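/- Let $\beta_1>0$ and $\beta_2>1$, and let $Z$ be the space of all measurable functions $\Phi:[0,\infty)\to\mathbb R$ with finite norm $$\|\Phi\|_Z=\sup_{0\le z\le 1}|\Phi(z)|+\sup_{z\ge 1}\bigl|\Phi(z)e^{\beta_1 z}z^{\beta_2}\bigr| .$$ Put $(\Phi_1*\Phi_2)(z)=\tfrac12\int_0^z\Phi_1(z-y)\Phi_2(y)\,dy$ and $\lambda_{LSW}=3(1/2)^{2/3}$, and for $\delta\ge 0$ put $$a_\delta(z)=\frac1{1+z-\lambda_{LSW}z^{1/3}+\delta z^{1/3}},\qquad b_\delta(z)=2-\tfrac13\lambda_{LSW}z^{-2/3}+\tfrac13\delta z^{-2/3}.$$ Let $\Phi_{LSW}(z)=C\exp\bigl(-\int_0^z a_0(y)b_0(y)\,dy\bigr)$ for $0\le z<\tfrac12$ and $\Phi_{LSW}(z)=0$ for $z\ge\tfrac12$, where $C$ is such that $\int_0^\infty z\,\Phi_{LSW}(z)\,dz=1$. For $\delta>0$ let $\psi(\cdot\,;\varepsilon,\tilde\varepsilon,\delta)$ be the solution of $\psi'=-a_\delta(z)\bigl(b_\delta(z)-\tilde\varepsilon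 z-\varepsilon\bigr)\psi$ on $[0,\infty)$ with $\int_0^1 z\,\psi(z)\,dz=1$, and set $$I[\Phi;\varepsilon,\tilde\varepsilon,\delta](z)=\varepsilon\int_z^\infty \xi\,a_\delta(\xi)\,\frac{\psi(z;\varepsilon,\tilde\varepsilon,\delta)}{\psi(\xi;\varepsilon,\tilde\varepsilon,\delta)}\,(\Phi*\Phi)(\xi)\,d\xi ,$$ $$\widehat\Phi_\delta=\chi_{[0,1]}\,\psi(\cdot\,;0,0,\delta),\qquad K_1(\delta)=\int_0^1 z\,\frac{\psi(z;0,0,\delta)}{\psi(1;0,0,\delta)}\,dz .$$ There exist functions $\delta\mapsto\mu_\delta$ such that, as $\delta\to0^+$, $$\mu_\delta=o(1),\qquad \frac1{\delta K_1(\delta)}=o(\mu_\delta^2),\qquad \|\widehat\Phi_\delta-\Phi_{LSW}\|_Z=o(\mu_\delta^2).$$ Fix any such $\mu_\delta$, put $\mathcal Y_\delta=\{\Phi\in Z:\ \|\Phi-\widehat\Phi_\delta\|_Z\le\mu_\delta^2\}$, and let $\eta>0$ be arbitrary. Then there is a function $L$ with $L(\delta)\to0$ as $\delta\to0^+$ such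 that the following holds for all sufficiently small $\delta>0$. 1. $\mathcal Y_\delta$ is a small ball around $\Phi_{LSW}$ in the sense that $\Phi_{LSW}\in\mathcal Y_\delta$ and $$\{\Phi\in Z:\|\Phi-\Phi_{LSW}\|_Z\le\tfrac12\mu_\delta^2\}\subseteq\mathcal Y_\delta\subseteq\{\Phi\in Z:\|\Phi-\Phi_{LSW}\|_Z\le2\mu_\delta^2\}.$$ 2. For each $\Phi\in\mathcal Y_\delta$ there is exactly one pair $(\varepsilon,\tilde\varepsilon)$ with $0<\varepsilon\le\eta\sqrt\delta$ and $0<\tilde\varepsilon\le\eta\sqrt\delta$ that satisfies the compatibility conditions $$\varepsilon\int_0^\infty z\,I[\Phi;\varepsilon,\tilde\varepsilon,\delta](z)\,dz=\varepsilon,\qquad \varepsilon\int_0^\infty I[\Phi;\varepsilon,\tilde\varepsilon,\delta](z)\,dz=\tilde\varepsilon .$$ Let $\bar I_\delta[\Phi]=I[\Phi;\varepsilon,\tilde\varepsilon,\delta]$ with this pair. 3. $\bar I_\delta$ maps $\mathcal Y_\delta$ into itself. 4. $\|\bar I_\delta[\Phi_2]-\bar I_\delta[\Phi_1]\|_Z\le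 L(\delta)\,\|\Phi_2-\Phi_1\|_Z$ for all $\Phi_1,\Phi_2\in\mathcal Y_\delta$; in particular $\bar I_\delta$ is a contraction on $\mathcal Y_\delta$ with Lipschitz constant $o(1)$ as $\delta\to0$. -/

import Mathlib

open Set Filter Topology MeasureTheory Asymptotics
open scoped ENNReal

namespace LSW

noncomputable section

/-! Functions on the half line `[0, ∞)` are represented by functions `ℝ → ℝ`; only their values at
`z ≥ 0` enter the definitions below. -/

/-- The mean field `λ_LSW = 3 (1/2)^(2/3)` of the smooth solution of the LSW model. -/
def lamLSW : ℝ := 3 * (1 / 2 : ℝ) ^ (2 / 3 : ℝ)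

/-- `a_δ(z) = 1 / (1 + z - λ_LSW z^(1/3) + δ z^(1/3))`. -/
def a (δ z : ℝ) : ℝ :=
  1 / (1 + z - lamLSW * z ^ (1 / 3 : ℝ) + δ * z ^ (1 / 3 : ℝ))

/-- `b_δ(z) = 2 - (1/3) λ_LSW z^(-2/3) + (1/3) δ z^(-2/3)`. -/
def b (δ z : ℝ) : ℝ :=
  2 - 1 / 3 * lamLSW * z ^ (-(2 / 3) : ℝ) + 1 / 3 * δ * z ^ (-(2 / 3) : ℝ)

/-- The unnormalized profile `exp (- ∫_0^z a_0 b_0)` on `[0, 1/2)`, and `0` elsewhere. The integral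
diverges to `+∞` as `z → 1/2`, so the value at the end point `z = 1/2` is `0`. -/
def phiLSWShape (z : ℝ) : ℝ :=
  if 0 ≤ z ∧ z < 1 / 2 then Real.exp (-∫ y in (0 : ℝ)..z, a 0 y * b 0 y) else 0

/-- The LSW profile `Φ_LSW`, normalized by `∫_0^∞ z Φ_LSW(z) dz = 1`. -/
def phiLSW (z : ℝ) : ℝ :=
  phiLSWShape z / ∫ y in Ioi (0 : ℝ), y * phiLSWShape y

/-- The solution with value `1` at `z = 0` of the homogeneous equation
`ψ' = - a_δ(z) (b_δ(z) - ε' z - ε) ψ`. -/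
def psiShape (ε ε' δ z : ℝ) : ℝ :=
  Real.exp (-∫ y in (0 : ℝ)..z, a δ y * (b δ y - ε' * y - ε))

/-- The solution `ψ(z; ε, ε', δ)` of the homogeneous equation that is normalized by
`∫_0^1 z ψ(z) dz = 1`. -/
def psi (ε ε' δ z : ℝ) : ℝ :=
  psiShape ε ε' δ z / ∫ y in (0 : ℝ)..1, y * psiShape ε ε' δ y

/-- The symmetric convolution `(Φ₁ * Φ₂)(z) = (1/2) ∫_0^z Φ₁(z - y) Φ₂(y) dy`. -/
def conv (Φ₁ Φ₂ : ℝ → ℝ) (z : ℝ) : ℝ :=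
  1 / 2 * ∫ y in (0 : ℝ)..z, Φ₁ (z - y) * Φ₂ y

/-- The integral operator
`I[Φ; ε, ε', δ](z) = ε ∫_z^∞ ξ a_δ(ξ) (ψ(z) / ψ(ξ)) (Φ * Φ)(ξ) dξ`. -/
def opI (Φ : ℝ → ℝ) (ε ε' δ z : ℝ) : ℝ :=
  ε * ∫ ξ in Ioi z, ξ * a δ ξ * (psi ε ε' δ z / psi ε ε' δ ξ) * conv Φ Φ ξ

/-- The pair `p = (ε, ε')` is admissible, `0 < ε, ε' ≤ η √δ`, and satisfies the compatibility
conditions `ε ∫_0^∞ z I[Φ; ε, ε', δ](z) dz = ε` and `ε ∫_0^∞ I[Φ; ε, ε', δ](z) dz = ε'`. -/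
def IsCompatible (η δ : ℝ) (Φ : ℝ → ℝ) (p : ℝ × ℝ) : Prop :=
  (0 < p.1 ∧ p.1 ≤ η * √δ) ∧ (0 < p.2 ∧ p.2 ≤ η * √δ) ∧
    p.1 * ∫ z in Ioi (0 : ℝ), z * opI Φ p.1 p.2 δ z = p.1 ∧
    p.1 * ∫ z in Ioi (0 : ℝ), opI Φ p.1 p.2 δ z = p.2

/-- The pair `(ε[Φ * Φ; δ], ε'[Φ * Φ; δ])` of admissible parameters that solves the compatibility
conditions. It is meaningful whenever there is exactly one such pair. -/
def params (η δ : ℝ) (Φ : ℝ → ℝ) : ℝ × ℝ :=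
  Classical.epsilon (IsCompatible η δ Φ)

/-- The fixed point operator `Ī_δ[Φ] = I[Φ; ε[Φ * Φ; δ], ε'[Φ * Φ; δ], δ]`. -/
def opIbar (η δ : ℝ) (Φ : ℝ → ℝ) : ℝ → ℝ :=
  opI Φ (params η δ Φ).1 (params η δ Φ).2 δ

/-- `sup_{0 ≤ z ≤ 1} |Φ(z)|`, with values in `[0, ∞]`. -/
def sNorm (Φ : ℝ → ℝ) : ℝ≥0∞ :=
  ⨆ z ∈ Icc (0 : ℝ) 1, ENNReal.ofReal |Φ z|

/-- `sup_{z ≥ 1} |Φ(z) exp(β₁ z) z^β₂|`, with values in `[0, ∞]`. -/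
def tNorm (β₁ β₂ : ℝ) (Φ : ℝ → ℝ) : ℝ≥0∞ :=
  ⨆ z ∈ Ici (1 : ℝ), ENNReal.ofReal |Φ z * Real.exp (β₁ * z) * z ^ β₂|

/-- The norm of the space `Z`, with values in `[0, ∞]`. -/
def zNorm (β₁ β₂ : ℝ) (Φ : ℝ → ℝ) : ℝ≥0∞ :=
  sNorm Φ + tNorm β₁ β₂ Φ

/-- The closed ball with centre `Φ₀` and radius `r` in the space `Z` of (Lebesgue) measurable
functions `Φ` on `[0, ∞)` with finite norm. -/
def zBall (β₁ β₂ : ℝ) (Φ₀ : ℝ → ℝ) (r : ℝ) : Set (ℝ → ℝ) :=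
  {Φ | (AEMeasurable Φ (volume.restrict (Ici 0)) ∧ zNorm β₁ β₂ Φ < ∞) ∧
    zNorm β₁ β₂ (Φ - Φ₀) ≤ ENNReal.ofReal r}

/-- `Φ̂_δ(z) = χ_[0,1](z) ψ(z; 0, 0, δ)`. -/
def phiHat (δ : ℝ) : ℝ → ℝ :=
  indicator (Icc 0 1) (psi 0 0 δ)

/-- The constant `K₁(δ) = ∫_0^1 z ψ(z; 0, 0, δ) / ψ(1; 0, 0, δ) dz`. -/
def K₁ (δ : ℝ) : ℝ :=
  ∫ z in (0 : ℝ)..1, z * (psi 0 0 δ z / psi 0 0 δ 1)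

/-- The conditions on `μ_δ`, as `δ → 0` from the right: `μ_δ = o(1)`, `1 / (δ K₁(δ)) = o(μ_δ²)`, and
`‖Φ̂_δ - Φ_LSW‖ = o(μ_δ²)`. -/
def IsRadius (β₁ β₂ : ℝ) (μ : ℝ → ℝ) : Prop :=
  Tendsto μ (𝓝[>] 0) (𝓝 0) ∧
    (fun δ => 1 / (δ * K₁ δ)) =o[𝓝[>] 0] (fun δ => μ δ ^ 2) ∧
    ∀ c > 0, ∀ᶠ δ in 𝓝[>] (0 : ℝ),
      zNorm β₁ β₂ (phiHat δ - phiLSW) ≤ ENNReal.ofReal (c * μ δ ^ 2)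

/-- The set `𝒴_δ = {Φ ∈ Z : ‖Φ - Φ̂_δ‖ ≤ μ_δ²}`. -/
def Y (β₁ β₂ : ℝ) (μ : ℝ → ℝ) (δ : ℝ) : Set (ℝ → ℝ) :=
  zBall β₁ β₂ (phiHat δ) (μ δ ^ 2)

end

end LSW

/-! Put u = z^(1/3) and c = (1/2)^(1/3). The denominator of `a δ` is (u - c)²(u + 2c) + δu: it has a
double zero at z = 1/2 that δ lifts, so it is comparable to (z - 1/2)² + δ on [0, 1]. Its derivative
is `b δ` - 1, so the homogeneous equation is solved explicitly by exp(-E)/den with E(z) = ∫_0^z (1 -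
ε - ε'y)/den dy. At ε = ε' = 0 the value E(1) lies between two multiples of δ^(-1/2); thus K = exp
E(1) beats every power of 1/δ. The whole argument rests on this: each loss is a power of 1/δ, each
gain a factor 1/K.

Let G = Φ * Φ. Splitting the integral over (z, ∞) as (0, ∞) minus (0, z] turns the operator into I =
ε (T exp(-E)/den - H/den), where T is the full integral and H, the part over (0, z], is bounded on
[0, 1]. The coefficient T is of order K: the limit profile vanishes beyond 1/2, but its convolution
square is bounded below on [3/5, 7/10], past the point where E picks up its size (`lowC_le_lead`,
`lead_ge`). Hence the moments εA and εB of I with weights z and 1 have A and B of order K, up to an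
error O(1/δ) (`totMom_eq`).

The compatibility conditions say εA = 1 and ε²B = ε', that is, (ε, ε') is a fixed point of (1/A,
B/A²). Since A and B vary by O(K/δ) per unit of the parameters, this map has Lipschitz constant
O(1/(δK)), and the contraction principle on [0, η√δ]² gives the unique pair, of size O(1/K)
(`existsUnique_parMap`). On this range the parameters change E by O(1) only, because E(1) =
O(δ^(-1/2)).

At the fixed point the relation εA = 1 eliminates T, and on [0, 1] the operator equals ψ(1 + εR) -
εH/den with R = O(1/δ) (`opI_eq_of_fixed`). As ε and ε' are O(1/K), this is within O(1/(δK)) of ψ at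
ε = ε' = 0, hence of the centre of the ball, and 1/(δK) is comparable to 1/(δK₁) = o(μ²): the ball
is mapped into itself. The same decomposition applied to differences gives a Lipschitz constant
O(1/(δK)). Beyond z = 1 the kernel grows at most like a slow exponential, which the weight of Z
absorbs; the weight is stable under convolution because β₂ > 1. -/

namespace LSW

/-! ### The denominator of `a δ`: factorization and two-sided bounds. -/

noncomputable section

/-- The denominator of `a δ`, extended evenly to negative arguments. -/
def den (δ z : ℝ) : ℝ :=
  1 + |z| - lamLSW * |z| ^ (1 / 3 : ℝ) + δ * |z| ^ (1 / 3 : ℝ)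

lemma continuous_den (δ : ℝ) : Continuous (den δ) := by
  have h : Continuous fun z : ℝ => |z| ^ (1 / 3 : ℝ) :=
    continuous_abs.rpow_const fun _ => Or.inr (by norm_num)
  unfold den
  fun_prop

lemma a_eq {δ z : ℝ} (hz : 0 ≤ z) : a δ z = 1 / den δ z := by
  simp only [a, den, abs_of_nonneg hz]

/-- The cube root of `1/2`. -/
def cbrtHalf : ℝ := (1 / 2 : ℝ) ^ (1 / 3 : ℝ)

lemma cbrtHalf_pos : 0 < cbrtHalf := by unfold cbrtHalf; positivity

lemma cbrtHalf_pow : cbrtHalf ^ 3 = 1 / 2 := by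
  unfold cbrtHalf
  rw [← Real.rpow_natCast, ← Real.rpow_mul (by norm_num)]
  norm_num

lemma lamLSW_eq : lamLSW = 3 * cbrtHalf ^ 2 := by
  unfold lamLSW cbrtHalf
  rw [← Real.rpow_natCast, ← Real.rpow_mul (by norm_num)]
  norm_num

lemma cbrtHalf_gt : 3 / 4 < cbrtHalf := by
  by_contra! h
  have := pow_le_pow_left₀ cbrtHalf_pos.le h 3
  rw [cbrtHalf_pow] at this
  norm_num at this

lemma cbrtHalf_lt : cbrtHalf < 4 / 5 := by
  by_contra! h
  have := pow_le_pow_left₀ (by norm_num) h 3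
  rw [cbrtHalf_pow] at this
  norm_num at this

/-- Because 2c³ = 1, the cubic u³ - 3c²u + 1 has the double root u = c; this is the reason for the
value of `lamLSW`. -/
lemma den_eq {δ z : ℝ} : ∃ u : ℝ, u = |z| ^ (1 / 3 : ℝ) ∧ 0 ≤ u ∧ u ^ 3 = |z| ∧
    den δ z = (u - cbrtHalf) ^ 2 * (u + 2 * cbrtHalf) + δ * u := by
  refine ⟨|z| ^ (1 / 3 : ℝ), rfl, by positivity, ?_, ?_⟩
  · rw [← Real.rpow_natCast, ← Real.rpow_mul (abs_nonneg z)]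
    norm_num
  · have h : (|z| ^ (1 / 3 : ℝ)) ^ 3 = |z| := by
      rw [← Real.rpow_natCast, ← Real.rpow_mul (abs_nonneg z)]
      norm_num
    unfold den
    rw [lamLSW_eq]
    set u := |z| ^ (1 / 3 : ℝ)
    rw [← h]
    linear_combination (-2 : ℝ) * cbrtHalf_pow

/-- The factor u² + uc + c² in z - 1/2 = (u - c)(u² + uc + c²) is bounded above and away from zero
on [0, 1], so the order of the zero is the same in z as in u. -/
lemma le_den {δ z : ℝ} (hδ : 0 ≤ δ) (hδ1 : δ ≤ 1) (hz : z ∈ Icc (0 : ℝ) 1) :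
    ((z - 1 / 2) ^ 2 + δ) / 32 ≤ den δ z := by
  obtain ⟨u, -, hu0, hu3, h⟩ := den_eq (δ := δ) (z := z)
  rw [abs_of_nonneg hz.1] at hu3
  rw [h]
  have c3 := cbrtHalf_pow
  have c1 := cbrtHalf_gt
  have c2 := cbrtHalf_lt
  set c := cbrtHalf
  have hu1 : u ≤ 1 := by
    by_contra! hh
    have := one_lt_pow₀ hh (n := 3) (by norm_num)
    linarith [hz.2]
  have e1 : (z - 1 / 2) ^ 2 ≤ 9 * (u - c) ^ 2 := by
    have : z - 1 / 2 = (u - c) * (u ^ 2 + u * c + c ^ 2) := by rw [← hu3, ← c3]; ring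
    rw [this, mul_pow, mul_comm]
    have h3 : u ^ 2 + u * c + c ^ 2 ≤ 3 := by nlinarith
    have h4 : 0 ≤ u ^ 2 + u * c + c ^ 2 := by positivity
    gcongr
    nlinarith
  have e2 : (u - c) ^ 2 * (3 / 2) ≤ (u - c) ^ 2 * (u + 2 * c) := by
    gcongr; linarith
  -- The term δu degenerates at u = 0; there u is far from c and the quadratic term takes over.
  have e3 : δ / 16 ≤ (u - c) ^ 2 * (1 / 2) + δ * u := by
    rcases le_total u (1 / 4) with h4 | h4
    · have : (1 / 2 : ℝ) ^ 2 ≤ (c - u) ^ 2 := by gcongr; linarith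
      nlinarith
    · nlinarith [sq_nonneg (u - c)]
  nlinarith [sq_nonneg (u - c)]

lemma den_le {δ z : ℝ} (hδ : 0 ≤ δ) (hz : z ∈ Icc (0 : ℝ) 1) :
    den δ z ≤ 48 * ((z - 1 / 2) ^ 2 + δ) := by
  obtain ⟨u, -, hu0, hu3, h⟩ := den_eq (δ := δ) (z := z)
  rw [abs_of_nonneg hz.1] at hu3
  rw [h]
  have c3 := cbrtHalf_pow
  have c1 := cbrtHalf_gt
  have c2 := cbrtHalf_lt
  set c := cbrtHalf
  have hu1 : u ≤ 1 := by
    by_contra! hh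
    have := one_lt_pow₀ hh (n := 3) (by norm_num)
    linarith [hz.2]
  have e1 : (u - c) ^ 2 ≤ 4 * (z - 1 / 2) ^ 2 := by
    have : z - 1 / 2 = (u - c) * (u ^ 2 + u * c + c ^ 2) := by rw [← hu3, ← c3]; ring
    rw [this, mul_pow]
    have h3 : 1 / 2 ≤ u ^ 2 + u * c + c ^ 2 := by nlinarith
    have h4 : (1 / 2 : ℝ) ^ 2 ≤ (u ^ 2 + u * c + c ^ 2) ^ 2 := by gcongr
    nlinarith [sq_nonneg (u - c)]
  have e2 : (u - c) ^ 2 * (u + 2 * c) ≤ (u - c) ^ 2 * 3 := by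
    gcongr; linarith
  nlinarith

/-- Since c < 4/5, u ≥ 1 forces u - c ≥ u/5, whence (u - c)²(u + 2c) ≥ u³/25. -/
lemma le_den_of_one_le {δ z : ℝ} (hδ : 0 ≤ δ) (hz : 1 ≤ z) : z / 25 ≤ den δ z := by
  obtain ⟨u, -, hu0, hu3, h⟩ := den_eq (δ := δ) (z := z)
  rw [abs_of_nonneg (by linarith)] at hu3
  rw [h, ← hu3]
  have c1 := cbrtHalf_gt
  have c2 := cbrtHalf_lt
  set c := cbrtHalf
  have hu1 : 1 ≤ u := by
    by_contra! hh
    have := pow_lt_one₀ hu0 hh (n := 3) (by norm_num)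
    linarith
  have e1 : (u / 5) ^ 2 ≤ (u - c) ^ 2 := by gcongr; linarith
  have e2 : (u / 5) ^ 2 * u ≤ (u - c) ^ 2 * (u + 2 * c) := by gcongr; linarith
  have := mul_nonneg hδ hu0
  nlinarith

lemma den_abs (δ z : ℝ) : den δ |z| = den δ z := by simp [den]

lemma den_zero (δ : ℝ) : den δ 0 = 1 := by simp [den]

/-- The even extension pays off here: positivity on the whole line makes the integrands and
primitives below continuous on ℝ without any side condition. -/
lemma den_pos {δ : ℝ} (hδ : 0 < δ) (hδ1 : δ ≤ 1) (z : ℝ) : 0 < den δ z := by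
  rw [← den_abs]
  rcases le_total |z| 1 with h | h
  · have := le_den hδ.le hδ1 (z := |z|) ⟨abs_nonneg z, h⟩
    have h2 : 0 < ((|z| - 1 / 2) ^ 2 + δ) / 32 := by positivity
    linarith
  · have := le_den_of_one_le hδ.le h
    linarith

lemma den_zero_pos {z : ℝ} (hz : 0 ≤ z) (hz1 : z < 1 / 2) : 0 < den 0 z := by
  have := le_den le_rfl zero_le_one (z := z) ⟨hz, by linarith⟩
  have h2 : 0 < (z - 1 / 2) ^ 2 := sq_pos_of_neg (by linarith)
  linarith

/-- The quantity (1 + y)/den bounds the derivative of (1 - ε - ε'y)/den in (ε, ε'); it is the source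
of every factor 64/δ below. -/
lemma one_add_div_den_le {δ y : ℝ} (hδ : 0 < δ) (hδ1 : δ ≤ 1) (hy : 0 ≤ y) :
    (1 + y) / den δ y ≤ 64 / δ := by
  rw [div_le_div_iff₀ (den_pos hδ hδ1 y) hδ]
  rcases le_total y 1 with h | h
  · have := le_den hδ.le hδ1 (z := y) ⟨hy, h⟩
    nlinarith [sq_nonneg (y - 1 / 2)]
  · have := le_den_of_one_le hδ.le h
    nlinarith

lemma one_div_den_le {δ z : ℝ} (hδ : 0 < δ) (hδ1 : δ ≤ 1) (hz : z ∈ Icc (0 : ℝ) 1) :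
    1 / den δ z ≤ 32 / δ := by
  rw [div_le_div_iff₀ (den_pos hδ hδ1 z) hδ]
  have := le_den hδ.le hδ1 hz
  nlinarith [sq_nonneg (z - 1 / 2)]

lemma den_mono_left {δ δ' : ℝ} (h : δ ≤ δ') (z : ℝ) : den δ z ≤ den δ' z := by
  unfold den
  gcongr

/-- This identity makes the homogeneous equation explicit: it splits `a δ * b δ` into the
logarithmic derivative of the denominator and 1/den. -/
lemma hasDerivAt_den (δ : ℝ) {z : ℝ} (hz : 0 < z) : HasDerivAt (den δ) (b δ z - 1) z := by
  have h1 : HasDerivAt (fun y : ℝ => y ^ (1 / 3 : ℝ)) ((1 / 3 : ℝ) * z ^ (-(2 / 3) : ℝ)) z := by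
    have := Real.hasDerivAt_rpow_const (x := z) (p := 1 / 3) (Or.inl hz.ne')
    convert this using 3
    norm_num
  have h2 : HasDerivAt (fun y : ℝ => 1 + y - lamLSW * y ^ (1 / 3 : ℝ) + δ * y ^ (1 / 3 : ℝ))
      (b δ z - 1) z := by
    have := (((hasDerivAt_id z).const_add 1).sub (h1.const_mul lamLSW)).add (h1.const_mul δ)
    refine this.congr_deriv ?_
    unfold b
    ring
  refine h2.congr_of_eventuallyEq ?_
  filter_upwards [lt_mem_nhds hz] with y hy
  simp [den, abs_of_pos hy]

end

end LSW

/-! ### The homogeneous solution in closed form and estimates of its exponent. -/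

namespace LSW

noncomputable section

/-- The exponent `∫_0^z (1 - ε - ε' y) / den δ y dy`, for `p = (ε, ε')`. -/
def expo (δ : ℝ) (p : ℝ × ℝ) (z : ℝ) : ℝ :=
  ∫ y in (0 : ℝ)..z, (1 - p.1 - p.2 * y) / den δ y

/-- Closed form of the homogeneous solution `psiShape`. -/
def homSol (δ : ℝ) (p : ℝ × ℝ) (z : ℝ) : ℝ := Real.exp (-expo δ p z) / den δ z

/-- The exponent of `psiShape` is E(z) + log den(z), as den(0) = 1. Positivity is asked on [0, z]
only, so that the formula also covers δ = 0 with z < 1/2, the limit profile. -/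
lemma psiShape_eq_of_den_pos {δ z : ℝ} {p : ℝ × ℝ} (hz : 0 ≤ z)
    (h : ∀ y ∈ Icc 0 z, 0 < den δ y) : psiShape p.1 p.2 δ z = homSol δ p z := by
  have hcd : ContinuousOn (fun y => 1 / den δ y) (uIcc 0 z) := by
    rw [uIcc_of_le hz]
    exact continuousOn_const.div (continuous_den δ).continuousOn fun y hy => (h y hy).ne'
  have hb : IntervalIntegrable (fun y => b δ y - 1) volume 0 z := by
    have h1 : IntervalIntegrable (fun y : ℝ => y ^ (-(2 / 3) : ℝ)) volume 0 z :=
      intervalIntegral.intervalIntegrable_rpow' (by norm_num)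
    have h2 : IntervalIntegrable (fun _ : ℝ => (1 : ℝ)) volume 0 z := intervalIntegrable_const
    have := h2.add (h1.const_mul (-(1 / 3 * lamLSW) + 1 / 3 * δ))
    refine this.congr fun y _ => ?_
    simp only [b]
    ring
  have hlog : IntervalIntegrable (fun y => (b δ y - 1) * (1 / den δ y)) volume 0 z :=
    hb.mul_continuousOn hcd
  have hrate : IntervalIntegrable (fun y => (1 - p.1 - p.2 * y) / den δ y) volume 0 z := by
    refine ContinuousOn.intervalIntegrable ?_
    rw [uIcc_of_le hz]
    exact ContinuousOn.div (by fun_prop) (continuous_den δ).continuousOn fun y hy => (h y hy).ne'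
  have hint : ∫ y in (0 : ℝ)..z, (b δ y - 1) * (1 / den δ y) = Real.log (den δ z) := by
    -- The derivative has the integrable singularity y^(-2/3) at 0, so it is used on the open
    -- interval only.
    rw [intervalIntegral.integral_eq_sub_of_hasDerivAt_of_le hz
      (f := fun y => Real.log (den δ y)) _ _ hlog]
    · simp [den_zero]
    · exact (continuous_den δ).continuousOn.log fun y hy => (h y hy).ne'
    · intro y hy
      have := (hasDerivAt_den δ hy.1).log (h y ⟨hy.1.le, hy.2.le⟩).ne'
      simpa [div_eq_mul_inv] using this
  have hsum : ∫ y in (0 : ℝ)..z, a δ y * (b δ y - p.2 * y - p.1) =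
      expo δ p z + Real.log (den δ z) := by
    rw [← hint, expo, ← intervalIntegral.integral_add hrate hlog]
    refine intervalIntegral.integral_congr fun y hy => ?_
    rw [uIcc_of_le hz] at hy
    simp only [a_eq hy.1]
    ring
  have hpos := h z ⟨hz, le_rfl⟩
  rw [psiShape, hsum, homSol, neg_add, Real.exp_add, Real.exp_neg (Real.log _),
    Real.exp_log hpos]
  rfl

variable {δ : ℝ} {p q : ℝ × ℝ}

lemma psiShape_eq (hδ : 0 < δ) (hδ1 : δ ≤ 1) (p : ℝ × ℝ) {z : ℝ} (hz : 0 ≤ z) :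
    psiShape p.1 p.2 δ z = homSol δ p z :=
  psiShape_eq_of_den_pos hz fun y _ => den_pos hδ hδ1 y

lemma continuous_rate (hδ : 0 < δ) (hδ1 : δ ≤ 1) (p : ℝ × ℝ) :
    Continuous fun y => (1 - p.1 - p.2 * y) / den δ y :=
  Continuous.div (by fun_prop) (continuous_den δ) fun y => (den_pos hδ hδ1 y).ne'

lemma continuous_expo (hδ : 0 < δ) (hδ1 : δ ≤ 1) (p : ℝ × ℝ) : Continuous (expo δ p) :=
  intervalIntegral.continuous_primitive
    (fun _ _ => (continuous_rate hδ hδ1 p).intervalIntegrable _ _) 0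

lemma continuous_homSol (hδ : 0 < δ) (hδ1 : δ ≤ 1) (p : ℝ × ℝ) : Continuous (homSol δ p) :=
  (Real.continuous_exp.comp (continuous_expo hδ hδ1 p).neg).div (continuous_den δ)
    fun y => (den_pos hδ hδ1 y).ne'

lemma homSol_pos (hδ : 0 < δ) (hδ1 : δ ≤ 1) (p : ℝ × ℝ) (z : ℝ) : 0 < homSol δ p z :=
  div_pos (Real.exp_pos _) (den_pos hδ hδ1 z)

lemma expo_sub (hδ : 0 < δ) (hδ1 : δ ≤ 1) (p : ℝ × ℝ) (z ξ : ℝ) :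
    expo δ p ξ - expo δ p z = ∫ y in z..ξ, (1 - p.1 - p.2 * y) / den δ y :=
  intervalIntegral.integral_interval_sub_left
    ((continuous_rate hδ hδ1 p).intervalIntegrable _ _)
    ((continuous_rate hδ hδ1 p).intervalIntegrable _ _)

lemma expo_zero_right (δ : ℝ) (p : ℝ × ℝ) : expo δ p 0 = 0 := by simp [expo]

/-- The increments of the exponent are largest at `p = 0`. -/
lemma expo_sub_le (hδ : 0 < δ) (hδ1 : δ ≤ 1) (hp : 0 ≤ p) {z ξ : ℝ} (hz : 0 ≤ z) (h : z ≤ ξ) :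
    expo δ p ξ - expo δ p z ≤ expo δ 0 ξ - expo δ 0 z := by
  rw [expo_sub hδ hδ1, expo_sub hδ hδ1]
  refine intervalIntegral.integral_mono_on h
    ((continuous_rate hδ hδ1 p).intervalIntegrable _ _)
    ((continuous_rate hδ hδ1 0).intervalIntegrable _ _) fun y hy => ?_
  have h1 : 0 ≤ p.1 := hp.1
  have h2 : 0 ≤ p.2 * y := mul_nonneg hp.2 (hz.trans hy.1)
  have := den_pos hδ hδ1 y
  refine div_le_div_of_nonneg_right ?_ this.le
  simp only [Prod.fst_zero, Prod.snd_zero]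
  linarith

/-- The bound on the sum of the parameters keeps 1 - ε - ε'y nonnegative on [0, 1]; farther out the
integrand may change sign. -/
lemma expo_mono (hδ : 0 < δ) (hδ1 : δ ≤ 1) (hp : 0 ≤ p) (hp1 : p.1 + p.2 ≤ 1) {z ξ : ℝ}
    (h : z ≤ ξ) (hξ : ξ ≤ 1) : expo δ p z ≤ expo δ p ξ := by
  rw [← sub_nonneg, expo_sub hδ hδ1]
  refine intervalIntegral.integral_nonneg h fun y hy => ?_
  refine div_nonneg ?_ (den_pos hδ hδ1 y).le
  have h2 : 0 ≤ p.2 := hp.2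
  nlinarith [hy.2]

lemma expo_zero_mono (hδ : 0 < δ) (hδ1 : δ ≤ 1) {z ξ : ℝ} (h : z ≤ ξ) :
    expo δ 0 z ≤ expo δ 0 ξ := by
  rw [← sub_nonneg, expo_sub hδ hδ1]
  refine intervalIntegral.integral_nonneg h fun y hy => ?_
  simpa using (den_pos hδ hδ1 y).le

/-- Lipschitz dependence of the increments of the exponent on the parameters. -/
lemma abs_expo_sub_sub_le (hδ : 0 < δ) (hδ1 : δ ≤ 1) (p q : ℝ × ℝ) {z ξ : ℝ} (hz : 0 ≤ z)
    (h : z ≤ ξ) :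
    |(expo δ p ξ - expo δ p z) - (expo δ q ξ - expo δ q z)| ≤ 64 / δ * ‖p - q‖ * (ξ - z) := by
  rw [expo_sub hδ hδ1, expo_sub hδ hδ1, ← intervalIntegral.integral_sub
    ((continuous_rate hδ hδ1 p).intervalIntegrable _ _)
    ((continuous_rate hδ hδ1 q).intervalIntegrable _ _), ← Real.norm_eq_abs]
  have hb : ∀ y ∈ uIoc z ξ, ‖(1 - p.1 - p.2 * y) / den δ y - (1 - q.1 - q.2 * y) / den δ y‖ ≤
      64 / δ * ‖p - q‖ := by
    intro y hy
    rw [uIoc_of_le h] at hy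
    have hy0 : 0 ≤ y := hz.trans hy.1.le
    have hd := den_pos hδ hδ1 y
    have e : (1 - p.1 - p.2 * y) / den δ y - (1 - q.1 - q.2 * y) / den δ y =
        -(((p - q).1 + (p - q).2 * y) / den δ y) := by
      simp only [Prod.fst_sub, Prod.snd_sub]
      field_simp
      ring
    rw [e, norm_neg, norm_div, Real.norm_eq_abs (den δ y), abs_of_pos hd]
    have h1 : ‖(p - q).1 + (p - q).2 * y‖ ≤ ‖p - q‖ * (1 + y) := by
      refine (norm_add_le _ _).trans ?_
      rw [norm_mul, Real.norm_eq_abs y, abs_of_nonneg hy0, mul_add, mul_one]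
      gcongr
      · exact norm_fst_le _
      · exact norm_snd_le _
    calc _ ≤ ‖p - q‖ * (1 + y) / den δ y := by gcongr
      _ = (1 + y) / den δ y * ‖p - q‖ := by ring
      _ ≤ _ := mul_le_mul_of_nonneg_right (one_add_div_den_le hδ hδ1 hy0) (norm_nonneg _)
  have := intervalIntegral.norm_integral_le_of_norm_le_const hb
  rwa [abs_of_nonneg (sub_nonneg.2 h)] at this

/-- Beyond `z = 1` the exponent grows at most with an arbitrarily small linear rate. -/
lemma expo_sub_le_of_one_le (hδ : 0 < δ) (hδ1 : δ ≤ 1) (hp : 0 ≤ p) {κ : ℝ} (hκ : 0 < κ)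
    {z ξ : ℝ} (hz : 1 ≤ z) (h : z ≤ ξ) :
    expo δ p ξ - expo δ p z ≤ 25 ^ 2 / (4 * κ) + κ * (ξ - z) := by
  have hc2 : ContinuousOn (fun y : ℝ => 25 ^ 2 / (4 * κ) * (y ^ 2)⁻¹ + κ) (uIcc z ξ) := by
    rw [uIcc_of_le h]
    refine ContinuousOn.add (continuousOn_const.mul (ContinuousOn.inv₀ (by fun_prop) ?_))
      continuousOn_const
    intro y hy
    have : 0 < y := by linarith [hy.1]
    positivity
  refine (expo_sub_le hδ hδ1 hp (by linarith) h).trans ?_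
  rw [expo_sub hδ hδ1]
  have hmono : ∫ y in z..ξ, (1 - (0 : ℝ × ℝ).1 - (0 : ℝ × ℝ).2 * y) / den δ y ≤
      ∫ y in z..ξ, (25 ^ 2 / (4 * κ) * (y ^ 2)⁻¹ + κ) := by
    refine intervalIntegral.integral_mono_on h
      ((continuous_rate hδ hδ1 0).intervalIntegrable _ _) hc2.intervalIntegrable fun y hy => ?_
    have hy1 : 1 ≤ y := hz.trans hy.1
    have hd := le_den_of_one_le hδ.le hy1
    have hy0 : 0 < y := by linarith
    calc _ ≤ 1 / (y / 25) := by
          simp only [Prod.fst_zero, Prod.snd_zero, sub_zero, zero_mul]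
          gcongr
      _ ≤ _ := by
        -- Completing the square: 25/y ≤ 25²/(4κy²) + κ. The first term has a bounded integral over
        -- [1, ∞), the second is the slow linear rate.
        have : 25 ^ 2 / (4 * κ) * (y ^ 2)⁻¹ + κ - 1 / (y / 25) =
            (25 - 2 * κ * y) ^ 2 / (4 * κ * y ^ 2) := by
          field_simp
          ring
        have h2 : 0 ≤ (25 - 2 * κ * y) ^ 2 / (4 * κ * y ^ 2) := by positivity
        linarith
  refine hmono.trans ?_
  have hi : ∫ y in z..ξ, (25 ^ 2 / (4 * κ) * (y ^ 2)⁻¹ + κ) =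
      (-(25 ^ 2 / (4 * κ)) * ξ⁻¹ + κ * ξ) - (-(25 ^ 2 / (4 * κ)) * z⁻¹ + κ * z) := by
    refine intervalIntegral.integral_eq_sub_of_hasDerivAt
      (f := fun y => -(25 ^ 2 / (4 * κ)) * y⁻¹ + κ * y) (fun y hy => ?_) hc2.intervalIntegrable
    rw [uIcc_of_le h] at hy
    have hy0 : y ≠ 0 := by linarith [hy.1]
    have := ((hasDerivAt_inv hy0).const_mul (-(25 ^ 2 / (4 * κ)))).add
      ((hasDerivAt_id y).const_mul κ)
    refine this.congr_deriv ?_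
    ring
  rw [hi]
  have hξ0 : 0 < ξ := by linarith
  have h1 : 0 ≤ 25 ^ 2 / (4 * κ) * ξ⁻¹ := by positivity
  have h2 : 25 ^ 2 / (4 * κ) * z⁻¹ ≤ 25 ^ 2 / (4 * κ) := by
    have : z⁻¹ ≤ 1 := inv_le_one_of_one_le₀ hz
    have h3 : 0 ≤ 25 ^ 2 / (4 * κ) := by positivity
    nlinarith
  linarith

/-- `∫_0^1 1 / den δ = O(δ^(-1/2))`. -/
lemma expo_zero_one_le (hδ : 0 < δ) (hδ1 : δ ≤ 1) : expo δ 0 1 ≤ 32 * Real.pi / √δ := by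
  have hs : 0 < √δ := Real.sqrt_pos.2 hδ
  have hsq : √δ ^ 2 = δ := Real.sq_sqrt hδ.le
  have hc : Continuous fun y : ℝ => 32 / ((y - 1 / 2) ^ 2 + δ) :=
    continuous_const.div (by fun_prop) fun y => by positivity
  have hmono : expo δ 0 1 ≤ ∫ y in (0 : ℝ)..1, 32 / ((y - 1 / 2) ^ 2 + δ) := by
    refine intervalIntegral.integral_mono_on zero_le_one
      ((continuous_rate hδ hδ1 0).intervalIntegrable _ _) (hc.intervalIntegrable _ _)
      fun y hy => ?_
    have := le_den hδ.le hδ1 hy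
    have hd := den_pos hδ hδ1 y
    simp only [Prod.fst_zero, Prod.snd_zero, sub_zero, zero_mul]
    rw [div_le_div_iff₀ hd (by positivity)]
    linarith
  have hi : ∫ y in (0 : ℝ)..1, 32 / ((y - 1 / 2) ^ 2 + δ) =
      32 / √δ * Real.arctan ((1 - 1 / 2) / √δ) - 32 / √δ * Real.arctan ((0 - 1 / 2) / √δ) := by
    refine intervalIntegral.integral_eq_sub_of_hasDerivAt
      (f := fun y => 32 / √δ * Real.arctan ((y - 1 / 2) / √δ)) (fun y _ => ?_)
      (hc.intervalIntegrable _ _)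
    have := ((((hasDerivAt_id y).sub_const (1 / 2)).div_const (√δ)).arctan).const_mul (32 / √δ)
    refine this.congr_deriv ?_
    have : (id y - 1 / 2) ^ 2 + √δ ^ 2 ≠ 0 := by positivity
    simp only [id] at this ⊢
    have h4 : 32 / ((y - 1 / 2) ^ 2 + δ) = 32 / ((y - 1 / 2) ^ 2 + √δ ^ 2) := by rw [hsq]
    rw [h4]
    field_simp
    ring
  rw [hi] at hmono
  have h1 := (Real.arctan_lt_pi_div_two ((1 - 1 / 2) / √δ)).le
  have h2 := (Real.neg_pi_div_two_lt_arctan ((0 - 1 / 2) / √δ)).le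
  have h3 : 0 < 32 / √δ := by positivity
  calc _ ≤ _ := hmono
    _ ≤ 32 / √δ * (Real.pi / 2) - 32 / √δ * (-(Real.pi / 2)) := by gcongr
    _ = _ := by ring

/-- On `[0, 1]` parameters of size `O(√δ)` change the exponent by `O(1)`. -/
lemma expo_zero_sub_expo_le (hδ : 0 < δ) (hδ1 : δ ≤ 1) {η : ℝ} (hη : 0 ≤ η)
    (hp : p ∈ Icc (0 : ℝ × ℝ) (η * √δ, η * √δ)) {z : ℝ} (hz : z ∈ Icc (0 : ℝ) 1) :
    expo δ 0 z - expo δ p z ≤ 64 * Real.pi * η := by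
  have hs : 0 < √δ := Real.sqrt_pos.2 hδ
  have h1 : p.1 ≤ η * √δ := hp.2.1
  have h2 : p.2 ≤ η * √δ := hp.2.2
  have h20 : 0 ≤ p.2 := hp.1.2
  calc expo δ 0 z - expo δ p z = ∫ y in (0 : ℝ)..z,
        ((1 - (0 : ℝ × ℝ).1 - (0 : ℝ × ℝ).2 * y) / den δ y - (1 - p.1 - p.2 * y) / den δ y) :=
        (intervalIntegral.integral_sub ((continuous_rate hδ hδ1 0).intervalIntegrable _ _)
          ((continuous_rate hδ hδ1 p).intervalIntegrable _ _)).symm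
    -- For y ≤ 1 one has ε + ε'y ≤ 2η√δ, and this √δ cancels the δ^(-1/2) of the integral of 1/den.
    -- It explains the size of the parameter range.
    _ ≤ ∫ y in (0 : ℝ)..z, 2 * (η * √δ) *
          ((1 - (0 : ℝ × ℝ).1 - (0 : ℝ × ℝ).2 * y) / den δ y) := by
        refine intervalIntegral.integral_mono_on hz.1
          (((continuous_rate hδ hδ1 0).sub (continuous_rate hδ hδ1 p)).intervalIntegrable _ _)
          ((continuous_const.mul (continuous_rate hδ hδ1 0)).intervalIntegrable _ _)
          fun y hy => ?_
        have hd := den_pos hδ hδ1 y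
        rw [← sub_div, ← mul_div_assoc]
        gcongr
        simp only [Prod.fst_zero, Prod.snd_zero]
        nlinarith [hy.1, hy.2, hz.2]
    _ = 2 * (η * √δ) * expo δ 0 z := intervalIntegral.integral_const_mul _ _
    _ ≤ 2 * (η * √δ) * (32 * Real.pi / √δ) := by
        gcongr
        exact (expo_zero_mono hδ hδ1 hz.2).trans (expo_zero_one_le hδ hδ1)
    _ = _ := by field_simp; ring

end

end LSW

/-! ### Bounds for the profiles and normalizing constants, uniform in δ. -/

namespace LSW

noncomputable section

variable {δ : ℝ} {p q : ℝ × ℝ}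

lemma continuousOn_one_div_den {z : ℝ} (h : ∀ y ∈ Icc 0 z, 0 < den δ y) :
    ContinuousOn (fun y => 1 / den δ y) (Icc 0 z) :=
  continuousOn_const.div (continuous_den δ).continuousOn fun y hy => (h y hy).ne'

lemma expo_zero_eq (δ z : ℝ) : expo δ 0 z = ∫ y in (0 : ℝ)..z, 1 / den δ y := by
  simp [expo]

/-- With r = max(√δ, 1/2 - z), the interval of length r that ends at min(z, 1/2) lies within 2r of
1/2, and δ ≤ r². There den ≤ 48(4r² + r²) = 240r², so this interval alone contributes 1/(240r). The
case δ = 0, z < 1/2 is included. -/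
lemma le_expo_zero {z : ℝ} (hδ : 0 ≤ δ) (hδ1 : δ ≤ 1 / 16) (hz : 1 / 4 ≤ z) (hz1 : z ≤ 1)
    (h : ∀ y ∈ Icc 0 z, 0 < den δ y) (hr : 0 < max (√δ) (1 / 2 - z)) :
    1 / (240 * max (√δ) (1 / 2 - z)) ≤ expo δ 0 z := by
  have hsq : √δ ^ 2 = δ := Real.sq_sqrt hδ
  have hs4 : √δ ≤ 1 / 4 := Real.sqrt_le_iff.2 ⟨by norm_num, by norm_num; linarith⟩
  set r := max (√δ) (1 / 2 - z) with hrdef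
  have hr4 : r ≤ 1 / 4 := max_le hs4 (by linarith)
  have hδr : δ ≤ r ^ 2 := by
    rw [← hsq]
    exact pow_le_pow_left₀ (Real.sqrt_nonneg _) (le_max_left _ _) 2
  set t := min z (1 / 2) with htdef
  have ht : 1 / 4 ≤ t := le_min hz (by norm_num)
  have htz : t ≤ z := min_le_left _ _
  have ht2 : t ≤ 1 / 2 := min_le_right _ _
  have htr : 1 / 2 - t ≤ r := by
    rcases min_choice z (1 / 2) with h1 | h1
    · rw [htdef, h1]; exact le_max_right _ _
    · rw [htdef, h1]; linarith
  have hint : IntervalIntegrable (fun y => 1 / den δ y) volume 0 z := by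
    refine ContinuousOn.intervalIntegrable ?_
    rw [uIcc_of_le (by linarith)]
    exact continuousOn_one_div_den h
  have hint2 : IntervalIntegrable (fun y => 1 / den δ y) volume (t - r) t := by
    refine hint.mono_set ?_
    rw [uIcc_of_le (by linarith), uIcc_of_le (by linarith)]
    exact Icc_subset_Icc (by linarith) htz
  rw [expo_zero_eq]
  calc 1 / (240 * r) = ∫ _ in (t - r)..t, 1 / (240 * r ^ 2) := by
        rw [intervalIntegral.integral_const, smul_eq_mul]
        field_simp
        ring
    _ ≤ ∫ y in (t - r)..t, 1 / den δ y := by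
        refine intervalIntegral.integral_mono_on (by linarith) intervalIntegrable_const hint2 ?_
        intro y hy
        have hy0 : 0 ≤ y := by linarith [hy.1]
        have hd := h y ⟨hy0, hy.2.trans htz⟩
        have hu := den_le (z := y) hδ ⟨hy0, by linarith [hy.2]⟩
        have : (y - 1 / 2) ^ 2 ≤ (2 * r) ^ 2 := sq_le_sq' (by linarith [hy.1]) (by linarith [hy.2])
        refine one_div_le_one_div_of_le hd ?_
        nlinarith
    _ ≤ ∫ y in (0 : ℝ)..z, 1 / den δ y := by
        refine intervalIntegral.integral_mono_interval (by linarith) (by linarith) htz ?_ hint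
        filter_upwards [ae_restrict_mem measurableSet_Ioc] with y hy
        exact (one_div_pos.2 (h y ⟨hy.1.le, hy.2⟩)).le

/-- A bound for the profiles that is uniform in `δ`. -/
lemma homSol_zero_le {z : ℝ} (hδ : 0 ≤ δ) (hδ1 : δ ≤ 1 / 16) (hz : z ∈ Icc (0 : ℝ) 1)
    (h : ∀ y ∈ Icc 0 z, 0 < den δ y) (hr : 0 < max (√δ) (1 / 2 - z)) :
    homSol δ 0 z ≤ 3000000000 * max (√δ) (1 / 2 - z) := by
  have hsq : √δ ^ 2 = δ := Real.sq_sqrt hδ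
  have hl := le_den hδ (by linarith) hz
  have hd := h z ⟨hz.1, le_rfl⟩
  rcases le_total z (1 / 4) with h4 | h4
  · have hm : 1 / 4 ≤ max (√δ) (1 / 2 - z) := le_max_of_le_right (by linarith)
    have h1 : 0 ≤ expo δ 0 z := by
      rw [expo_zero_eq]
      exact intervalIntegral.integral_nonneg hz.1 fun y hy => (one_div_pos.2 (h y hy)).le
    have h2 : Real.exp (-expo δ 0 z) ≤ 1 := Real.exp_le_one_iff.2 (by linarith)
    have h3 : 1 / 512 ≤ den δ z := by nlinarith
    calc homSol δ 0 z ≤ 1 / (1 / 512) := by unfold homSol; gcongr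
      _ ≤ _ := by linarith
  · have he := le_expo_zero hδ hδ1 h4 hz.2 h hr
    have hmin : max (√δ) (1 / 2 - z) ^ 2 / 32 ≤ den δ z := by
      refine le_trans ?_ hl
      gcongr
      rcases max_choice (√δ) (1 / 2 - z) with h1 | h1 <;> rw [h1]
      · nlinarith [sq_nonneg (z - 1 / 2)]
      · nlinarith
    set r := max (√δ) (1 / 2 - z)
    have hx : 0 ≤ 1 / (240 * r) := by positivity
    -- The cube suffices: exp(-1/(240r)) = O(r³) outweighs 1/den = O(r⁻²) and leaves one power of r,
    -- which makes the profiles small near 1/2.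
    have h5 := Real.pow_div_factorial_le_exp _ hx 3
    have h6 : Real.exp (-expo δ 0 z) ≤ 6 * 240 ^ 3 * r ^ 3 := by
      calc Real.exp (-expo δ 0 z) ≤ Real.exp (-(1 / (240 * r))) := by gcongr
        _ = (Real.exp (1 / (240 * r)))⁻¹ := Real.exp_neg _
        _ ≤ ((1 / (240 * r)) ^ 3 / (Nat.factorial 3 : ℕ))⁻¹ := by gcongr
        _ = _ := by
          norm_num [Nat.factorial]
          field_simp
          norm_num
    calc homSol δ 0 z ≤ 6 * 240 ^ 3 * r ^ 3 / (r ^ 2 / 32) := by unfold homSol; gcongr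
      _ = 6 * 240 ^ 3 * 32 * r := by field_simp
      _ ≤ _ := by nlinarith

lemma homSol_zero_le_const (hδ : 0 < δ) (hδ1 : δ ≤ 1 / 16) {z : ℝ} (hz : z ∈ Icc (0 : ℝ) 1) :
    homSol δ 0 z ≤ 1500000000 := by
  have hs : 0 < √δ := Real.sqrt_pos.2 hδ
  have hs4 : √δ ≤ 1 / 4 := Real.sqrt_le_iff.2 ⟨by norm_num, by norm_num; linarith⟩
  have := homSol_zero_le hδ.le hδ1 hz (fun y _ => den_pos hδ (by linarith) y)
    (lt_max_of_lt_left hs)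
  have h2 : max (√δ) (1 / 2 - z) ≤ 1 / 2 := max_le (by linarith) (by linarith [hz.1])
  linarith

/-- A lower bound for the profiles on `[0, 2/5]`. -/
lemma le_homSol_zero {z : ℝ} (hδ : 0 ≤ δ) (hδ1 : δ ≤ 1 / 16) (hz : z ∈ Icc (0 : ℝ) (2 / 5)) :
    Real.exp (-1280) / 15 ≤ homSol δ 0 z := by
  -- On [0, 2/5] the distance to 1/2 is at least 1/10, hence 1/3200; then 1280 = 3200 · 2/5 bounds
  -- the exponent, and 15 = 48(1/4 + 1/16) bounds den.
  have hd : ∀ y ∈ Icc (0 : ℝ) z, 1 / 3200 ≤ den δ y := by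
    intro y hy
    have := le_den hδ (by linarith) (z := y) ⟨hy.1, by linarith [hy.2, hz.2]⟩
    nlinarith [hy.2, hz.2]
  have hpos : ∀ y ∈ Icc (0 : ℝ) z, 0 < den δ y := fun y hy => by linarith [hd y hy]
  have he : expo δ 0 z ≤ 1280 := by
    rw [expo_zero_eq]
    calc ∫ y in (0 : ℝ)..z, 1 / den δ y ≤ ∫ _ in (0 : ℝ)..z, (3200 : ℝ) := by
          refine intervalIntegral.integral_mono_on hz.1 ?_ intervalIntegrable_const ?_
          · refine ContinuousOn.intervalIntegrable ?_
            rw [uIcc_of_le hz.1]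
            exact continuousOn_one_div_den hpos
          · intro y hy
            rw [div_le_iff₀ (hpos y hy)]
            linarith [hd y hy]
      _ ≤ 1280 := by
          rw [intervalIntegral.integral_const, smul_eq_mul]
          linarith [hz.2]
  have hu := den_le hδ (z := z) ⟨hz.1, by linarith [hz.2]⟩
  have hzp := hpos z ⟨hz.1, le_rfl⟩
  unfold homSol
  gcongr
  nlinarith [hz.1, hz.2]

lemma le_exp_expo_zero_one (hδ : 0 < δ) (hδ1 : δ ≤ 1 / 16) :
    Real.exp (1 / (240 * √δ)) ≤ Real.exp (expo δ 0 1) := by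
  have hs : 0 < √δ := Real.sqrt_pos.2 hδ
  have h1 := le_expo_zero (z := 1) hδ.le hδ1 (by norm_num) le_rfl
    (fun y _ => den_pos hδ (by linarith) y) (lt_max_of_lt_left hs)
  rw [max_eq_left (by linarith)] at h1
  exact Real.exp_le_exp.2 h1

/-- The normalizing constant `∫_0^1 z homSol δ p z dz`. -/
def normC (δ : ℝ) (p : ℝ × ℝ) : ℝ := ∫ y in (0 : ℝ)..1, y * homSol δ p y

lemma psi_eq (hδ : 0 < δ) (hδ1 : δ ≤ 1) (p : ℝ × ℝ) {z : ℝ} (hz : 0 ≤ z) :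
    psi p.1 p.2 δ z = homSol δ p z / normC δ p := by
  rw [psi, psiShape_eq hδ hδ1 p hz, normC]
  congr 1
  refine intervalIntegral.integral_congr fun y hy => ?_
  rw [uIcc_of_le zero_le_one] at hy
  simp only [psiShape_eq hδ hδ1 p hy.1]

lemma psi_zero_eq (hδ : 0 < δ) (hδ1 : δ ≤ 1) {z : ℝ} (hz : 0 ≤ z) :
    psi 0 0 δ z = homSol δ 0 z / normC δ 0 := psi_eq hδ hδ1 0 hz

/-- Lower bound for integrals over `[0, 1]` in terms of a lower bound on `[0, 2/5]`. -/
lemma le_integral_of_le {f : ℝ → ℝ} {c : ℝ} (hf : IntervalIntegrable f volume 0 1)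
    (h0 : ∀ y ∈ Icc (0 : ℝ) 1, 0 ≤ f y) (hc : ∀ y ∈ Icc (0 : ℝ) (2 / 5), c * y ≤ f y) :
    c * (2 / 25) ≤ ∫ y in (0 : ℝ)..1, f y := by
  calc c * (2 / 25) = ∫ y in (0 : ℝ)..(2 / 5), c * y := by
        rw [intervalIntegral.integral_const_mul, integral_id]; ring
    _ ≤ ∫ y in (0 : ℝ)..(2 / 5), f y := by
        refine intervalIntegral.integral_mono_on (by norm_num)
          ((continuous_const.mul continuous_id).intervalIntegrable _ _) (hf.mono_set ?_) hc
        rw [uIcc_of_le (by norm_num), uIcc_of_le (by norm_num)]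
        exact Icc_subset_Icc le_rfl (by norm_num)
    _ ≤ _ := by
        refine intervalIntegral.integral_mono_interval le_rfl (by norm_num) (by norm_num) ?_ hf
        filter_upwards [ae_restrict_mem measurableSet_Ioc] with y hy
        exact h0 y ⟨hy.1.le, hy.2⟩

lemma homSol_zero_le_homSol (hδ : 0 < δ) (hδ1 : δ ≤ 1) (hp : 0 ≤ p) {z : ℝ} (hz : 0 ≤ z) :
    homSol δ 0 z ≤ homSol δ p z := by
  have := expo_sub_le hδ hδ1 hp le_rfl hz
  simp only [expo_zero_right, sub_zero] at this
  have hd := den_pos hδ hδ1 z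
  unfold homSol
  gcongr

/-- A positive lower bound for the normalizing constants. -/
def normLower : ℝ := Real.exp (-1280) / 15 * (2 / 25)

lemma normLower_pos : 0 < normLower := by unfold normLower; positivity

lemma intervalIntegrable_mul_homSol (hδ : 0 < δ) (hδ1 : δ ≤ 1) (p : ℝ × ℝ) (s t : ℝ) :
    IntervalIntegrable (fun y => y * homSol δ p y) volume s t :=
  (continuous_id.mul (continuous_homSol hδ hδ1 p)).intervalIntegrable _ _

lemma normLower_le (hδ : 0 < δ) (hδ1 : δ ≤ 1 / 16) (hp : 0 ≤ p) : normLower ≤ normC δ p := by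
  refine le_integral_of_le (intervalIntegrable_mul_homSol hδ (by linarith) p 0 1)
    (fun y hy => mul_nonneg hy.1 (homSol_pos hδ (by linarith) p y).le) fun y hy => ?_
  rw [mul_comm]
  gcongr
  · exact hy.1
  · exact (le_homSol_zero hδ.le hδ1 hy).trans
      (homSol_zero_le_homSol hδ (by linarith) hp hy.1)

lemma normC_zero_le (hδ : 0 < δ) (hδ1 : δ ≤ 1 / 16) : normC δ 0 ≤ 1500000000 := by
  calc normC δ 0 ≤ ∫ _ in (0 : ℝ)..1, (1500000000 : ℝ) := by
        refine intervalIntegral.integral_mono_on zero_le_one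
          (intervalIntegrable_mul_homSol hδ (by linarith) 0 0 1) intervalIntegrable_const ?_
        intro y hy
        have h1 := homSol_zero_le_const hδ hδ1 hy
        have h2 := homSol_pos hδ (by linarith) 0 y
        nlinarith [hy.1, hy.2]
    _ = _ := by simp

/-- The normalization cancels in the quotient. As the first two factors lie between positive
constants, K₁ is interchangeable with exp E(1), which translates the hypothesis on μ. -/
lemma K₁_eq (hδ : 0 < δ) (hδ1 : δ ≤ 1 / 16) :
    K₁ δ = normC δ 0 * den δ 1 * Real.exp (expo δ 0 1) := by
  have hN := normLower_pos.trans_le (normLower_le hδ hδ1 (le_refl (0 : ℝ × ℝ)))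
  have hd := den_pos hδ (by linarith) 1
  have h1 : K₁ δ = ∫ z in (0 : ℝ)..1, z * homSol δ 0 z * (den δ 1 * Real.exp (expo δ 0 1)) := by
    refine intervalIntegral.integral_congr fun z hz => ?_
    rw [uIcc_of_le zero_le_one] at hz
    simp only [psi_zero_eq hδ (by linarith) hz.1, psi_zero_eq hδ (by linarith) zero_le_one]
    rw [div_div_div_cancel_right₀ hN.ne', homSol.eq_1 δ 0 1, Real.exp_neg]
    field_simp
  rw [h1, intervalIntegral.integral_mul_const, normC]
  ring

end

end LSW

/-! ### Convergence of the profiles to the LSW profile, with a rate. -/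

namespace LSW

noncomputable section

variable {δ : ℝ} {p q : ℝ × ℝ}

lemma phiLSWShape_of_lt {z : ℝ} (hz : 0 ≤ z) (h : z < 1 / 2) :
    phiLSWShape z = homSol 0 0 z := by
  have := psiShape_eq_of_den_pos (δ := 0) (p := 0) hz
    fun y hy => den_zero_pos hy.1 (hy.2.trans_lt h)
  rw [← this, phiLSWShape, if_pos ⟨hz, h⟩, psiShape]
  simp

lemma phiLSWShape_of_ge {z : ℝ} (h : 1 / 2 ≤ z) : phiLSWShape z = 0 := by
  rw [phiLSWShape, if_neg]
  rintro ⟨-, h2⟩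
  linarith

lemma phiLSWShape_nonneg (z : ℝ) : 0 ≤ phiLSWShape z := by
  unfold phiLSWShape
  split_ifs
  · exact (Real.exp_pos _).le
  · exact le_rfl

lemma expo_zero_zero_monotoneOn : MonotoneOn (expo 0 0) (Ico 0 (1 / 2)) := by
  intro x hx y hy hxy
  have hpos : ∀ t ∈ Icc 0 y, 0 < den 0 t := fun t ht => den_zero_pos ht.1 (ht.2.trans_lt hy.2)
  rw [expo_zero_eq, expo_zero_eq]
  refine intervalIntegral.integral_mono_interval le_rfl hx.1 hxy ?_ ?_
  · filter_upwards [ae_restrict_mem measurableSet_Ioc] with t ht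
    exact (one_div_pos.2 (hpos t ⟨ht.1.le, ht.2⟩)).le
  · refine ContinuousOn.intervalIntegrable ?_
    rw [uIcc_of_le hy.1]
    exact continuousOn_one_div_den hpos

/-- Monotonicity of the exponent on [0, 1/2) yields measurability without any analysis at the end
point, where the integral diverges. -/
lemma aemeasurable_phiLSWShape : AEMeasurable phiLSWShape := by
  have h1 : AEMeasurable (expo 0 0) (volume.restrict (Ico 0 (1 / 2))) :=
    aemeasurable_restrict_of_monotoneOn measurableSet_Ico expo_zero_zero_monotoneOn
  have h2 : AEMeasurable (homSol 0 0) (volume.restrict (Ico 0 (1 / 2))) :=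
    (Real.measurable_exp.comp_aemeasurable h1.neg).div (continuous_den 0).measurable.aemeasurable
  have h3 : phiLSWShape = indicator (Ico 0 (1 / 2)) (homSol 0 0) := by
    ext z
    by_cases hz : z ∈ Ico (0 : ℝ) (1 / 2)
    · rw [indicator_of_mem hz, phiLSWShape_of_lt hz.1 hz.2]
    · rw [indicator_of_notMem hz, phiLSWShape]
      exact if_neg hz
  rw [h3]
  exact (aemeasurable_indicator_iff measurableSet_Ico).2 h2

lemma phiLSWShape_le {z : ℝ} (hz : 0 ≤ z) :
    phiLSWShape z ≤ 3000000000 * max 0 (1 / 2 - z) := by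
  rcases lt_or_ge z (1 / 2) with h | h
  · rw [phiLSWShape_of_lt hz h]
    have := homSol_zero_le (δ := 0) le_rfl (by norm_num) (z := z) ⟨hz, by linarith⟩
      (fun y hy => den_zero_pos hy.1 (hy.2.trans_lt h)) (lt_max_of_lt_right (by linarith))
    simpa using this
  · rw [phiLSWShape_of_ge h]
    positivity

/-- The profiles converge uniformly on `[0, 1]`, with a rate. -/
lemma abs_homSol_sub_phiLSWShape_le {h z : ℝ} (hh : 0 < h) (hh1 : h ≤ 1 / 4)
    (hz : z ∈ Icc (0 : ℝ) 1) :
    |homSol (h ^ 8) 0 z - phiLSWShape z| ≤ 3000000000 * h := by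
  have h8 : h ^ 8 ≤ 1 / 16 := by
    calc h ^ 8 ≤ (1 / 4) ^ 8 := by gcongr
      _ ≤ _ := by norm_num
  have hδ : 0 < h ^ 8 := by positivity
  have hsq : √(h ^ 8) = h ^ 4 := by
    rw [show h ^ 8 = (h ^ 4) ^ 2 by ring]
    exact Real.sqrt_sq (by positivity)
  have hh4 : h ^ 4 ≤ h := by
    calc h ^ 4 = h * h ^ 3 := by ring
      _ ≤ h * 1 := by gcongr; exact pow_le_one₀ hh.le (by linarith)
      _ = h := mul_one h
  -- Here δ = h⁸. At distance at least h to the left of 1/2, den ≥ h²/32, so the exponents and the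
  -- reciprocals 1/den differ by O(h⁸/h⁴); the factor 1/den costs another h⁻², which leaves O(h²).
  -- For the remaining z both profiles are O(h) by the uniform bound.
  rcases le_total z (1 / 2 - h) with hzh | hzh
  · have hlt : z < 1 / 2 := by linarith
    rw [phiLSWShape_of_lt hz.1 hlt]
    set c := h ^ 2 / 32 with hc
    have hcpos : 0 < c := by positivity
    have hd0 : ∀ y ∈ Icc 0 z, c ≤ den 0 y := by
      intro y hy
      have := le_den le_rfl zero_le_one (z := y) ⟨hy.1, hy.2.trans hz.2⟩
      have h2 : h ^ 2 ≤ (1 / 2 - y) ^ 2 := by gcongr; linarith [hy.2]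
      rw [hc]
      nlinarith
    have hdd : ∀ y ∈ Icc 0 z, den 0 y ≤ den (h ^ 8) y := fun y _ => den_mono_left hδ.le y
    have hpos0 : ∀ y ∈ Icc 0 z, 0 < den 0 y := fun y hy => hcpos.trans_le (hd0 y hy)
    have hpos : ∀ y ∈ Icc 0 z, 0 < den (h ^ 8) y := fun y _ => den_pos hδ (by linarith) y
    have hdiff : ∀ y ∈ Icc 0 z, |1 / den (h ^ 8) y - 1 / den 0 y| ≤ h ^ 8 / c ^ 2 := by
      intro y hy
      have e : den (h ^ 8) y - den 0 y = h ^ 8 * |y| ^ (1 / 3 : ℝ) := by unfold den; ring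
      have e1 : |y| ^ (1 / 3 : ℝ) ≤ 1 := Real.rpow_le_one (abs_nonneg _)
        (by rw [abs_of_nonneg hy.1]; exact hy.2.trans hz.2) (by norm_num)
      have e2 : den (h ^ 8) y - den 0 y ≤ h ^ 8 := by rw [e]; nlinarith
      have p0 := hpos0 y hy
      have p1 := hpos y hy
      have e3 : 1 / den (h ^ 8) y - 1 / den 0 y =
          -((den (h ^ 8) y - den 0 y) / (den (h ^ 8) y * den 0 y)) := by
        field_simp
        ring
      rw [e3, abs_neg, abs_of_nonneg (div_nonneg (by linarith [hdd y hy]) (by positivity)), sq]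
      gcongr
      · exact (hd0 y hy).trans (hdd y hy)
      · exact hd0 y hy
    have hE : |expo (h ^ 8) 0 z - expo 0 0 z| ≤ h ^ 8 / c ^ 2 := by
      have i1 : IntervalIntegrable (fun y => 1 / den (h ^ 8) y) volume 0 z :=
        (continuousOn_one_div_den hpos).intervalIntegrable_of_Icc hz.1
      have i2 : IntervalIntegrable (fun y => 1 / den 0 y) volume 0 z :=
        (continuousOn_one_div_den hpos0).intervalIntegrable_of_Icc hz.1
      rw [expo_zero_eq, expo_zero_eq, ← intervalIntegral.integral_sub i1 i2, ← Real.norm_eq_abs]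
      refine (intervalIntegral.norm_integral_le_of_norm_le_const (C := h ^ 8 / c ^ 2)
        fun y hy => ?_).trans ?_
      · rw [uIoc_of_le hz.1] at hy
        exact hdiff y ⟨hy.1.le, hy.2⟩
      · rw [sub_zero, abs_of_nonneg hz.1]
        have : 0 ≤ h ^ 8 / c ^ 2 := by positivity
        nlinarith [hz.2]
    have hF0 : 0 ≤ expo 0 0 z := by
      rw [expo_zero_eq]
      exact intervalIntegral.integral_nonneg hz.1 fun y hy => (one_div_pos.2 (hpos0 y hy)).le
    have hF1 : 0 ≤ expo (h ^ 8) 0 z := by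
      rw [expo_zero_eq]
      exact intervalIntegral.integral_nonneg hz.1 fun y hy => (one_div_pos.2 (hpos y hy)).le
    have hexp : |Real.exp (-expo (h ^ 8) 0 z) - Real.exp (-expo 0 0 z)| ≤ h ^ 8 / c ^ 2 := by
      refine le_trans ?_ hE
      have key : ∀ x y : ℝ, 0 ≤ x → x ≤ y →
          |Real.exp (-x) - Real.exp (-y)| ≤ |x - y| := by
        intro x y hx hxy
        have t1 : Real.exp (-y) ≤ Real.exp (-x) := Real.exp_le_exp.2 (by linarith)
        rw [abs_of_nonneg (by linarith), abs_of_nonpos (by linarith)]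
        have t2 : Real.exp (-y) = Real.exp (-x) * Real.exp (x - y) := by
          rw [← Real.exp_add]; ring_nf
        have t3 := Real.add_one_le_exp (x - y)
        have t4 : Real.exp (-x) ≤ 1 := Real.exp_le_one_iff.2 (by linarith)
        have t5 := Real.exp_pos (-x)
        rw [t2]
        nlinarith
      rcases le_total (expo (h ^ 8) 0 z) (expo 0 0 z) with t | t
      · exact key _ _ hF1 t
      · rw [abs_sub_comm, abs_sub_comm (expo _ _ _)]
        exact key _ _ hF0 t
    have hzz : z ∈ Icc 0 z := ⟨hz.1, le_rfl⟩
    have hsplit : homSol (h ^ 8) 0 z - homSol 0 0 z =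
        (Real.exp (-expo (h ^ 8) 0 z) - Real.exp (-expo 0 0 z)) * (1 / den (h ^ 8) z) +
          Real.exp (-expo 0 0 z) * (1 / den (h ^ 8) z - 1 / den 0 z) := by
      unfold homSol
      ring
    have hb1 : |1 / den (h ^ 8) z| ≤ 1 / c := by
      rw [abs_of_pos (one_div_pos.2 (hpos z hzz))]
      exact one_div_le_one_div_of_le hcpos ((hd0 z hzz).trans (hdd z hzz))
    have hb2 : |Real.exp (-expo 0 0 z)| ≤ 1 := by
      rw [Real.abs_exp]
      exact Real.exp_le_one_iff.2 (by linarith)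
    calc |homSol (h ^ 8) 0 z - homSol 0 0 z| ≤ h ^ 8 / c ^ 2 * (1 / c) + 1 * (h ^ 8 / c ^ 2) := by
          rw [hsplit]
          refine (abs_add_le _ _).trans ?_
          rw [abs_mul, abs_mul]
          gcongr
          exact hdiff z hzz
      _ = 32 ^ 3 * h * h + 32 ^ 2 * (h ^ 4) := by
          rw [hc]
          field_simp
      _ ≤ 32 ^ 3 * h * 1 + 32 ^ 2 * h := by gcongr; linarith
      _ ≤ _ := by linarith
  · have hm : max (√(h ^ 8)) (1 / 2 - z) ≤ h := by
      rw [hsq]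
      exact max_le hh4 (by linarith)
    have h1 := homSol_zero_le hδ.le h8 hz (fun y _ => den_pos hδ (by linarith) y)
      (lt_max_of_lt_left (by rw [hsq]; positivity))
    have h2 := phiLSWShape_le hz.1
    have h3 : max 0 (1 / 2 - z) ≤ h := max_le hh.le (by linarith)
    have h4 := (homSol_pos hδ (by linarith) 0 z).le
    have h5 := phiLSWShape_nonneg z
    rw [abs_le]
    constructor <;> linarith

lemma intervalIntegrable_mul_phiLSWShape :
    IntervalIntegrable (fun y => y * phiLSWShape y) volume 0 1 := by
  rw [intervalIntegrable_iff, uIoc_of_le zero_le_one]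
  refine Measure.integrableOn_of_bounded (M := 3000000000) (by simp)
    (aemeasurable_id.mul aemeasurable_phiLSWShape).aestronglyMeasurable ?_
  filter_upwards [ae_restrict_mem measurableSet_Ioc] with y hy
  have h1 := phiLSWShape_le hy.1.le
  have h2 : max 0 (1 / 2 - y) ≤ 1 := max_le zero_le_one (by linarith [hy.1])
  have h3 := phiLSWShape_nonneg y
  simp only [norm_mul, Real.norm_eq_abs, abs_of_nonneg hy.1.le, abs_of_nonneg h3]
  nlinarith [hy.1, hy.2]

/-- The normalizing constant of `phiLSW`. -/
def normLSW : ℝ := ∫ y in Ioi (0 : ℝ), y * phiLSWShape y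

lemma normLSW_eq : normLSW = ∫ y in (0 : ℝ)..1, y * phiLSWShape y := by
  rw [normLSW, intervalIntegral.integral_of_le zero_le_one]
  refine (setIntegral_eq_of_subset_of_forall_sdiff_eq_zero measurableSet_Ioi
    (fun y hy => hy.1) fun y hy => ?_)
  have : 1 < y := by
    by_contra! h
    exact hy.2 ⟨hy.1, h⟩
  rw [phiLSWShape_of_ge (by linarith), mul_zero]

lemma normLower_le_normLSW : normLower ≤ normLSW := by
  rw [normLSW_eq]
  refine le_integral_of_le intervalIntegrable_mul_phiLSWShape
    (fun y hy => mul_nonneg hy.1 (phiLSWShape_nonneg y)) fun y hy => ?_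
  rw [mul_comm]
  gcongr
  · exact hy.1
  · rw [phiLSWShape_of_lt hy.1 (by linarith [hy.2])]
    exact le_homSol_zero le_rfl (by norm_num) hy

lemma abs_normC_sub_normLSW_le {h : ℝ} (hh : 0 < h) (hh1 : h ≤ 1 / 4) :
    |normC (h ^ 8) 0 - normLSW| ≤ 3000000000 * h := by
  have h8 : h ^ 8 ≤ 1 := pow_le_one₀ hh.le (by linarith)
  rw [normLSW_eq, normC, ← intervalIntegral.integral_sub
    (intervalIntegrable_mul_homSol (by positivity) h8 0 0 1) intervalIntegrable_mul_phiLSWShape,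
    ← Real.norm_eq_abs]
  refine (intervalIntegral.norm_integral_le_of_norm_le_const (C := 3000000000 * h)
    fun y hy => ?_).trans (by simp)
  rw [uIoc_of_le zero_le_one] at hy
  have := abs_homSol_sub_phiLSWShape_le hh hh1 (z := y) ⟨hy.1.le, hy.2⟩
  rw [← mul_sub, norm_mul, Real.norm_eq_abs, Real.norm_eq_abs, abs_of_pos hy.1]
  nlinarith [hy.1, hy.2, abs_nonneg (homSol (h ^ 8) 0 y - phiLSWShape y)]

/-- The constant in the rate of convergence of `phiHat` to `phiLSW`. -/
def rateC : ℝ := 3000000000 / normLower + 3000000000 * 3000000000 / normLower ^ 2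

lemma rateC_pos : 0 < rateC := by
  have := normLower_pos
  unfold rateC
  positivity

lemma phiLSW_eq (z : ℝ) : phiLSW z = phiLSWShape z / normLSW := rfl

lemma phiHat_of_mem (hδ : 0 < δ) (hδ1 : δ ≤ 1) {z : ℝ} (hz : z ∈ Icc (0 : ℝ) 1) :
    phiHat δ z = homSol δ 0 z / normC δ 0 := by
  rw [phiHat, indicator_of_mem hz, psi_zero_eq hδ hδ1 hz.1]

lemma phiHat_of_one_lt {z : ℝ} (hz : 1 < z) : phiHat δ z = 0 := by
  rw [phiHat, indicator_of_notMem]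
  exact fun h => absurd h.2 (not_le.2 hz)

lemma phiLSW_of_ge {z : ℝ} (hz : 1 / 2 ≤ z) : phiLSW z = 0 := by
  rw [phiLSW_eq, phiLSWShape_of_ge hz, zero_div]

lemma abs_phiHat_sub_phiLSW_le {h z : ℝ} (hh : 0 < h) (hh1 : h ≤ 1 / 4)
    (hz : z ∈ Icc (0 : ℝ) 1) : |phiHat (h ^ 8) z - phiLSW z| ≤ rateC * h := by
  have h8 : h ^ 8 ≤ 1 / 16 := by
    calc h ^ 8 ≤ (1 / 4) ^ 8 := by gcongr
      _ ≤ _ := by norm_num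
  have hδ : 0 < h ^ 8 := by positivity
  rw [phiHat_of_mem hδ (by linarith) hz, phiLSW_eq]
  have hN0 := normLower_pos
  have hN1 := normLower_le hδ h8 (le_refl (0 : ℝ × ℝ))
  have hN2 := normLower_le_normLSW
  have e1 := abs_homSol_sub_phiLSWShape_le hh hh1 hz
  have e2 := abs_normC_sub_normLSW_le hh hh1
  have e3 : phiLSWShape z ≤ 3000000000 := by
    have h2 : max 0 (1 / 2 - z) ≤ 1 := max_le zero_le_one (by linarith [hz.1])
    linarith [phiLSWShape_le hz.1]
  have e4 := phiLSWShape_nonneg z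
  set A := normC (h ^ 8) 0
  set B := normLSW
  have hA : 0 < A := by linarith
  have hB : 0 < B := by linarith
  have key : homSol (h ^ 8) 0 z / A - phiLSWShape z / B =
      (homSol (h ^ 8) 0 z - phiLSWShape z) / A - phiLSWShape z * (A - B) / (A * B) := by
    field_simp
    ring
  rw [key]
  refine (abs_sub _ _).trans ?_
  rw [abs_div, abs_div, abs_mul, abs_of_pos hA, abs_of_pos (mul_pos hA hB), abs_of_nonneg e4]
  calc _ ≤ 3000000000 * h / normLower +
        3000000000 * (3000000000 * h) / (normLower * normLower) := by gcongr
    _ = _ := by unfold rateC; field_simp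

lemma zNorm_le {β₁ β₂ : ℝ} {f : ℝ → ℝ} {s t : ℝ} (hs : 0 ≤ s) (ht : 0 ≤ t)
    (h1 : ∀ z ∈ Icc (0 : ℝ) 1, |f z| ≤ s)
    (h2 : ∀ z, 1 ≤ z → |f z * Real.exp (β₁ * z) * z ^ β₂| ≤ t) :
    zNorm β₁ β₂ f ≤ ENNReal.ofReal (s + t) := by
  rw [zNorm, ENNReal.ofReal_add hs ht]
  exact add_le_add (iSup₂_le fun z hz => ENNReal.ofReal_le_ofReal (h1 z hz))
    (iSup₂_le fun z hz => ENNReal.ofReal_le_ofReal (h2 z hz))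

lemma zNorm_phiHat_sub_phiLSW_le (β₁ β₂ : ℝ) {h : ℝ} (hh : 0 < h) (hh1 : h ≤ 1 / 4) :
    zNorm β₁ β₂ (phiHat (h ^ 8) - phiLSW) ≤
      ENNReal.ofReal (rateC * (1 + Real.exp β₁) * h) := by
  have hC := rateC_pos
  have := zNorm_le (β₁ := β₁) (β₂ := β₂) (f := phiHat (h ^ 8) - phiLSW) (s := rateC * h)
    (t := rateC * h * Real.exp β₁) (by positivity) (by positivity)
    (fun z hz => abs_phiHat_sub_phiLSW_le hh hh1 hz) (fun z hz => ?_)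
  · refine this.trans_eq ?_
    congr 1
    ring
  · rcases hz.eq_or_lt with rfl | hz1
    · have := abs_phiHat_sub_phiLSW_le hh hh1 (z := 1) ⟨zero_le_one, le_rfl⟩
      simp only [Pi.sub_apply, mul_one, Real.one_rpow, abs_mul, Real.abs_exp]
      gcongr
    · simp only [Pi.sub_apply, phiHat_of_one_lt hz1, phiLSW_of_ge (by linarith : 1 / 2 ≤ z)]
      simp
      positivity

end

end LSW

/-! ### Growth of K₁ and existence of an admissible radius. -/

namespace LSW

noncomputable section

variable {δ : ℝ} {p q : ℝ × ℝ}

/-- The constant in the lower bound for `exp (expo δ 0 1)`. -/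
def growthC : ℝ := 240 ^ 10 * (Nat.factorial 10 : ℕ)

lemma growthC_pos : 0 < growthC := by unfold growthC; positivity

/-- `exp (∫_0^1 1 / den δ)` is larger than any power of `1 / δ` (the fifth suffices here). -/
lemma inv_exp_expo_le (hδ : 0 < δ) (hδ1 : δ ≤ 1 / 16) :
    1 / Real.exp (expo δ 0 1) ≤ growthC * δ ^ 5 := by
  have hs : 0 < √δ := Real.sqrt_pos.2 hδ
  have hsq : √δ ^ 2 = δ := Real.sq_sqrt hδ.le
  have h1 := le_exp_expo_zero_one hδ hδ1
  have hx : 0 ≤ 1 / (240 * √δ) := by positivity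
  -- The exponent is of order δ^(-1/2), so the tenth power produces δ^(-5).
  have h2 := Real.pow_div_factorial_le_exp _ hx 10
  have h3 : (1 / (240 * √δ)) ^ 10 / (Nat.factorial 10 : ℕ) = 1 / (growthC * δ ^ 5) := by
    have h5 : δ ^ 5 = √δ ^ 10 := by rw [show 10 = 2 * 5 by norm_num, pow_mul, hsq]
    rw [h5, growthC]
    field_simp
  rw [h3] at h2
  have h4 : 0 < growthC * δ ^ 5 := mul_pos growthC_pos (by positivity)
  rw [div_le_iff₀ (Real.exp_pos _)]
  rw [div_le_iff₀ h4] at h2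
  nlinarith

lemma K₁_pos (hδ : 0 < δ) (hδ1 : δ ≤ 1 / 16) : 0 < K₁ δ := by
  rw [K₁_eq hδ hδ1]
  have := normLower_pos.trans_le (normLower_le hδ hδ1 (le_refl (0 : ℝ × ℝ)))
  have := den_pos hδ (by linarith) 1
  positivity

lemma one_div_mul_K₁_le (hδ : 0 < δ) (hδ1 : δ ≤ 1 / 16) :
    1 / (δ * K₁ δ) ≤ 25 * growthC / normLower * δ := by
  have h1 := inv_exp_expo_le hδ hδ1
  have h2 := normLower_le hδ hδ1 (le_refl (0 : ℝ × ℝ))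
  have h3 := le_den_of_one_le hδ.le (le_refl (1 : ℝ))
  have h0 := normLower_pos
  have hg := growthC_pos
  rw [K₁_eq hδ hδ1]
  have hn : 0 ≤ normC δ 0 := by linarith
  set K := Real.exp (expo δ 0 1)
  have hK : 0 < K := Real.exp_pos _
  calc 1 / (δ * (normC δ 0 * den δ 1 * K)) ≤ 1 / (δ * (normLower * (1 / 25) * K)) := by gcongr
    _ = 25 / (normLower * δ) * (1 / K) := by field_simp
    _ ≤ 25 / (normLower * δ) * (growthC * δ ^ 5) := by gcongr
    _ = 25 * growthC / normLower * δ * δ ^ 3 := by field_simp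
    _ ≤ 25 * growthC / normLower * δ * 1 := by
        gcongr
        exact pow_le_one₀ hδ.le (by linarith)
    _ = _ := mul_one _

/-- This turns the hypothesis 1/(δK₁) = o(μ²) into smallness of 1/(δ exp E(1)), the quantity in
which all later errors are measured. The constants come from the upper bounds for `normC δ 0` and
`den δ 1`. -/
lemma exp_expo_le_K₁ (hδ : 0 < δ) (hδ1 : δ ≤ 1 / 16) :
    1 / (δ * Real.exp (expo δ 0 1)) ≤ 72000000000 * (25 * (1 / (δ * K₁ δ))) := by
  have h2 := normC_zero_le hδ hδ1
  have h20 := normLower_pos.trans_le (normLower_le hδ hδ1 (le_refl (0 : ℝ × ℝ)))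
  have h3 := den_le hδ.le (z := 1) ⟨zero_le_one, le_rfl⟩
  have hd := den_pos hδ (by linarith) 1
  rw [K₁_eq hδ hδ1]
  set K := Real.exp (expo δ 0 1)
  have hK : 0 < K := Real.exp_pos _
  have h4 : normC δ 0 * den δ 1 ≤ 1500000000 * 48 * 25 := by
    calc normC δ 0 * den δ 1 ≤ 1500000000 * (48 * 25) := by gcongr; linarith
      _ = _ := by norm_num
  have h5 : 72000000000 * (25 * (1 / (δ * (normC δ 0 * den δ 1 * K)))) =
      (1500000000 * 48 * 25) / (normC δ 0 * den δ 1) * (1 / (δ * K)) := by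
    field_simp
    norm_num
  rw [h5]
  refine le_mul_of_one_le_left (by positivity) ?_
  rwa [one_le_div (by positivity)]

lemma tendsto_rpow_nhdsGT {s : ℝ} (hs : 0 < s) :
    Tendsto (fun δ : ℝ => δ ^ s) (𝓝[>] 0) (𝓝 0) := by
  have := (Real.continuousAt_rpow_const 0 s (Or.inr hs.le)).tendsto
  rw [Real.zero_rpow hs.ne'] at this
  exact this.mono_left nhdsWithin_le_nhds

lemma eventually_pos : ∀ᶠ δ in 𝓝[>] (0 : ℝ), 0 < δ := self_mem_nhdsWithin

lemma eventually_le {c : ℝ} (hc : 0 < c) : ∀ᶠ δ in 𝓝[>] (0 : ℝ), δ ≤ c :=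
  (eventually_le_nhds hc).filter_mono nhdsWithin_le_nhds

/-- Take μ² = k with k = δ^(1/16). The profiles converge at the rate δ^(1/8) = k² = o(k), and
1/(δK₁) = O(δ) = O(k¹⁶). -/
theorem exists_isRadius (β₁ β₂ : ℝ) : ∃ μ : ℝ → ℝ, IsRadius β₁ β₂ μ := by
  have hk0 : Tendsto (fun δ : ℝ => δ ^ (1 / 16 : ℝ)) (𝓝[>] 0) (𝓝 0) :=
    tendsto_rpow_nhdsGT (by norm_num)
  have hk16 : ∀ δ : ℝ, 0 < δ → (δ ^ (1 / 16 : ℝ)) ^ 16 = δ := by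
    intro δ hδ
    rw [← Real.rpow_natCast, ← Real.rpow_mul hδ.le]
    norm_num
  have hsmall : ∀ c > 0, ∀ᶠ δ in 𝓝[>] (0 : ℝ), δ ^ (1 / 16 : ℝ) ≤ c := fun c hc =>
    hk0.eventually (eventually_le_nhds hc)
  have hsq : ∀ δ : ℝ, 0 < δ → √(δ ^ (1 / 16 : ℝ)) ^ 2 = δ ^ (1 / 16 : ℝ) := fun δ hδ =>
    Real.sq_sqrt (by positivity)
  have hN := normLower_pos
  have hg := growthC_pos
  refine ⟨fun δ => √(δ ^ (1 / 16 : ℝ)), ?_, ?_, ?_⟩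
  · simpa using hk0.sqrt
  · rw [isLittleO_iff]
    intro c hc
    filter_upwards [eventually_pos, eventually_le (c := 1 / 16) (by norm_num),
      hsmall 1 one_pos, hsmall (c / (25 * growthC / normLower)) (by positivity)]
      with δ hδ hδ1 h1 h2
    have h3 := one_div_mul_K₁_le hδ hδ1
    have hK := K₁_pos hδ hδ1
    have h4 := hk16 δ hδ
    rw [hsq δ hδ]
    have hkp : 0 < δ ^ (1 / 16 : ℝ) := by positivity
    set k := δ ^ (1 / 16 : ℝ)
    rw [Real.norm_of_nonneg (by positivity), Real.norm_of_nonneg hkp.le]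
    rw [le_div_iff₀ (by positivity)] at h2
    calc 1 / (δ * K₁ δ) ≤ 25 * growthC / normLower * δ := h3
      _ = 25 * growthC / normLower * (k * k * k ^ 14) := by rw [← h4]; ring
      _ ≤ 25 * growthC / normLower * (k * k * 1) := by
          gcongr
          exact pow_le_one₀ hkp.le h1
      _ = k * (25 * growthC / normLower) * k := by ring
      _ ≤ c * k := by gcongr
  · intro c hc
    have hC : 0 < rateC * (1 + Real.exp β₁) := mul_pos rateC_pos (by positivity)
    filter_upwards [eventually_pos, hsmall (1 / 2) (by norm_num),
      hsmall (c / (rateC * (1 + Real.exp β₁))) (by positivity)] with δ hδ h1 h2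
    rw [hsq δ hδ]
    have hkp : 0 < δ ^ (1 / 16 : ℝ) := by positivity
    have h4 := hk16 δ hδ
    set k := δ ^ (1 / 16 : ℝ)
    have := zNorm_phiHat_sub_phiLSW_le β₁ β₂ (h := k ^ 2) (by positivity) (by nlinarith)
    rw [← pow_mul, show 2 * 8 = 16 by norm_num, h4] at this
    refine this.trans (ENNReal.ofReal_le_ofReal ?_)
    rw [le_div_iff₀ (by positivity)] at h2
    nlinarith

/-! ### The triangle inequality in Z and comparison of balls about the two centres. -/

section ZNorm

variable {β₁ β₂ : ℝ}

lemma zNorm_add_le (f g : ℝ → ℝ) : zNorm β₁ β₂ (f + g) ≤ zNorm β₁ β₂ f + zNorm β₁ β₂ g := by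
  unfold zNorm
  rw [add_add_add_comm]
  refine add_le_add (iSup₂_le fun z hz => ?_) (iSup₂_le fun z hz => ?_)
  · calc ENNReal.ofReal |(f + g) z| ≤ ENNReal.ofReal (|f z| + |g z|) :=
          ENNReal.ofReal_le_ofReal (abs_add_le _ _)
      _ = ENNReal.ofReal |f z| + ENNReal.ofReal |g z| :=
          ENNReal.ofReal_add (abs_nonneg _) (abs_nonneg _)
      _ ≤ sNorm f + sNorm g := add_le_add
          (le_iSup₂ (f := fun z (_ : z ∈ Icc (0 : ℝ) 1) => ENNReal.ofReal |f z|) z hz)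
          (le_iSup₂ (f := fun z (_ : z ∈ Icc (0 : ℝ) 1) => ENNReal.ofReal |g z|) z hz)
  · calc ENNReal.ofReal |(f + g) z * Real.exp (β₁ * z) * z ^ β₂|
        ≤ ENNReal.ofReal (|f z * Real.exp (β₁ * z) * z ^ β₂| +
            |g z * Real.exp (β₁ * z) * z ^ β₂|) := by
          refine ENNReal.ofReal_le_ofReal ?_
          rw [Pi.add_apply, add_mul, add_mul]
          exact abs_add_le _ _
      _ = _ := ENNReal.ofReal_add (abs_nonneg _) (abs_nonneg _)
      _ ≤ tNorm β₁ β₂ f + tNorm β₁ β₂ g := add_le_add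
          (le_iSup₂ (f := fun z (_ : z ∈ Ici (1 : ℝ)) =>
            ENNReal.ofReal |f z * Real.exp (β₁ * z) * z ^ β₂|) z hz)
          (le_iSup₂ (f := fun z (_ : z ∈ Ici (1 : ℝ)) =>
            ENNReal.ofReal |g z * Real.exp (β₁ * z) * z ^ β₂|) z hz)

lemma zNorm_sub_comm (f g : ℝ → ℝ) : zNorm β₁ β₂ (f - g) = zNorm β₁ β₂ (g - f) := by
  have h : ∀ z, (f - g) z = -((g - f) z) := fun z => by simp
  simp only [zNorm, sNorm, tNorm, h, neg_mul, abs_neg]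

lemma zNorm_sub_le (f g h : ℝ → ℝ) :
    zNorm β₁ β₂ (f - h) ≤ zNorm β₁ β₂ (f - g) + zNorm β₁ β₂ (g - h) := by
  simpa using zNorm_add_le (β₁ := β₁) (β₂ := β₂) (f - g) (g - h)

lemma phiLSW_mem_Z :
    AEMeasurable phiLSW (volume.restrict (Ici 0)) ∧ zNorm β₁ β₂ phiLSW < ∞ := by
  constructor
  · exact (aemeasurable_phiLSWShape.div_const normLSW).restrict
  · have hN : 0 < normLSW := normLower_pos.trans_le normLower_le_normLSW
    refine (zNorm_le (s := 3000000000 / normLSW) (t := 0) (by positivity) le_rfl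
      (fun z hz => ?_) (fun z hz => ?_)).trans_lt ENNReal.ofReal_lt_top
    · rw [phiLSW_eq, abs_div, abs_of_pos hN, abs_of_nonneg (phiLSWShape_nonneg z)]
      have h2 : max 0 (1 / 2 - z) ≤ 1 := max_le zero_le_one (by linarith [hz.1])
      have := phiLSWShape_le hz.1
      gcongr
      linarith
    · rw [phiLSW_of_ge (by linarith)]
      simp

/-- Eventually the centres are at distance at most μ²/2, and the triangle inequality does the rest.
-/
theorem eventually_ball_subset {μ : ℝ → ℝ} (hμ : IsRadius β₁ β₂ μ) :
    ∀ᶠ δ in 𝓝[>] (0 : ℝ), phiLSW ∈ Y β₁ β₂ μ δ ∧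
      zBall β₁ β₂ phiLSW (μ δ ^ 2 / 2) ⊆ Y β₁ β₂ μ δ ∧
      Y β₁ β₂ μ δ ⊆ zBall β₁ β₂ phiLSW (2 * μ δ ^ 2) := by
  filter_upwards [hμ.2.2 (1 / 2) (by norm_num)] with δ h
  have hm : 0 ≤ μ δ ^ 2 := sq_nonneg _
  refine ⟨⟨phiLSW_mem_Z, ?_⟩, fun Φ hΦ => ⟨hΦ.1, ?_⟩, fun Φ hΦ => ⟨hΦ.1, ?_⟩⟩
  · rw [zNorm_sub_comm]
    exact h.trans (ENNReal.ofReal_le_ofReal (by linarith))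
  · refine (zNorm_sub_le Φ phiLSW _).trans ?_
    rw [zNorm_sub_comm phiLSW]
    refine (add_le_add hΦ.2 h).trans ?_
    rw [← ENNReal.ofReal_add (by positivity) (by positivity)]
    exact ENNReal.ofReal_le_ofReal (by linarith)
  · refine (zNorm_sub_le Φ (phiHat δ) _).trans ?_
    refine (add_le_add hΦ.2 h).trans ?_
    rw [← ENNReal.ofReal_add (by positivity) (by positivity)]
    exact ENNReal.ofReal_le_ofReal (by linarith)

end ZNorm

end

end LSW

/-! ### Weighted pointwise bounds and the convolution. -/

namespace LSW

noncomputable section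

/-- The weight `exp (-β₁ z) max(1, z)^(-β₂)`. -/
def wt (β₁ β₂ z : ℝ) : ℝ := Real.exp (-β₁ * z) * max 1 z ^ (-β₂)

/-- `f` is measurable on the half line and bounded there by `m` times the weight. -/
structure WBdd (β₁ β₂ m : ℝ) (f : ℝ → ℝ) : Prop where
  meas : AEStronglyMeasurable f (volume.restrict (Ioi 0))
  bound : ∀ z, 0 ≤ z → |f z| ≤ m * wt β₁ β₂ z

variable {β₁ β₂ m m' : ℝ} {f g : ℝ → ℝ}

lemma tail_pos (β₂ z : ℝ) : 0 < max 1 z ^ (-β₂) :=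
  Real.rpow_pos_of_pos (lt_max_of_lt_left one_pos) _

lemma tail_le_one (hβ₂ : 0 ≤ β₂) (z : ℝ) : max 1 z ^ (-β₂) ≤ 1 :=
  Real.rpow_le_one_of_one_le_of_nonpos (le_max_left _ _) (by linarith)

lemma wt_pos (β₁ β₂ z : ℝ) : 0 < wt β₁ β₂ z := mul_pos (Real.exp_pos _) (tail_pos _ _)

lemma wt_le_exp (hβ₂ : 0 ≤ β₂) (z : ℝ) : wt β₁ β₂ z ≤ Real.exp (-β₁ * z) :=
  mul_le_of_le_one_right (Real.exp_pos _).le (tail_le_one hβ₂ z)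

lemma wt_le_one (hβ₁ : 0 ≤ β₁) (hβ₂ : 0 ≤ β₂) {z : ℝ} (hz : 0 ≤ z) : wt β₁ β₂ z ≤ 1 :=
  (wt_le_exp hβ₂ z).trans (Real.exp_le_one_iff.2 (by nlinarith))

/-- The first moment costs one power of z, which the algebraic part of the weight pays for; the
exponential remains for integrability. -/
lemma max_mul_wt_le (hβ₂ : 1 ≤ β₂) (z : ℝ) : max 1 z * wt β₁ β₂ z ≤ Real.exp (-β₁ * z) := by
  have h1 : 0 < max 1 z := lt_max_of_lt_left one_pos
  have : max 1 z * max 1 z ^ (-β₂) ≤ 1 := by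
    rw [mul_comm, ← Real.rpow_add_one h1.ne']
    exact Real.rpow_le_one_of_one_le_of_nonpos (le_max_left _ _) (by linarith)
  calc max 1 z * wt β₁ β₂ z = Real.exp (-β₁ * z) * (max 1 z * max 1 z ^ (-β₂)) := by
        unfold wt; ring
    _ ≤ _ := mul_le_of_le_one_right (Real.exp_pos _).le this

lemma exp_le_wt {z : ℝ} (hβ₁ : 0 ≤ β₁) (hz : z ≤ 1) : Real.exp (-β₁) ≤ wt β₁ β₂ z := by
  rw [wt, max_eq_left hz, Real.one_rpow, mul_one]
  exact Real.exp_le_exp.2 (by nlinarith)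

lemma wt_mul_of_one_le {z : ℝ} (hz : 1 ≤ z) :
    wt β₁ β₂ z * Real.exp (β₁ * z) * z ^ β₂ = 1 := by
  have hz0 : 0 < z := by linarith
  rw [wt, max_eq_right hz, Real.rpow_neg hz0.le, neg_mul, Real.exp_neg]
  have := Real.rpow_pos_of_pos hz0 β₂
  field_simp

/-- From the norm of `Z` to weighted pointwise bounds. -/
lemma abs_le_of_zNorm_le (hβ₁ : 0 ≤ β₁) (hm : 0 ≤ m) (h : zNorm β₁ β₂ f ≤ ENNReal.ofReal m)
    {z : ℝ} (hz : 0 ≤ z) : |f z| ≤ Real.exp β₁ * m * wt β₁ β₂ z := by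
  have hE : 1 ≤ Real.exp β₁ := Real.one_le_exp hβ₁
  rcases le_total z 1 with h1 | h1
  · have h2 : ENNReal.ofReal |f z| ≤ sNorm f :=
      le_iSup₂ (f := fun z (_ : z ∈ Icc (0 : ℝ) 1) => ENNReal.ofReal |f z|) z ⟨hz, h1⟩
    have h3 : |f z| ≤ m :=
      (ENNReal.ofReal_le_ofReal_iff hm).1 (h2.trans (le_self_add.trans h))
    have h4 := exp_le_wt (β₂ := β₂) hβ₁ h1
    calc |f z| ≤ m := h3
      _ = Real.exp β₁ * m * Real.exp (-β₁) := by rw [Real.exp_neg]; field_simp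
      _ ≤ _ := by gcongr
  · have h2 : ENNReal.ofReal |f z * Real.exp (β₁ * z) * z ^ β₂| ≤ tNorm β₁ β₂ f :=
      le_iSup₂ (f := fun z (_ : z ∈ Ici (1 : ℝ)) =>
        ENNReal.ofReal |f z * Real.exp (β₁ * z) * z ^ β₂|) z h1
    have h3 : |f z * Real.exp (β₁ * z) * z ^ β₂| ≤ m :=
      (ENNReal.ofReal_le_ofReal_iff hm).1 (h2.trans (le_add_self.trans h))
    have hz0 : 0 < z := by linarith
    have hzp := Real.rpow_pos_of_pos hz0 β₂
    rw [abs_mul, abs_mul, Real.abs_exp, abs_of_pos hzp] at h3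
    have h4 := wt_mul_of_one_le (β₁ := β₁) (β₂ := β₂) h1
    have hw := wt_pos β₁ β₂ z
    calc |f z| = |f z| * Real.exp (β₁ * z) * z ^ β₂ * wt β₁ β₂ z := by
          linear_combination -|f z| * h4
      _ ≤ m * wt β₁ β₂ z := by gcongr
      _ ≤ Real.exp β₁ * m * wt β₁ β₂ z := by
          gcongr
          exact le_mul_of_one_le_left hm hE

/-- From weighted pointwise bounds to the norm of `Z`. -/
lemma zNorm_le_of_abs_le (hβ₁ : 0 ≤ β₁) (hβ₂ : 0 ≤ β₂) (hm : 0 ≤ m)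
    (h : ∀ z, 0 ≤ z → |f z| ≤ m * wt β₁ β₂ z) :
    zNorm β₁ β₂ f ≤ ENNReal.ofReal (2 * m) := by
  rw [two_mul]
  refine zNorm_le hm hm (fun z hz => ?_) (fun z hz => ?_)
  · exact (h z hz.1).trans (mul_le_of_le_one_right hm (wt_le_one hβ₁ hβ₂ hz.1))
  · have hz0 : 0 < z := by linarith
    have hzp := Real.rpow_pos_of_pos hz0 β₂
    rw [abs_mul, abs_mul, Real.abs_exp, abs_of_pos hzp]
    calc _ ≤ m * wt β₁ β₂ z * Real.exp (β₁ * z) * z ^ β₂ := by gcongr; exact h z hz0.le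
      _ = m := by linear_combination m * wt_mul_of_one_le (β₁ := β₁) (β₂ := β₂) hz

lemma WBdd.add (hf : WBdd β₁ β₂ m f) (hg : WBdd β₁ β₂ m' g) : WBdd β₁ β₂ (m + m') (f + g) :=
  ⟨hf.meas.add hg.meas, fun z hz => by
    rw [add_mul]
    exact (abs_add_le _ _).trans (add_le_add (hf.bound z hz) (hg.bound z hz))⟩

lemma WBdd.nonneg (hf : WBdd β₁ β₂ m f) : 0 ≤ m := by
  have := (abs_nonneg _).trans (hf.bound 0 le_rfl)
  exact nonneg_of_mul_nonneg_left this (wt_pos _ _ _)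

lemma WBdd.integrableOn (hβ₁ : 0 < β₁) (hβ₂ : 0 ≤ β₂) (hf : WBdd β₁ β₂ m f) :
    IntegrableOn f (Ioi 0) := by
  refine Integrable.mono' ((integrableOn_exp_mul_Ioi (neg_lt_zero.2 hβ₁) 0).const_mul m)
    hf.meas ?_
  filter_upwards [ae_restrict_mem measurableSet_Ioi] with z hz
  exact (hf.bound z (le_of_lt hz)).trans
    (mul_le_mul_of_nonneg_left (wt_le_exp hβ₂ z) hf.nonneg)

lemma WBdd.intervalIntegrable (hβ₁ : 0 < β₁) (hβ₂ : 0 ≤ β₂) (hf : WBdd β₁ β₂ m f) {z : ℝ}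
    (hz : 0 ≤ z) : IntervalIntegrable f volume 0 z := by
  rw [intervalIntegrable_iff, uIoc_of_le hz]
  exact (hf.integrableOn hβ₁ hβ₂).mono_set fun y hy => hy.1

lemma intervalIntegrable_conv (hβ₁ : 0 < β₁) (hβ₂ : 0 ≤ β₂) (hf : WBdd β₁ β₂ m f)
    (hg : WBdd β₁ β₂ m' g) {z : ℝ} (hz : 0 ≤ z) :
    IntervalIntegrable (fun y => f (z - y) * g y) volume 0 z := by
  have h1 : IntervalIntegrable (fun y => f (z - y)) volume 0 z := by
    simpa using ((hf.intervalIntegrable hβ₁ hβ₂ hz).comp_sub_left z).symm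
  have h2 := hg.intervalIntegrable hβ₁ hβ₂ hz
  rw [intervalIntegrable_iff, uIoc_of_le hz] at h1 h2 ⊢
  refine Integrable.bdd_mul (c := m) h2 h1.aestronglyMeasurable ?_
  filter_upwards [ae_restrict_mem measurableSet_Ioc] with y hy
  have hy0 : 0 ≤ z - y := by linarith [hy.2]
  exact (hf.bound _ hy0).trans (mul_le_of_le_one_right hf.nonneg (wt_le_one hβ₁.le hβ₂ hy0))

/-- The constant `∫_0^∞ max(1, y)^(-β₂) dy`. -/
def tailC (β₂ : ℝ) : ℝ := ∫ y in Ioi (0 : ℝ), max 1 y ^ (-β₂)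

lemma continuous_tail (β₂ : ℝ) : Continuous fun y : ℝ => max 1 y ^ (-β₂) :=
  (continuous_const.max continuous_id).rpow_const
    fun _ => Or.inl (lt_max_of_lt_left one_pos).ne'

lemma integrableOn_tail (hβ₂ : 1 < β₂) : IntegrableOn (fun y : ℝ => max 1 y ^ (-β₂)) (Ioi 0) := by
  have h := (integrableOn_add_rpow_Ioi_of_lt (a := -β₂) (c := 0) (m := 1) (by linarith)
    (by norm_num)).const_mul ((1 / 2 : ℝ) ^ (-β₂))
  refine Integrable.mono' h (continuous_tail β₂).aestronglyMeasurable ?_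
  filter_upwards [ae_restrict_mem measurableSet_Ioi] with y hy
  have hy0 : (0 : ℝ) < y := hy
  rw [Real.norm_of_nonneg (tail_pos _ _).le, ← Real.mul_rpow (by norm_num) (by linarith)]
  refine Real.rpow_le_rpow_of_nonpos (by linarith) ?_ (by linarith)
  rcases max_choice 1 y with h | h <;> rw [h]
  · linarith [max_eq_left_iff.1 h]
  · linarith [max_eq_right_iff.1 h]

lemma tailC_nonneg (β₂ : ℝ) : 0 ≤ tailC β₂ :=
  integral_nonneg fun y => (tail_pos β₂ y).le

lemma integral_tail_le (hβ₂ : 1 < β₂) {z : ℝ} (hz : 0 ≤ z) :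
    ∫ y in (0 : ℝ)..z, max 1 y ^ (-β₂) ≤ tailC β₂ := by
  rw [intervalIntegral.integral_of_le hz]
  exact setIntegral_mono_set (integrableOn_tail hβ₂)
    (Eventually.of_forall fun y => (tail_pos β₂ y).le)
    (Eventually.of_forall fun _ (hy : _ ∈ Ioc 0 z) => hy.1)

/-- One of y and z - y is at least z/2, and its tail is at most 2^β₂ times the tail at z. The other
tail is kept for integration in y, which is where β₂ > 1 is needed. -/
lemma tail_mul_tail_le (hβ₂ : 0 ≤ β₂) {y z : ℝ} :
    max 1 (z - y) ^ (-β₂) * max 1 y ^ (-β₂) ≤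
      2 ^ β₂ * max 1 z ^ (-β₂) * (max 1 y ^ (-β₂) + max 1 (z - y) ^ (-β₂)) := by
  have key : ∀ t, z / 2 ≤ t → max 1 t ^ (-β₂) ≤ 2 ^ β₂ * max 1 z ^ (-β₂) := by
    intro t ht
    have e : (2 : ℝ) ^ β₂ = (1 / 2 : ℝ) ^ (-β₂) := by
      rw [Real.rpow_neg (by norm_num), one_div, Real.inv_rpow (by norm_num), inv_inv]
    have hz1 : 0 < max 1 z := lt_max_of_lt_left one_pos
    rw [e, ← Real.mul_rpow (by norm_num) hz1.le]
    refine Real.rpow_le_rpow_of_nonpos (by positivity) ?_ (by linarith)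
    rcases max_choice 1 z with h | h <;> rw [h]
    · exact le_max_of_le_left (by norm_num)
    · exact le_max_of_le_right (by linarith)
  have p1 := tail_pos β₂ y
  have p2 := tail_pos β₂ (z - y)
  have p3 : 0 < 2 ^ β₂ * max 1 z ^ (-β₂) := mul_pos (by positivity) (tail_pos β₂ z)
  rcases le_total (z / 2) y with h | h
  · have := key y h
    nlinarith
  · have := key (z - y) (by linarith)
    nlinarith

/-- The norm of the convolution as a bilinear map. -/
def convC (β₂ : ℝ) : ℝ := 2 ^ β₂ * tailC β₂

lemma convC_nonneg (β₂ : ℝ) : 0 ≤ convC β₂ := mul_nonneg (by positivity) (tailC_nonneg β₂)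

/-- The exponentials multiply exactly to exp(-β₁z), so only the algebraic tails have to be
convolved. The factor 1/2 in `conv` cancels the two equal tail integrals. -/
lemma abs_conv_le (hβ₂ : 1 < β₂) (hf : WBdd β₁ β₂ m f) (hg : WBdd β₁ β₂ m' g)
    {z : ℝ} (hz : 0 ≤ z) : |conv f g z| ≤ convC β₂ * m * m' * wt β₁ β₂ z := by
  have hm := hf.nonneg
  have hm' := hg.nonneg
  have hb : ∀ y ∈ Ioc 0 z, ‖f (z - y) * g y‖ ≤
      m * m' * Real.exp (-β₁ * z) * (2 ^ β₂ * max 1 z ^ (-β₂)) *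
        (max 1 y ^ (-β₂) + max 1 (z - y) ^ (-β₂)) := by
    intro y hy
    have e1 := hf.bound (z - y) (by linarith [hy.2])
    have e2 := hg.bound y hy.1.le
    have e3 := tail_mul_tail_le (by linarith : 0 ≤ β₂) (y := y) (z := z)
    rw [norm_mul, Real.norm_eq_abs, Real.norm_eq_abs]
    calc |f (z - y)| * |g y| ≤ (m * wt β₁ β₂ (z - y)) * (m' * wt β₁ β₂ y) := by
          gcongr
          exact mul_nonneg hm (wt_pos _ _ _).le
      _ = m * m' * (Real.exp (-β₁ * (z - y)) * Real.exp (-β₁ * y)) *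
            (max 1 (z - y) ^ (-β₂) * max 1 y ^ (-β₂)) := by
          unfold wt
          ring
      _ = m * m' * Real.exp (-β₁ * z) * (max 1 (z - y) ^ (-β₂) * max 1 y ^ (-β₂)) := by
          rw [← Real.exp_add]
          ring_nf
      _ ≤ _ := by
          rw [mul_assoc (m * m' * _)]
          gcongr
  have hi1 : IntervalIntegrable (fun y : ℝ => max 1 y ^ (-β₂)) volume 0 z :=
    (continuous_tail β₂).intervalIntegrable _ _
  have hi2 : IntervalIntegrable (fun y : ℝ => max 1 (z - y) ^ (-β₂)) volume 0 z :=
    ((continuous_tail β₂).comp (continuous_const.sub continuous_id)).intervalIntegrable _ _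
  have h1 := intervalIntegral.norm_integral_le_of_norm_le hz (f := fun y => f (z - y) * g y)
    (Eventually.of_forall fun y => hb y) ((hi1.add hi2).const_mul _)
  have h2 : ∫ y in (0 : ℝ)..z, max 1 (z - y) ^ (-β₂) = ∫ y in (0 : ℝ)..z, max 1 y ^ (-β₂) := by
    have := intervalIntegral.integral_comp_sub_left (fun y : ℝ => max 1 y ^ (-β₂)) z (a := 0)
      (b := z)
    simpa using this
  rw [intervalIntegral.integral_const_mul, intervalIntegral.integral_add hi1 hi2, h2,
    Real.norm_eq_abs] at h1
  have h3 := integral_tail_le hβ₂ hz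
  have ht := tail_pos β₂ z
  rw [conv, abs_mul, abs_of_pos (by norm_num : (0 : ℝ) < 1 / 2)]
  calc _ ≤ 1 / 2 * (m * m' * Real.exp (-β₁ * z) * (2 ^ β₂ * max 1 z ^ (-β₂)) *
        (tailC β₂ + tailC β₂)) := by
        refine mul_le_mul_of_nonneg_left (h1.trans ?_) (by norm_num)
        gcongr
    _ = _ := by
        unfold convC wt
        ring

lemma aestronglyMeasurable_conv (hf : IntegrableOn f (Ioi 0)) (hg : IntegrableOn g (Ioi 0)) :
    AEStronglyMeasurable (conv f g) (volume.restrict (Ioi 0)) := by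
  have h := (integrable_posConvolution (μ := volume) (ν := volume) hg hf
    (ContinuousLinearMap.mul ℝ ℝ)).aestronglyMeasurable.const_mul (1 / 2)
  refine h.restrict.congr ?_
  filter_upwards [ae_restrict_mem measurableSet_Ioi] with z hz
  rw [posConvolution, indicator_of_mem hz, conv]
  simp only [ContinuousLinearMap.mul_apply', mul_comm]

lemma WBdd.conv (hβ₁ : 0 < β₁) (hβ₂ : 1 < β₂) (hf : WBdd β₁ β₂ m f) (hg : WBdd β₁ β₂ m' g) :
    WBdd β₁ β₂ (convC β₂ * m * m') (conv f g) :=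
  ⟨aestronglyMeasurable_conv (hf.integrableOn hβ₁ (by linarith))
    (hg.integrableOn hβ₁ (by linarith)), fun _ hz => abs_conv_le hβ₂ hf hg hz⟩

/-- Lipschitz dependence of `f ↦ conv f f` on `f`. -/
lemma WBdd.conv_self_sub {d : ℝ} (hβ₁ : 0 < β₁) (hβ₂ : 1 < β₂) (hf : WBdd β₁ β₂ m f)
    (hg : WBdd β₁ β₂ m g) (hd : WBdd β₁ β₂ d (f - g)) :
    WBdd β₁ β₂ (2 * convC β₂ * m * d) (LSW.conv f f - LSW.conv g g) := by
  have hβ : 0 ≤ β₂ := by linarith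
  refine ⟨(hf.conv hβ₁ hβ₂ hf).meas.sub (hg.conv hβ₁ hβ₂ hg).meas, fun z hz => ?_⟩
  have e : (LSW.conv f f - LSW.conv g g) z = LSW.conv (f - g) f z + LSW.conv g (f - g) z := by
    rw [Pi.sub_apply]
    unfold LSW.conv
    rw [← mul_sub, ← mul_add,
      ← intervalIntegral.integral_sub (intervalIntegrable_conv hβ₁ hβ hf hf hz)
        (intervalIntegrable_conv hβ₁ hβ hg hg hz),
      ← intervalIntegral.integral_add (intervalIntegrable_conv hβ₁ hβ hd hf hz)
        (intervalIntegrable_conv hβ₁ hβ hg hd hz)]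
    congr 1
    refine intervalIntegral.integral_congr fun y _ => ?_
    simp only [Pi.sub_apply]
    ring
  rw [e]
  refine (abs_add_le _ _).trans ?_
  have h1 := abs_conv_le hβ₂ hd hf hz
  have h2 := abs_conv_le hβ₂ hg hd hz
  nlinarith

end

end LSW

/-! ### The kernel and the integrals over (z, ∞) and (0, z]. -/

namespace LSW

noncomputable section

variable {δ : ℝ} {p q : ℝ × ℝ} {β₁ β₂ m m' d : ℝ} {G G' : ℝ → ℝ}

/-- The kernel `exp (∫_z^ξ (1 - ε - ε' y) / den δ y dy)`. -/
def ker (δ : ℝ) (p : ℝ × ℝ) (z ξ : ℝ) : ℝ := Real.exp (expo δ p ξ - expo δ p z)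

/-- The integral operator `∫_z^∞ ξ G(ξ) ker(z, ξ) dξ`. -/
def tailInt (δ : ℝ) (p : ℝ × ℝ) (G : ℝ → ℝ) (z : ℝ) : ℝ :=
  ∫ ξ in Ioi z, ξ * G ξ * ker δ p z ξ

/-- The complementary integral `∫_0^z ξ G(ξ) ker(z, ξ) dξ`. -/
def headInt (δ : ℝ) (p : ℝ × ℝ) (G : ℝ → ℝ) (z : ℝ) : ℝ :=
  ∫ ξ in (0 : ℝ)..z, ξ * G ξ * ker δ p z ξ

/-- The growth constant of the kernel. -/
def kerC (β₁ : ℝ) : ℝ := Real.exp (25 ^ 2 / (4 * (β₁ / 4)))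

lemma one_le_kerC (hβ₁ : 0 < β₁) : 1 ≤ kerC β₁ := Real.one_le_exp (by positivity)

lemma ker_le_of_one_le (hβ₁ : 0 < β₁) (hδ : 0 < δ) (hδ1 : δ ≤ 1) (hp : 0 ≤ p) {z ξ : ℝ}
    (hz : 1 ≤ z) (h : z ≤ ξ) : ker δ p z ξ ≤ kerC β₁ * Real.exp (β₁ / 4 * (ξ - z)) := by
  rw [ker, kerC, ← Real.exp_add]
  exact Real.exp_le_exp.2 (expo_sub_le_of_one_le hδ hδ1 hp (by positivity) hz h)

lemma expo_le_expo_zero_one (hδ : 0 < δ) (hδ1 : δ ≤ 1) (hp : 0 ≤ p) {ξ : ℝ} (h0 : 0 ≤ ξ)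
    (h : ξ ≤ 1) : expo δ p ξ ≤ expo δ 0 1 := by
  have := expo_sub_le hδ hδ1 hp le_rfl h0
  simp only [expo_zero_right, sub_zero] at this
  exact this.trans (expo_zero_mono hδ hδ1 h)

/-- The kernel is multiplicative across ξ = 1: up to 1 it costs at most exp E(1), computed at zero
parameters, and beyond 1 only the slow exponential. -/
lemma ker_zero_le (hβ₁ : 0 < β₁) (hδ : 0 < δ) (hδ1 : δ ≤ 1) (hp : 0 ≤ p) {ξ : ℝ} (h : 0 ≤ ξ) :
    ker δ p 0 ξ ≤ kerC β₁ * Real.exp (expo δ 0 1) * Real.exp (β₁ / 4 * (ξ - 0)) := by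
  rcases le_total ξ 1 with h1 | h1
  · rw [ker, expo_zero_right, sub_zero]
    have e1 := Real.exp_le_exp.2 (expo_le_expo_zero_one hδ hδ1 hp h h1)
    have e2 : 1 ≤ Real.exp (β₁ / 4 * (ξ - 0)) := Real.one_le_exp (by rw [sub_zero]; positivity)
    have e3 := one_le_kerC hβ₁
    have e4 := Real.exp_pos (expo δ 0 1)
    calc _ ≤ 1 * Real.exp (expo δ 0 1) * 1 := by linarith
      _ ≤ _ := by gcongr
  · have e1 := ker_le_of_one_le hβ₁ hδ hδ1 hp le_rfl h1
    have e2 := Real.exp_le_exp.2 (expo_le_expo_zero_one hδ hδ1 hp zero_le_one le_rfl)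
    have e3 := one_le_kerC hβ₁
    calc ker δ p 0 ξ = ker δ p 1 ξ * Real.exp (expo δ p 1) := by
          rw [ker, ker, ← Real.exp_add, expo_zero_right]
          ring_nf
      _ ≤ kerC β₁ * Real.exp (β₁ / 4 * (ξ - 1)) * Real.exp (expo δ 0 1) := by gcongr
      _ = kerC β₁ * Real.exp (expo δ 0 1) * Real.exp (β₁ / 4 * (ξ - 1)) := by ring
      _ ≤ _ := by
          gcongr
          norm_num

lemma abs_exp_sub_exp_le {x y B : ℝ} (hx : Real.exp x ≤ B) (hy : Real.exp y ≤ B) :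
    |Real.exp x - Real.exp y| ≤ |x - y| * B := by
  have key : ∀ x y : ℝ, y ≤ x → Real.exp x ≤ B → |Real.exp x - Real.exp y| ≤ |x - y| * B := by
    intro x y hxy hB
    rw [abs_of_nonneg (sub_nonneg.2 (Real.exp_le_exp.2 hxy)), abs_of_nonneg (sub_nonneg.2 hxy)]
    have t2 : Real.exp y = Real.exp x * Real.exp (y - x) := by
      rw [← Real.exp_add]; ring_nf
    have t3 := Real.add_one_le_exp (y - x)
    have t5 := Real.exp_pos x
    calc Real.exp x - Real.exp y ≤ (x - y) * Real.exp x := by rw [t2]; nlinarith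
      _ ≤ _ := mul_le_mul_of_nonneg_left hB (by linarith)
  rcases le_total y x with h | h
  · exact key x y h hx
  · rw [abs_sub_comm, abs_sub_comm x]
    exact key y x h hy

lemma continuous_ker (hδ : 0 < δ) (hδ1 : δ ≤ 1) (p : ℝ × ℝ) (z : ℝ) : Continuous (ker δ p z) :=
  Real.continuous_exp.comp ((continuous_expo hδ hδ1 p).sub continuous_const)

lemma ker_pos (δ : ℝ) (p : ℝ × ℝ) (z ξ : ℝ) : 0 < ker δ p z ξ := Real.exp_pos _

lemma abs_ker_sub_ker_le (hδ : 0 < δ) (hδ1 : δ ≤ 1) {z ξ B : ℝ} (hz : 0 ≤ z) (h : z ≤ ξ)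
    (hp : ker δ p z ξ ≤ B) (hq : ker δ q z ξ ≤ B) :
    |ker δ p z ξ - ker δ q z ξ| ≤ 64 / δ * ‖p - q‖ * (ξ - z) * B :=
  (abs_exp_sub_exp_le hp hq).trans (mul_le_mul_of_nonneg_right
    (abs_expo_sub_sub_le hδ hδ1 p q hz h) ((ker_pos δ p z ξ).le.trans hp))

/-- Up to the exponential, max(1, t) times the weight is max(1, t)^(1 - β₂), which is nonincreasing
for β₂ ≥ 1. So ξ times the weight at ξ can be compared with its value at z, keeping the full decay
in ξ - z. -/
lemma mul_wt_le_of_le (hβ₂ : 1 ≤ β₂) {z ξ : ℝ} (h : z ≤ ξ) :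
    ξ * wt β₁ β₂ ξ ≤ max 1 z * wt β₁ β₂ z * Real.exp (-β₁ * (ξ - z)) := by
  have key : ∀ t, max 1 t * wt β₁ β₂ t = Real.exp (-β₁ * t) * max 1 t ^ (1 - β₂) := by
    intro t
    have h1 : 0 < max 1 t := lt_max_of_lt_left one_pos
    rw [wt, sub_eq_add_neg, Real.rpow_add h1, Real.rpow_one]
    ring
  have h1 : 0 < max 1 z := lt_max_of_lt_left one_pos
  calc ξ * wt β₁ β₂ ξ ≤ max 1 ξ * wt β₁ β₂ ξ :=
        mul_le_mul_of_nonneg_right (le_max_right _ _) (wt_pos _ _ _).le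
    _ = Real.exp (-β₁ * ξ) * max 1 ξ ^ (1 - β₂) := key ξ
    _ ≤ Real.exp (-β₁ * ξ) * max 1 z ^ (1 - β₂) := by
        refine mul_le_mul_of_nonneg_left ?_ (Real.exp_pos _).le
        exact Real.rpow_le_rpow_of_nonpos h1 (max_le_max le_rfl h) (by linarith)
    _ = _ := by
        rw [key z, mul_right_comm, ← Real.exp_add]
        ring_nf

lemma integral_exp_decay (hβ₁ : 0 < β₁) (z : ℝ) :
    IntegrableOn (fun ξ => Real.exp (-(β₁ / 2) * (ξ - z))) (Ioi z) ∧
      ∫ ξ in Ioi z, Real.exp (-(β₁ / 2) * (ξ - z)) = 2 / β₁ := by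
  have e : ∀ ξ, Real.exp (-(β₁ / 2) * (ξ - z)) =
      Real.exp (β₁ / 2 * z) * Real.exp (-(β₁ / 2) * ξ) := by
    intro ξ
    rw [← Real.exp_add]
    ring_nf
  have hneg : -(β₁ / 2) < 0 := by linarith
  simp only [e]
  refine ⟨(integrableOn_exp_mul_Ioi hneg z).const_mul _, ?_⟩
  rw [integral_const_mul, integral_exp_mul_Ioi hneg]
  have : Real.exp (β₁ / 2 * z) * Real.exp (-(β₁ / 2) * z) = 1 := by
    rw [← Real.exp_add]
    ring_nf
    exact Real.exp_zero
  calc _ = Real.exp (β₁ / 2 * z) * Real.exp (-(β₁ / 2) * z) * (2 / β₁) := by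
        rw [neg_div_neg_eq]
        field_simp
    _ = _ := by rw [this, one_mul]

lemma exp_mul_exp_le (hβ₁ : 0 < β₁) {t : ℝ} (ht : 0 ≤ t) :
    Real.exp (-β₁ * t) * Real.exp (β₁ / 4 * t) ≤ Real.exp (-(β₁ / 2) * t) := by
  rw [← Real.exp_add]
  exact Real.exp_le_exp.2 (by nlinarith)

/-- The factor t = ξ - z comes from the Lipschitz dependence of the kernel on the parameters;
another quarter of the decay rate absorbs it. -/
lemma mul_exp_mul_exp_le (hβ₁ : 0 < β₁) (t : ℝ) :
    t * (Real.exp (-β₁ * t) * Real.exp (β₁ / 4 * t)) ≤ 4 / β₁ * Real.exp (-(β₁ / 2) * t) := by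
  have h := Real.add_one_le_exp (β₁ / 4 * t)
  have e : Real.exp (-β₁ * t) * Real.exp (β₁ / 4 * t) * Real.exp (β₁ / 4 * t) =
      Real.exp (-(β₁ / 2) * t) := by
    rw [← Real.exp_add, ← Real.exp_add]
    ring_nf
  have h2 : t ≤ 4 / β₁ * Real.exp (β₁ / 4 * t) := by
    rw [div_mul_eq_mul_div, le_div_iff₀ hβ₁]
    linarith
  calc _ ≤ 4 / β₁ * Real.exp (β₁ / 4 * t) * (Real.exp (-β₁ * t) * Real.exp (β₁ / 4 * t)) := by
        gcongr
    _ = _ := by rw [← e]; ring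

/-- The constant B stays free because two values occur: `kerC β₁` for z ≥ 1, and `kerC β₁` times exp
E(1) for z = 0. -/
lemma abs_tailInt_integrand_le (hβ₁ : 0 < β₁) (hβ₂ : 1 ≤ β₂) (hG : WBdd β₁ β₂ m G)
    {z ξ B : ℝ} (hB0 : 0 ≤ B) (hz : 0 ≤ z) (h : z ≤ ξ)
    (hB : ker δ p z ξ ≤ B * Real.exp (β₁ / 4 * (ξ - z))) :
    |ξ * G ξ * ker δ p z ξ| ≤
      m * B * (max 1 z * wt β₁ β₂ z) * Real.exp (-(β₁ / 2) * (ξ - z)) := by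
  have hξ : 0 ≤ ξ := hz.trans h
  have hm := hG.nonneg
  have hw : 0 ≤ max 1 z * wt β₁ β₂ z :=
    mul_nonneg (zero_le_one.trans (le_max_left _ _)) (wt_pos _ _ _).le
  rw [abs_mul, abs_mul, abs_of_nonneg hξ, abs_of_pos (ker_pos _ _ _ _)]
  calc ξ * |G ξ| * ker δ p z ξ ≤ ξ * (m * wt β₁ β₂ ξ) * (B * Real.exp (β₁ / 4 * (ξ - z))) := by
        have h1 := (wt_pos β₁ β₂ ξ).le
        have h2 := (ker_pos δ p z ξ).le
        have h3 := hG.bound ξ hξ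
        gcongr
    _ = m * B * (ξ * wt β₁ β₂ ξ) * Real.exp (β₁ / 4 * (ξ - z)) := by ring
    _ ≤ m * B * (max 1 z * wt β₁ β₂ z * Real.exp (-β₁ * (ξ - z))) *
          Real.exp (β₁ / 4 * (ξ - z)) := by
        have h1 := mul_wt_le_of_le (β₁ := β₁) hβ₂ h
        have h2 : 0 ≤ m * B := mul_nonneg hm hB0
        exact mul_le_mul_of_nonneg_right (mul_le_mul_of_nonneg_left h1 h2) (Real.exp_pos _).le
    _ = m * B * (max 1 z * wt β₁ β₂ z) *
          (Real.exp (-β₁ * (ξ - z)) * Real.exp (β₁ / 4 * (ξ - z))) := by ring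
    _ ≤ _ := by
        gcongr
        exact exp_mul_exp_le hβ₁ (by linarith)

lemma aestronglyMeasurable_integrand (hδ : 0 < δ) (hδ1 : δ ≤ 1) (hG : WBdd β₁ β₂ m G) {z : ℝ}
    (hz : 0 ≤ z) (t : ℝ) :
    AEStronglyMeasurable (fun ξ => ξ * G ξ * ker δ p t ξ) (volume.restrict (Ioi z)) :=
  (continuous_id.aestronglyMeasurable.mul
    (hG.meas.mono_measure (Measure.restrict_mono (Ioi_subset_Ioi hz) le_rfl))).mul
    (continuous_ker hδ hδ1 p t).aestronglyMeasurable

lemma integrableOn_tailInt (hβ₁ : 0 < β₁) (hβ₂ : 1 ≤ β₂) (hδ : 0 < δ) (hδ1 : δ ≤ 1)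
    (hG : WBdd β₁ β₂ m G) {z B : ℝ} (hB0 : 0 ≤ B) (hz : 0 ≤ z)
    (hB : ∀ ξ, z ≤ ξ → ker δ p z ξ ≤ B * Real.exp (β₁ / 4 * (ξ - z))) :
    IntegrableOn (fun ξ => ξ * G ξ * ker δ p z ξ) (Ioi z) := by
  refine Integrable.mono' ((integral_exp_decay hβ₁ z).1.const_mul
    (m * B * (max 1 z * wt β₁ β₂ z))) (aestronglyMeasurable_integrand hδ hδ1 hG hz z) ?_
  filter_upwards [ae_restrict_mem measurableSet_Ioi] with ξ hξ
  exact abs_tailInt_integrand_le hβ₁ hβ₂ hG hB0 hz (le_of_lt hξ) (hB ξ (le_of_lt hξ))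

lemma abs_tailInt_le (hβ₁ : 0 < β₁) (hβ₂ : 1 ≤ β₂) (hG : WBdd β₁ β₂ m G) {z B : ℝ}
    (hB0 : 0 ≤ B) (hz : 0 ≤ z)
    (hB : ∀ ξ, z ≤ ξ → ker δ p z ξ ≤ B * Real.exp (β₁ / 4 * (ξ - z))) :
    |tailInt δ p G z| ≤ m * B * (max 1 z * wt β₁ β₂ z) * (2 / β₁) := by
  have h := norm_integral_le_of_norm_le (μ := volume.restrict (Ioi z))
    (f := fun ξ => ξ * G ξ * ker δ p z ξ)
    ((integral_exp_decay hβ₁ z).1.const_mul (m * B * (max 1 z * wt β₁ β₂ z))) (by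
      filter_upwards [ae_restrict_mem measurableSet_Ioi] with ξ hξ
      exact abs_tailInt_integrand_le hβ₁ hβ₂ hG hB0 hz (le_of_lt hξ) (hB ξ (le_of_lt hξ)))
  rwa [integral_const_mul, (integral_exp_decay hβ₁ z).2] at h

lemma abs_tailInt_sub_le (hβ₁ : 0 < β₁) (hβ₂ : 1 ≤ β₂) (hδ : 0 < δ) (hδ1 : δ ≤ 1)
    (hG : WBdd β₁ β₂ m G) {z B : ℝ} (hB0 : 0 ≤ B) (hz : 0 ≤ z)
    (hB : ∀ ξ, z ≤ ξ → ker δ p z ξ ≤ B * Real.exp (β₁ / 4 * (ξ - z)))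
    (hB' : ∀ ξ, z ≤ ξ → ker δ q z ξ ≤ B * Real.exp (β₁ / 4 * (ξ - z))) :
    |tailInt δ p G z - tailInt δ q G z| ≤
      m * B * (64 / δ * ‖p - q‖) * (4 / β₁) * (max 1 z * wt β₁ β₂ z) * (2 / β₁) := by
  have hm := hG.nonneg
  have hw : 0 ≤ max 1 z * wt β₁ β₂ z :=
    mul_nonneg (zero_le_one.trans (le_max_left _ _)) (wt_pos _ _ _).le
  rw [tailInt, tailInt, ← integral_sub (integrableOn_tailInt hβ₁ hβ₂ hδ hδ1 hG hB0 hz hB)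
    (integrableOn_tailInt hβ₁ hβ₂ hδ hδ1 hG hB0 hz hB')]
  have h := norm_integral_le_of_norm_le (μ := volume.restrict (Ioi z))
    (f := fun ξ => ξ * G ξ * ker δ p z ξ - ξ * G ξ * ker δ q z ξ)
    ((integral_exp_decay hβ₁ z).1.const_mul
      (m * B * (64 / δ * ‖p - q‖) * (4 / β₁) * (max 1 z * wt β₁ β₂ z))) (by
      filter_upwards [ae_restrict_mem measurableSet_Ioi] with ξ hξ
      have hzξ : z ≤ ξ := le_of_lt hξ
      have hξ0 : 0 ≤ ξ := hz.trans hzξ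
      rw [← mul_sub, norm_mul, norm_mul, Real.norm_eq_abs, Real.norm_eq_abs, Real.norm_eq_abs,
        abs_of_nonneg hξ0]
      have hwξ := (wt_pos β₁ β₂ ξ).le
      have ht : 0 ≤ ξ - z := by linarith
      calc ξ * |G ξ| * |ker δ p z ξ - ker δ q z ξ|
          ≤ ξ * (m * wt β₁ β₂ ξ) *
            (64 / δ * ‖p - q‖ * (ξ - z) * (B * Real.exp (β₁ / 4 * (ξ - z)))) := by
            gcongr
            · exact hG.bound ξ hξ0
            · exact abs_ker_sub_ker_le hδ hδ1 hz hzξ (hB ξ hzξ) (hB' ξ hzξ)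
        _ = m * B * (64 / δ * ‖p - q‖) * (ξ * wt β₁ β₂ ξ) * (ξ - z) *
              Real.exp (β₁ / 4 * (ξ - z)) := by ring
        _ ≤ m * B * (64 / δ * ‖p - q‖) * (max 1 z * wt β₁ β₂ z * Real.exp (-β₁ * (ξ - z))) *
              (ξ - z) * Real.exp (β₁ / 4 * (ξ - z)) := by
            have h1 := mul_wt_le_of_le (β₁ := β₁) hβ₂ hzξ
            have h2 : 0 ≤ m * B * (64 / δ * ‖p - q‖) := by positivity
            exact mul_le_mul_of_nonneg_right (mul_le_mul_of_nonneg_right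
              (mul_le_mul_of_nonneg_left h1 h2) ht) (Real.exp_pos _).le
        _ = m * B * (64 / δ * ‖p - q‖) * (max 1 z * wt β₁ β₂ z) *
              ((ξ - z) * (Real.exp (-β₁ * (ξ - z)) * Real.exp (β₁ / 4 * (ξ - z)))) := by ring
        _ ≤ m * B * (64 / δ * ‖p - q‖) * (max 1 z * wt β₁ β₂ z) *
              (4 / β₁ * Real.exp (-(β₁ / 2) * (ξ - z))) := by
            exact mul_le_mul_of_nonneg_left (mul_exp_mul_exp_le hβ₁ _) (by positivity)
        _ = _ := by ring)
  rwa [integral_const_mul, (integral_exp_decay hβ₁ z).2] at h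

lemma ker_le_one (hδ : 0 < δ) (hδ1 : δ ≤ 1) (hp : 0 ≤ p) (hp1 : p.1 + p.2 ≤ 1) {z ξ : ℝ}
    (h : ξ ≤ z) (hz : z ≤ 1) : ker δ p z ξ ≤ 1 :=
  Real.exp_le_one_iff.2 (sub_nonpos.2 (expo_mono hδ hδ1 hp hp1 h hz))

/-- For ξ ≤ z ≤ 1 the exponent is monotone and the kernel is at most 1. No exponentially large
factor enters this part. -/
lemma abs_headInt_le (hβ₁ : 0 ≤ β₁) (hβ₂ : 0 ≤ β₂) (hδ : 0 < δ) (hδ1 : δ ≤ 1) (hp : 0 ≤ p)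
    (hp1 : p.1 + p.2 ≤ 1) (hG : WBdd β₁ β₂ m G) {z : ℝ} (hz : z ∈ Icc (0 : ℝ) 1) :
    |headInt δ p G z| ≤ m := by
  have hm := hG.nonneg
  rw [headInt, ← Real.norm_eq_abs]
  refine (intervalIntegral.norm_integral_le_of_norm_le_const (C := m) fun ξ hξ => ?_).trans ?_
  · rw [uIoc_of_le hz.1] at hξ
    have e1 := (hG.bound ξ hξ.1.le).trans
      (mul_le_of_le_one_right hm (wt_le_one hβ₁ hβ₂ hξ.1.le))
    have e2 := ker_le_one hδ hδ1 hp hp1 hξ.2 hz.2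
    have e3 := (ker_pos δ p z ξ).le
    rw [norm_mul, norm_mul, Real.norm_of_nonneg hξ.1.le, Real.norm_of_nonneg e3, Real.norm_eq_abs]
    calc ξ * |G ξ| * ker δ p z ξ ≤ 1 * m * 1 := by
          gcongr
          exact hξ.2.trans hz.2
      _ = m := by ring
  · rw [sub_zero, abs_of_nonneg hz.1]
    exact mul_le_of_le_one_right hm hz.2

lemma intervalIntegrable_headInt (hβ₁ : 0 < β₁) (hβ₂ : 0 ≤ β₂) (hδ : 0 < δ) (hδ1 : δ ≤ 1)
    (hG : WBdd β₁ β₂ m G) {z : ℝ} (hz : 0 ≤ z) (t : ℝ) :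
    IntervalIntegrable (fun ξ => ξ * G ξ * ker δ p t ξ) volume 0 z := by
  have h := hG.intervalIntegrable hβ₁ hβ₂ hz
  exact (h.continuousOn_mul continuous_id.continuousOn).mul_continuousOn
    (continuous_ker hδ hδ1 p t).continuousOn

lemma abs_headInt_sub_le (hβ₁ : 0 < β₁) (hβ₂ : 0 ≤ β₂) (hδ : 0 < δ) (hδ1 : δ ≤ 1) (hp : 0 ≤ p)
    (hp1 : p.1 + p.2 ≤ 1) (hq : 0 ≤ q) (hq1 : q.1 + q.2 ≤ 1) (hG : WBdd β₁ β₂ m G) {z : ℝ}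
    (hz : z ∈ Icc (0 : ℝ) 1) :
    |headInt δ p G z - headInt δ q G z| ≤ m * (64 / δ * ‖p - q‖) := by
  have hm := hG.nonneg
  rw [headInt, headInt, ← intervalIntegral.integral_sub
    (intervalIntegrable_headInt hβ₁ hβ₂ hδ hδ1 hG hz.1 z)
    (intervalIntegrable_headInt hβ₁ hβ₂ hδ hδ1 hG hz.1 z), ← Real.norm_eq_abs]
  refine (intervalIntegral.norm_integral_le_of_norm_le_const
    (C := m * (64 / δ * ‖p - q‖)) fun ξ hξ => ?_).trans ?_
  · rw [uIoc_of_le hz.1] at hξ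
    have e1 := (hG.bound ξ hξ.1.le).trans
      (mul_le_of_le_one_right hm (wt_le_one hβ₁.le hβ₂ hξ.1.le))
    have e2 : |ker δ p z ξ - ker δ q z ξ| ≤ 64 / δ * ‖p - q‖ * (z - ξ) * 1 := by
      refine (abs_exp_sub_exp_le (ker_le_one hδ hδ1 hp hp1 hξ.2 hz.2)
        (ker_le_one hδ hδ1 hq hq1 hξ.2 hz.2)).trans ?_
      gcongr
      have := abs_expo_sub_sub_le hδ hδ1 p q hξ.1.le hξ.2
      rw [← abs_neg]
      refine le_of_eq_of_le ?_ this
      congr 1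
      ring
    rw [← mul_sub, norm_mul, norm_mul, Real.norm_of_nonneg hξ.1.le, Real.norm_eq_abs,
      Real.norm_eq_abs]
    have h3 : z - ξ ≤ 1 := by linarith [hz.2, hξ.1]
    have h4 : 0 ≤ z - ξ := by linarith [hξ.2]
    calc ξ * |G ξ| * |ker δ p z ξ - ker δ q z ξ| ≤ 1 * m * (64 / δ * ‖p - q‖ * 1 * 1) := by
          gcongr
          · exact hξ.2.trans hz.2
          · refine e2.trans ?_
            gcongr
      _ = _ := by ring
  · rw [sub_zero, abs_of_nonneg hz.1]
    exact mul_le_of_le_one_right (by positivity) hz.2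

/-- Splitting of the tail integral. -/
lemma tailInt_eq (hβ₁ : 0 < β₁) (hβ₂ : 1 ≤ β₂) (hδ : 0 < δ) (hδ1 : δ ≤ 1) (hp : 0 ≤ p)
    (hG : WBdd β₁ β₂ m G) {z : ℝ} (hz : 0 ≤ z) :
    tailInt δ p G z = Real.exp (-expo δ p z) * tailInt δ p G 0 - headInt δ p G z := by
  have hint : IntegrableOn (fun ξ => ξ * G ξ * ker δ p 0 ξ) (Ioi 0) := by
    refine integrableOn_tailInt hβ₁ hβ₂ hδ hδ1 hG (B := kerC β₁ * Real.exp (expo δ 0 1)) ?_ le_rfl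
      fun ξ hξ => ker_zero_le hβ₁ hδ hδ1 hp hξ
    have := one_le_kerC hβ₁
    positivity
  have e : ∀ ξ, ξ * G ξ * ker δ p z ξ = Real.exp (-expo δ p z) * (ξ * G ξ * ker δ p 0 ξ) := by
    intro ξ
    have : ker δ p z ξ = Real.exp (-expo δ p z) * ker δ p 0 ξ := by
      rw [ker, ker, ← Real.exp_add, expo_zero_right]
      ring_nf
    rw [this]
    ring
  simp only [tailInt, headInt, e]
  rw [integral_const_mul, intervalIntegral.integral_const_mul, ← mul_sub]
  congr 1
  rw [eq_sub_iff_add_eq, add_comm]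
  rw [intervalIntegral.integral_of_le hz, ← setIntegral_union Ioc_disjoint_Ioi_same
    measurableSet_Ioi (hint.mono_set fun y hy => hy.1) (hint.mono_set (Ioi_subset_Ioi hz)),
    Ioc_union_Ioi_eq_Ioi hz]

end

end LSW

/-! ### Moments of the operator and their Lipschitz dependence on parameters and convolution. -/

namespace LSW

noncomputable section

/-- Smallness of `δ` and admissibility of the range `[0, η √δ]` of the parameters. -/
structure Small (η δ : ℝ) : Prop where
  pos : 0 < δ
  le : δ ≤ 1 / 16
  eta_nonneg : 0 ≤ η
  eta_le : η * √δ ≤ 1 / 2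

/-- The range of the parameters. -/
def box (η δ : ℝ) : Set (ℝ × ℝ) := Icc 0 (η * √δ, η * √δ)

variable {δ η : ℝ} {p q : ℝ × ℝ} {β₁ β₂ m d : ℝ} {G G' g : ℝ → ℝ}

lemma Small.le_one (h : Small η δ) : δ ≤ 1 := h.le.trans (by norm_num)

lemma Small.add_le_one (h : Small η δ) (hp : p ∈ box η δ) : p.1 + p.2 ≤ 1 := by
  have h1 : p.1 ≤ η * √δ := hp.2.1
  have h2 : p.2 ≤ η * √δ := hp.2.2
  linarith [h.eta_le]

/-- The bound for the profiles `homSol δ p` on `[0, 1]`. -/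
def profC (η : ℝ) : ℝ := Real.exp (64 * Real.pi * η) * 1500000000

lemma profC_pos (η : ℝ) : 0 < profC η := by unfold profC; positivity

/-- Parameters in the box alter the exponent by at most 64πη, so the bound at zero parameters
carries over with a factor independent of δ. -/
lemma homSol_le (h : Small η δ) (hp : p ∈ box η δ) {z : ℝ} (hz : z ∈ Icc (0 : ℝ) 1) :
    homSol δ p z ≤ profC η := by
  have h1 := expo_zero_sub_expo_le h.pos h.le_one h.eta_nonneg hp hz
  have h2 := homSol_zero_le_const h.pos h.le hz
  have hd := den_pos h.pos h.le_one z
  calc homSol δ p z = Real.exp (expo δ 0 z - expo δ p z) * homSol δ 0 z := by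
        rw [homSol, homSol, ← mul_div_assoc, ← Real.exp_add]
        ring_nf
    _ ≤ Real.exp (64 * Real.pi * η) * 1500000000 := by
        have := (homSol_pos h.pos h.le_one 0 z).le
        gcongr

lemma abs_homSol_sub_le (h : Small η δ) (hp : p ∈ box η δ) (hq : q ∈ box η δ) {z : ℝ}
    (hz : z ∈ Icc (0 : ℝ) 1) :
    |homSol δ p z - homSol δ q z| ≤ profC η * (64 / δ * ‖p - q‖) := by
  have hd := den_pos h.pos h.le_one z
  have key : ∀ r ∈ box η δ, Real.exp (-expo δ r z) ≤ profC η * den δ z := by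
    intro r hr
    have := homSol_le h hr hz
    rwa [homSol, div_le_iff₀ hd] at this
  have h1 := abs_exp_sub_exp_le (key p hp) (key q hq)
  have h2 : |-expo δ p z - -expo δ q z| ≤ 64 / δ * ‖p - q‖ := by
    have := abs_expo_sub_sub_le h.pos h.le_one p q le_rfl hz.1
    simp only [expo_zero_right, sub_zero] at this
    rw [← abs_neg, show -(-expo δ p z - -expo δ q z) = expo δ p z - expo δ q z by ring]
    have h3 : 0 ≤ 64 / δ * ‖p - q‖ := mul_nonneg (div_nonneg (by norm_num) h.pos.le) (norm_nonneg _)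
    exact this.trans (mul_le_of_le_one_right h3 hz.2)
  have hC := profC_pos η
  rw [homSol, homSol, ← sub_div, abs_div, abs_of_pos hd, div_le_iff₀ hd]
  calc _ ≤ _ := h1
    _ ≤ 64 / δ * ‖p - q‖ * (profC η * den δ z) := by gcongr
    _ = _ := by ring

/-- Continuous weights of moderate size, used for the moments `∫ g I`. -/
structure IsWeight (g : ℝ → ℝ) : Prop where
  cont : Continuous g
  le : ∀ z, 0 ≤ z → |g z| ≤ max 1 z

lemma isWeight_id : IsWeight fun z => z :=
  ⟨continuous_id, fun z hz => by rw [abs_of_nonneg hz]; exact le_max_right _ _⟩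

lemma isWeight_one : IsWeight fun _ => 1 :=
  ⟨continuous_const, fun z _ => by rw [abs_one]; exact le_max_left _ _⟩

lemma IsWeight.le_one (hg : IsWeight g) {z : ℝ} (hz : z ∈ Icc (0 : ℝ) 1) : |g z| ≤ 1 :=
  (hg.le z hz.1).trans (max_le le_rfl hz.2)

/-- Moments of the profiles. -/
def profMom (g : ℝ → ℝ) (δ : ℝ) (p : ℝ × ℝ) : ℝ := ∫ z in (0 : ℝ)..1, g z * homSol δ p z

lemma abs_integral_zero_one_le {f : ℝ → ℝ} {C : ℝ} (hf : ∀ z ∈ Icc (0 : ℝ) 1, |f z| ≤ C) :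
    |∫ z in (0 : ℝ)..1, f z| ≤ C := by
  have := intervalIntegral.norm_integral_le_of_norm_le_const (a := (0 : ℝ)) (b := 1) (f := f)
    (C := C) fun z hz => by
      rw [uIoc_of_le zero_le_one] at hz
      exact hf z ⟨hz.1.le, hz.2⟩
  simpa using this

lemma abs_profMom_le (hg : IsWeight g) (h : Small η δ) (hp : p ∈ box η δ) :
    |profMom g δ p| ≤ profC η := by
  refine abs_integral_zero_one_le fun z hz => ?_
  have h1 := homSol_pos h.pos h.le_one p z
  rw [abs_mul, abs_of_pos h1]
  calc _ ≤ 1 * profC η := by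
        gcongr
        · exact hg.le_one hz
        · exact homSol_le h hp hz
    _ = _ := one_mul _

lemma intervalIntegrable_mul_profile (hg : IsWeight g) (h : Small η δ) (p : ℝ × ℝ) :
    IntervalIntegrable (fun z => g z * homSol δ p z) volume 0 1 :=
  (hg.cont.mul (continuous_homSol h.pos h.le_one p)).intervalIntegrable _ _

lemma abs_profMom_sub_le (hg : IsWeight g) (h : Small η δ) (hp : p ∈ box η δ) (hq : q ∈ box η δ) :
    |profMom g δ p - profMom g δ q| ≤ profC η * (64 / δ * ‖p - q‖) := by
  rw [profMom, profMom, ← intervalIntegral.integral_sub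
    (intervalIntegrable_mul_profile hg h p) (intervalIntegrable_mul_profile hg h q)]
  refine abs_integral_zero_one_le fun z hz => ?_
  rw [← mul_sub, abs_mul]
  calc _ ≤ 1 * (profC η * (64 / δ * ‖p - q‖)) := by
        gcongr
        · exact hg.le_one hz
        · exact abs_homSol_sub_le h hp hq hz
    _ = _ := one_mul _

/-- The size of a joint change of the parameters and of the convolution term. -/
def delta (β₁ δ m d : ℝ) (p q : ℝ × ℝ) : ℝ := d + m * (64 * (1 + 4 / β₁)) * (‖p - q‖ / δ)

lemma delta_self (β₁ δ m d : ℝ) (p : ℝ × ℝ) : delta β₁ δ m d p p = d := by simp [delta]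

lemma ker_bound (hβ₁ : 0 < β₁) (h : Small η δ) (hp : p ∈ box η δ) {z : ℝ} (hz : 1 ≤ z) :
    ∀ ξ, z ≤ ξ → ker δ p z ξ ≤ kerC β₁ * Real.exp (β₁ / 4 * (ξ - z)) := fun _ hξ =>
  ker_le_of_one_le hβ₁ h.pos h.le_one hp.1 hz hξ

lemma ker_zero_bound (hβ₁ : 0 < β₁) (h : Small η δ) (hp : p ∈ box η δ) :
    ∀ ξ, 0 ≤ ξ → ker δ p 0 ξ ≤ kerC β₁ * Real.exp (expo δ 0 1) * Real.exp (β₁ / 4 * (ξ - 0)) :=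
  fun _ hξ => ker_zero_le hβ₁ h.pos h.le_one hp.1 hξ

/-- First G is replaced by G' at the parameter p, then p by q with G' fixed; the two errors add up
to `delta`. -/
lemma abs_tailInt_diff_le (hβ₁ : 0 < β₁) (hβ₂ : 1 ≤ β₂) (h : Small η δ)
    (hG : WBdd β₁ β₂ m G) (hG' : WBdd β₁ β₂ m G') (hd : WBdd β₁ β₂ d (G - G')) {z B : ℝ}
    (hB0 : 0 ≤ B) (hz : 0 ≤ z)
    (hB : ∀ ξ, z ≤ ξ → ker δ p z ξ ≤ B * Real.exp (β₁ / 4 * (ξ - z)))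
    (hB' : ∀ ξ, z ≤ ξ → ker δ q z ξ ≤ B * Real.exp (β₁ / 4 * (ξ - z))) :
    |tailInt δ p G z - tailInt δ q G' z| ≤
      delta β₁ δ m d p q * B * (max 1 z * wt β₁ β₂ z) * (2 / β₁) := by
  have hδ := h.pos
  have hm := hG.nonneg
  have hw : 0 ≤ max 1 z * wt β₁ β₂ z :=
    mul_nonneg (zero_le_one.trans (le_max_left _ _)) (wt_pos _ _ _).le
  have e : tailInt δ p (G - G') z = tailInt δ p G z - tailInt δ p G' z := by
    rw [tailInt, tailInt, tailInt, ← integral_sub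
      (integrableOn_tailInt hβ₁ hβ₂ hδ h.le_one hG hB0 hz hB)
      (integrableOn_tailInt hβ₁ hβ₂ hδ h.le_one hG' hB0 hz hB)]
    refine integral_congr_ae (Eventually.of_forall fun ξ => ?_)
    simp only [Pi.sub_apply]
    ring
  have h1 := abs_tailInt_le (p := p) hβ₁ hβ₂ hd hB0 hz hB
  have h2 := abs_tailInt_sub_le hβ₁ hβ₂ hδ h.le_one hG' hB0 hz hB hB'
  rw [e] at h1
  calc _ ≤ _ := abs_sub_le _ (tailInt δ p G' z) _
    _ ≤ _ := add_le_add h1 h2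
    _ = (d + m * (64 * (4 / β₁)) * (‖p - q‖ / δ)) * B * (max 1 z * wt β₁ β₂ z) * (2 / β₁) := by
        ring
    _ ≤ _ := by
        unfold delta
        gcongr
        linarith

lemma abs_headInt_diff_le (hβ₁ : 0 < β₁) (hβ₂ : 0 ≤ β₂) (h : Small η δ) (hp : p ∈ box η δ)
    (hq : q ∈ box η δ) (hG : WBdd β₁ β₂ m G) (hG' : WBdd β₁ β₂ m G')
    (hd : WBdd β₁ β₂ d (G - G')) {z : ℝ} (hz : z ∈ Icc (0 : ℝ) 1) :
    |headInt δ p G z - headInt δ q G' z| ≤ delta β₁ δ m d p q := by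
  have hδ := h.pos
  have hm := hG.nonneg
  have e : headInt δ p (G - G') z = headInt δ p G z - headInt δ p G' z := by
    rw [headInt, headInt, headInt, ← intervalIntegral.integral_sub
      (intervalIntegrable_headInt hβ₁ hβ₂ hδ h.le_one hG hz.1 z)
      (intervalIntegrable_headInt hβ₁ hβ₂ hδ h.le_one hG' hz.1 z)]
    refine intervalIntegral.integral_congr fun ξ _ => ?_
    simp only [Pi.sub_apply]
    ring
  have h1 := abs_headInt_le hβ₁.le hβ₂ hδ h.le_one hp.1 (h.add_le_one hp) hd hz
  have h2 := abs_headInt_sub_le hβ₁ hβ₂ hδ h.le_one hp.1 (h.add_le_one hp) hq.1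
    (h.add_le_one hq) hG' hz
  rw [e] at h1
  calc _ ≤ _ := abs_sub_le _ (headInt δ p G' z) _
    _ ≤ _ := add_le_add h1 h2
    _ = d + m * (64 * 1) * (‖p - q‖ / δ) := by ring
    _ ≤ _ := by
        unfold delta
        gcongr
        have : 0 < 4 / β₁ := by positivity
        linarith

/-- Serves measurability and integrability in z: on the half line the integral agrees with a
function continuous on ℝ. -/
lemma exists_continuous_headInt (hβ₁ : 0 < β₁) (hβ₂ : 1 ≤ β₂) (h : Small η δ) (hp : p ∈ box η δ)
    (hG : WBdd β₁ β₂ m G) : ∃ f : ℝ → ℝ, Continuous f ∧ ∀ z, 0 ≤ z → headInt δ p G z = f z := by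
  have hint : IntegrableOn (fun ξ => ξ * G ξ * ker δ p 0 ξ) (Ioi 0) := by
    refine integrableOn_tailInt hβ₁ hβ₂ h.pos h.le_one hG ?_ le_rfl (ker_zero_bound hβ₁ h hp)
    have := one_le_kerC hβ₁
    positivity
  -- Nothing is known about G on the negative axis; cutting the integrand off there makes its
  -- primitive continuous on ℝ.
  have hint2 := (integrable_indicator_iff measurableSet_Ioi).2 hint
  refine ⟨fun z => Real.exp (-expo δ p z) *
    ∫ ξ in (0 : ℝ)..z, (Ioi 0).indicator (fun ξ => ξ * G ξ * ker δ p 0 ξ) ξ,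
    (Real.continuous_exp.comp (continuous_expo h.pos h.le_one p).neg).mul
      (intervalIntegral.continuous_primitive (fun _ _ => hint2.intervalIntegrable) 0),
    fun z hz => ?_⟩
  simp only [headInt]
  rw [← intervalIntegral.integral_const_mul, intervalIntegral.integral_of_le hz,
    intervalIntegral.integral_of_le hz]
  refine setIntegral_congr_fun measurableSet_Ioc fun ξ hξ => ?_
  have hξ0 : ξ ∈ Ioi (0 : ℝ) := hξ.1
  have : ker δ p z ξ = Real.exp (-expo δ p z) * ker δ p 0 ξ := by
    rw [ker, ker, ← Real.exp_add, expo_zero_right]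
    ring_nf
  simp only [indicator_of_mem hξ0, this]
  ring

lemma exists_continuous_tailInt (hβ₁ : 0 < β₁) (hβ₂ : 1 ≤ β₂) (h : Small η δ) (hp : p ∈ box η δ)
    (hG : WBdd β₁ β₂ m G) : ∃ f : ℝ → ℝ, Continuous f ∧ ∀ z, 0 ≤ z → tailInt δ p G z = f z := by
  obtain ⟨f, hf, hfe⟩ := exists_continuous_headInt hβ₁ hβ₂ h hp hG
  refine ⟨fun z => Real.exp (-expo δ p z) * tailInt δ p G 0 - f z,
    ((Real.continuous_exp.comp (continuous_expo h.pos h.le_one p).neg).mul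
      continuous_const).sub hf, fun z hz => ?_⟩
  rw [tailInt_eq hβ₁ hβ₂ h.pos h.le_one hp.1 hG hz, hfe z hz]

/-- The bound for the tail integrals. -/
def tailIntC (β₁ : ℝ) : ℝ := 25 * kerC β₁ * (2 / β₁)

lemma tailIntC_pos (hβ₁ : 0 < β₁) : 0 < tailIntC β₁ := by
  have := one_le_kerC hβ₁
  unfold tailIntC
  positivity

/-- The power of z lost to the factor ξ in the integrand is regained from 1/den ≤ 25/z, so the
weight is reproduced exactly. -/
lemma abs_tailInt_div_diff_le (hβ₁ : 0 < β₁) (hβ₂ : 1 ≤ β₂) (h : Small η δ) (hp : p ∈ box η δ)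
    (hq : q ∈ box η δ) (hG : WBdd β₁ β₂ m G) (hG' : WBdd β₁ β₂ m G')
    (hd : WBdd β₁ β₂ d (G - G')) {z : ℝ} (hz : 1 ≤ z) :
    |tailInt δ p G z / den δ z - tailInt δ q G' z / den δ z| ≤
      tailIntC β₁ * delta β₁ δ m d p q * wt β₁ β₂ z := by
  have hz0 : 0 < z := by linarith
  have hk := one_le_kerC hβ₁
  have h1 := abs_tailInt_diff_le hβ₁ hβ₂ h hG hG' hd (by linarith) hz0.le (ker_bound hβ₁ h hp hz)
    (ker_bound hβ₁ h hq hz)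
  have hden := le_den_of_one_le h.pos.le hz
  have hd0 := den_pos h.pos h.le_one z
  rw [max_eq_right hz] at h1
  rw [← sub_div, abs_div, abs_of_pos hd0]
  calc _ ≤ (delta β₁ δ m d p q * kerC β₁ * (z * wt β₁ β₂ z) * (2 / β₁)) / (z / 25) :=
        div_le_div₀ ((abs_nonneg _).trans h1) h1 (by positivity) hden
    _ = _ := by
        unfold tailIntC
        field_simp

/-- Taking G' = 0 and q = p turns each difference estimate into a bound for a single term, with
`delta` equal to m. -/
lemma wBdd_zero (hm : 0 ≤ m) : WBdd β₁ β₂ m 0 :=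
  ⟨aestronglyMeasurable_zero, fun z _ => by
    simpa using mul_nonneg hm (wt_pos β₁ β₂ z).le⟩

lemma abs_tailInt_div_le (hβ₁ : 0 < β₁) (hβ₂ : 1 ≤ β₂) (h : Small η δ) (hp : p ∈ box η δ)
    (hG : WBdd β₁ β₂ m G) {z : ℝ} (hz : 1 ≤ z) :
    |tailInt δ p G z / den δ z| ≤ tailIntC β₁ * m * wt β₁ β₂ z := by
  have := abs_tailInt_div_diff_le hβ₁ hβ₂ h hp hp hG (wBdd_zero hG.nonneg) (d := m) (by simpa using hG) hz
  rw [delta_self] at this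
  simpa [tailInt] using this

lemma aestronglyMeasurable_mul_tailInt (hg : IsWeight g) (hβ₁ : 0 < β₁) (hβ₂ : 1 ≤ β₂)
    (h : Small η δ) (hp : p ∈ box η δ) (hG : WBdd β₁ β₂ m G) :
    AEStronglyMeasurable (fun z => g z * (tailInt δ p G z / den δ z))
      (volume.restrict (Ici 0)) := by
  obtain ⟨f, hf, hfe⟩ := exists_continuous_tailInt hβ₁ hβ₂ h hp hG
  have : Continuous fun z => g z * (f z / den δ z) :=
    hg.cont.mul (hf.div (continuous_den δ) fun z => (den_pos h.pos h.le_one z).ne')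
  refine this.aestronglyMeasurable.congr ?_
  filter_upwards [ae_restrict_mem measurableSet_Ici] with z hz
  rw [hfe z hz]

lemma integrableOn_mul_tailInt (hg : IsWeight g) (hβ₁ : 0 < β₁) (hβ₂ : 1 ≤ β₂)
    (h : Small η δ) (hp : p ∈ box η δ) (hG : WBdd β₁ β₂ m G) :
    IntegrableOn (fun z => g z * (tailInt δ p G z / den δ z)) (Ioi 1) := by
  refine Integrable.mono' ((integrableOn_exp_mul_Ioi (neg_lt_zero.2 hβ₁) 1).const_mul
    (tailIntC β₁ * m)) ((aestronglyMeasurable_mul_tailInt hg hβ₁ hβ₂ h hp hG).mono_measure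
      (Measure.restrict_mono (fun z (hz : 1 < z) => (zero_le_one.trans hz.le : (0 : ℝ) ≤ z))
        le_rfl)) ?_
  filter_upwards [ae_restrict_mem measurableSet_Ioi] with z hz
  have hz1 : (1 : ℝ) ≤ z := le_of_lt hz
  have h1 := abs_tailInt_div_le hβ₁ hβ₂ h hp hG hz1
  have h2 := hg.le z (by linarith)
  have h3 := tailIntC_pos hβ₁
  have hm := hG.nonneg
  rw [norm_mul, Real.norm_eq_abs, Real.norm_eq_abs]
  calc _ ≤ max 1 z * (tailIntC β₁ * m * wt β₁ β₂ z) := by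
        gcongr
    _ = tailIntC β₁ * m * (max 1 z * wt β₁ β₂ z) := by ring
    _ ≤ _ := mul_le_mul_of_nonneg_left (max_mul_wt_le hβ₂ z) (by positivity)

lemma intervalIntegrable_mul_headInt (hg : IsWeight g) (hβ₁ : 0 < β₁) (hβ₂ : 1 ≤ β₂)
    (h : Small η δ) (hp : p ∈ box η δ) (hG : WBdd β₁ β₂ m G) :
    IntervalIntegrable (fun z => g z * (headInt δ p G z / den δ z)) volume 0 1 := by
  obtain ⟨f, hf, hfe⟩ := exists_continuous_headInt hβ₁ hβ₂ h hp hG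
  have : Continuous fun z => g z * (f z / den δ z) :=
    hg.cont.mul (hf.div (continuous_den δ) fun z => (den_pos h.pos h.le_one z).ne')
  refine (this.intervalIntegrable 0 1).congr fun z hz => ?_
  rw [uIoc_of_le zero_le_one] at hz
  simp only [hfe z hz.1.le]

/-- The moments of the operator without the factor `ε`. -/
def totMom (g : ℝ → ℝ) (δ : ℝ) (p : ℝ × ℝ) (G : ℝ → ℝ) : ℝ :=
  ∫ z in Ioi (0 : ℝ), g z * (tailInt δ p G z / den δ z)

/-- The remainder in the leading order approximation of `totMom`. -/
def remMom (g : ℝ → ℝ) (δ : ℝ) (p : ℝ × ℝ) (G : ℝ → ℝ) : ℝ :=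
  (∫ z in (0 : ℝ)..1, g z * (headInt δ p G z / den δ z)) -
    ∫ z in Ioi (1 : ℝ), g z * (tailInt δ p G z / den δ z)

lemma tailInt_div_eq (hβ₁ : 0 < β₁) (hβ₂ : 1 ≤ β₂) (h : Small η δ) (hp : p ∈ box η δ)
    (hG : WBdd β₁ β₂ m G) {z : ℝ} (hz : 0 ≤ z) :
    tailInt δ p G z / den δ z = homSol δ p z * tailInt δ p G 0 - headInt δ p G z / den δ z := by
  rw [tailInt_eq hβ₁ hβ₂ h.pos h.le_one hp.1 hG hz, homSol]
  ring

/-- On (0, 1] the splitting of the tail integral isolates the product of a profile moment with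
`tailInt δ p G 0`. Only this product is exponentially large; what remains is O(1/δ). -/
lemma totMom_eq (hg : IsWeight g) (hβ₁ : 0 < β₁) (hβ₂ : 1 ≤ β₂)
    (h : Small η δ) (hp : p ∈ box η δ) (hG : WBdd β₁ β₂ m G) :
    totMom g δ p G = profMom g δ p * tailInt δ p G 0 - remMom g δ p G := by
  have i1 := intervalIntegrable_mul_headInt hg hβ₁ hβ₂ h hp hG
  have i2 : IntervalIntegrable (fun z => g z * homSol δ p z * tailInt δ p G 0) volume 0 1 :=
    ((hg.cont.mul (continuous_homSol h.pos h.le_one p)).mul continuous_const).intervalIntegrable _ _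
  have e : EqOn (fun z => g z * homSol δ p z * tailInt δ p G 0 -
      g z * (headInt δ p G z / den δ z)) (fun z => g z * (tailInt δ p G z / den δ z))
      (Ioc 0 1) := by
    intro z hz
    simp only [tailInt_div_eq hβ₁ hβ₂ h hp hG hz.1.le]
    ring
  have i3 : IntegrableOn (fun z => g z * (tailInt δ p G z / den δ z)) (Ioc 0 1) := by
    have := (i2.sub i1)
    rw [intervalIntegrable_iff, uIoc_of_le zero_le_one] at this
    exact this.congr_fun e measurableSet_Ioc
  rw [totMom, ← Ioc_union_Ioi_eq_Ioi (zero_le_one (α := ℝ)), setIntegral_union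
    Ioc_disjoint_Ioi_same measurableSet_Ioi i3 (integrableOn_mul_tailInt hg hβ₁ hβ₂ h hp hG),
    ← setIntegral_congr_fun measurableSet_Ioc e, ← intervalIntegral.integral_of_le zero_le_one,
    intervalIntegral.integral_sub i2 i1, intervalIntegral.integral_mul_const, remMom, profMom]
  ring

/-- The bound for the remainders. -/
def remC (β₁ : ℝ) : ℝ := 32 + tailIntC β₁ / β₁

lemma remC_pos (hβ₁ : 0 < β₁) : 0 < remC β₁ := by
  have := tailIntC_pos hβ₁
  unfold remC
  positivity

lemma delta_nonneg (hβ₁ : 0 < β₁) (hδ : 0 < δ) (hm : 0 ≤ m) (hd : 0 ≤ d) :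
    0 ≤ delta β₁ δ m d p q := by
  unfold delta
  positivity

lemma abs_headInt_div_diff_le (hβ₁ : 0 < β₁) (hβ₂ : 0 ≤ β₂) (h : Small η δ) (hp : p ∈ box η δ)
    (hq : q ∈ box η δ) (hG : WBdd β₁ β₂ m G) (hG' : WBdd β₁ β₂ m G')
    (hd : WBdd β₁ β₂ d (G - G')) {z : ℝ} (hz : z ∈ Icc (0 : ℝ) 1) :
    |headInt δ p G z / den δ z - headInt δ q G' z / den δ z| ≤
      32 * (delta β₁ δ m d p q / δ) := by
  have h1 := abs_headInt_diff_le hβ₁ hβ₂ h hp hq hG hG' hd hz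
  have h2 := one_div_den_le h.pos h.le_one hz
  have hd0 := den_pos h.pos h.le_one z
  rw [← sub_div, abs_div, abs_of_pos hd0, div_eq_mul_one_div]
  calc _ ≤ delta β₁ δ m d p q * (32 / δ) := mul_le_mul h1 h2 (by positivity)
        ((abs_nonneg _).trans h1)
    _ = _ := by ring

lemma abs_remMom_diff_le (hg : IsWeight g) (hβ₁ : 0 < β₁) (hβ₂ : 1 ≤ β₂) (h : Small η δ)
    (hp : p ∈ box η δ) (hq : q ∈ box η δ) (hG : WBdd β₁ β₂ m G) (hG' : WBdd β₁ β₂ m G')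
    (hd : WBdd β₁ β₂ d (G - G')) :
    |remMom g δ p G - remMom g δ q G'| ≤ remC β₁ * (delta β₁ δ m d p q / δ) := by
  have hδ := h.pos
  have hΔ := delta_nonneg (p := p) (q := q) hβ₁ h.pos hG.nonneg hd.nonneg
  have hC := tailIntC_pos hβ₁
  set Δ := delta β₁ δ m d p q
  have e1 : |(∫ z in (0 : ℝ)..1, g z * (headInt δ p G z / den δ z)) -
      ∫ z in (0 : ℝ)..1, g z * (headInt δ q G' z / den δ z)| ≤ 32 * (Δ / δ) := by
    rw [← intervalIntegral.integral_sub (intervalIntegrable_mul_headInt hg hβ₁ hβ₂ h hp hG)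
      (intervalIntegrable_mul_headInt hg hβ₁ hβ₂ h hq hG')]
    refine abs_integral_zero_one_le fun z hz => ?_
    rw [← mul_sub, abs_mul]
    calc _ ≤ 1 * (32 * (Δ / δ)) := mul_le_mul (hg.le_one hz)
          (abs_headInt_div_diff_le hβ₁ (by linarith) h hp hq hG hG' hd hz) (abs_nonneg _)
          zero_le_one
      _ = _ := one_mul _
  have e2 : |(∫ z in Ioi (1 : ℝ), g z * (tailInt δ p G z / den δ z)) -
      ∫ z in Ioi (1 : ℝ), g z * (tailInt δ q G' z / den δ z)| ≤ tailIntC β₁ / β₁ * Δ := by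
    rw [← integral_sub (integrableOn_mul_tailInt hg hβ₁ hβ₂ h hp hG)
      (integrableOn_mul_tailInt hg hβ₁ hβ₂ h hq hG'), ← Real.norm_eq_abs]
    refine (norm_integral_le_of_norm_le ((integrableOn_exp_mul_Ioi (neg_lt_zero.2 hβ₁) 1).const_mul
      (tailIntC β₁ * Δ)) ?_).trans ?_
    · filter_upwards [ae_restrict_mem measurableSet_Ioi] with z hz
      have hz1 : (1 : ℝ) ≤ z := le_of_lt hz
      have h1 := abs_tailInt_div_diff_le hβ₁ hβ₂ h hp hq hG hG' hd hz1
      have h2 := hg.le z (by linarith)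
      rw [← mul_sub, norm_mul, Real.norm_eq_abs, Real.norm_eq_abs]
      calc _ ≤ max 1 z * (tailIntC β₁ * Δ * wt β₁ β₂ z) :=
            mul_le_mul h2 h1 (abs_nonneg _) (zero_le_one.trans (le_max_left _ _))
        _ = tailIntC β₁ * Δ * (max 1 z * wt β₁ β₂ z) := by ring
        _ ≤ _ := mul_le_mul_of_nonneg_left (max_mul_wt_le hβ₂ z) (by positivity)
    · rw [integral_const_mul, integral_exp_mul_Ioi (neg_lt_zero.2 hβ₁), neg_div_neg_eq]
      have : Real.exp (-β₁ * 1) ≤ 1 := Real.exp_le_one_iff.2 (by linarith)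
      calc _ ≤ tailIntC β₁ * Δ * (1 / β₁) := by gcongr
        _ = _ := by ring
  have e3 : Δ ≤ Δ / δ := by
    rw [le_div_iff₀ hδ]
    exact mul_le_of_le_one_right hΔ h.le_one
  calc |remMom g δ p G - remMom g δ q G'| ≤ 32 * (Δ / δ) + tailIntC β₁ / β₁ * Δ := by
        unfold remMom
        rw [sub_sub_sub_comm]
        exact (abs_sub _ _).trans (add_le_add e1 e2)
    _ ≤ 32 * (Δ / δ) + tailIntC β₁ / β₁ * (Δ / δ) := by gcongr
    _ = _ := by unfold remC; ring

lemma abs_remMom_le (hg : IsWeight g) (hβ₁ : 0 < β₁) (hβ₂ : 1 ≤ β₂) (h : Small η δ)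
    (hp : p ∈ box η δ) (hG : WBdd β₁ β₂ m G) :
    |remMom g δ p G| ≤ remC β₁ * (m / δ) := by
  have := abs_remMom_diff_le hg hβ₁ hβ₂ h hp hp hG (wBdd_zero hG.nonneg) (d := m)
    (by simpa using hG)
  rw [delta_self] at this
  simpa [remMom, tailInt, headInt] using this

/-- The bound for the leading coefficient `tailInt δ p G 0`. -/
def leadC (β₁ : ℝ) : ℝ := kerC β₁ * (2 / β₁)

lemma leadC_pos (hβ₁ : 0 < β₁) : 0 < leadC β₁ := by
  have := one_le_kerC hβ₁
  unfold leadC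
  positivity

lemma abs_lead_diff_le (hβ₁ : 0 < β₁) (hβ₂ : 1 ≤ β₂) (h : Small η δ)
    (hp : p ∈ box η δ) (hq : q ∈ box η δ) (hG : WBdd β₁ β₂ m G) (hG' : WBdd β₁ β₂ m G')
    (hd : WBdd β₁ β₂ d (G - G')) :
    |tailInt δ p G 0 - tailInt δ q G' 0| ≤
      leadC β₁ * Real.exp (expo δ 0 1) * delta β₁ δ m d p q := by
  have hk := one_le_kerC hβ₁
  refine (abs_tailInt_diff_le hβ₁ hβ₂ h hG hG' hd (by positivity) le_rfl
    (ker_zero_bound hβ₁ h hp) (ker_zero_bound hβ₁ h hq)).trans_eq ?_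
  simp only [wt, leadC]
  norm_num
  ring

lemma abs_lead_le (hβ₁ : 0 < β₁) (hβ₂ : 1 ≤ β₂) (h : Small η δ)
    (hp : p ∈ box η δ) (hG : WBdd β₁ β₂ m G) :
    |tailInt δ p G 0| ≤ leadC β₁ * Real.exp (expo δ 0 1) * m := by
  have := abs_lead_diff_le hβ₁ hβ₂ h hp hp hG (wBdd_zero hG.nonneg) (d := m) (by simpa using hG)
  rw [delta_self] at this
  simpa [tailInt] using this

end

end LSW

/-! ### Lower bound for the leading coefficient on the ball. -/

namespace LSW

noncomputable section

variable {δ η : ℝ} {p q : ℝ × ℝ} {β₁ β₂ m d r : ℝ} {G G' g f Φ : ℝ → ℝ}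

lemma WBdd.mono (hf : WBdd β₁ β₂ m f) (h : m ≤ d) : WBdd β₁ β₂ d f :=
  ⟨hf.meas, fun z hz => (hf.bound z hz).trans
    (mul_le_mul_of_nonneg_right h (wt_pos _ _ _).le)⟩

/-- The weighted bound for `phiHat`. -/
def hatC (β₁ : ℝ) : ℝ := 1500000000 / normLower * Real.exp β₁

lemma hatC_pos (β₁ : ℝ) : 0 < hatC β₁ := by
  have := normLower_pos
  unfold hatC
  positivity

lemma phiHat_nonneg (h : Small η δ) {z : ℝ} (hz : 0 ≤ z) : 0 ≤ phiHat δ z := by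
  rcases le_or_gt z 1 with h1 | h1
  · rw [phiHat_of_mem h.pos h.le_one ⟨hz, h1⟩]
    exact div_nonneg (homSol_pos h.pos h.le_one 0 z).le
      (normLower_pos.le.trans (normLower_le h.pos h.le le_rfl))
  · rw [phiHat_of_one_lt h1]

lemma aemeasurable_phiHat (h : Small η δ) : AEMeasurable (phiHat δ) := by
  have e : phiHat δ = indicator (Icc 0 1) fun z => homSol δ 0 z / normC δ 0 := by
    ext z
    by_cases hz : z ∈ Icc (0 : ℝ) 1
    · rw [indicator_of_mem hz, phiHat_of_mem h.pos h.le_one hz]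
    · rw [indicator_of_notMem hz, phiHat, indicator_of_notMem hz]
  rw [e]
  exact (((continuous_homSol h.pos h.le_one 0).div_const _).measurable.indicator
    measurableSet_Icc).aemeasurable

lemma wBdd_phiHat (hβ₁ : 0 < β₁) (h : Small η δ) : WBdd β₁ β₂ (hatC β₁) (phiHat δ) := by
  refine ⟨(aemeasurable_phiHat h).aestronglyMeasurable.restrict, fun z hz => ?_⟩
  have hN := normLower_pos
  have hw := wt_pos β₁ β₂ z
  rcases le_or_gt z 1 with h1 | h1
  · rw [abs_of_nonneg (phiHat_nonneg h hz), phiHat_of_mem h.pos h.le_one ⟨hz, h1⟩]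
    have e1 := homSol_zero_le_const h.pos h.le ⟨hz, h1⟩
    have e2 := normLower_le h.pos h.le (le_refl (0 : ℝ × ℝ))
    have e3 := exp_le_wt (β₂ := β₂) hβ₁.le h1
    calc _ ≤ 1500000000 / normLower := by gcongr
      _ = hatC β₁ * Real.exp (-β₁) := by
          unfold hatC
          rw [Real.exp_neg]
          field_simp
      _ ≤ _ := mul_le_mul_of_nonneg_left e3 (hatC_pos β₁).le
  · rw [phiHat_of_one_lt h1, abs_zero]
    exact mul_nonneg (hatC_pos β₁).le hw.le

lemma phiHat_ge (h : Small η δ) {z : ℝ} (hz : z ∈ Icc (0 : ℝ) (2 / 5)) :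
    Real.exp (-1280) / 15 / 1500000000 ≤ phiHat δ z := by
  rw [phiHat_of_mem h.pos h.le_one ⟨hz.1, by linarith [hz.2]⟩]
  have e1 := le_homSol_zero h.pos.le h.le hz
  have e2 := normLower_pos.trans_le (normLower_le h.pos h.le (le_refl (0 : ℝ × ℝ)))
  have e3 := normC_zero_le h.pos h.le
  exact div_le_div₀ (homSol_pos h.pos h.le_one 0 z).le e1 e2 e3

lemma conv_phiHat_nonneg (h : Small η δ) {z : ℝ} (hz : 0 ≤ z) :
    0 ≤ conv (phiHat δ) (phiHat δ) z :=
  mul_nonneg (by norm_num) (intervalIntegral.integral_nonneg hz fun y hy =>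
    mul_nonneg (phiHat_nonneg h (by linarith [hy.2])) (phiHat_nonneg h hy.1))

/-- For y in [z - 2/5, 2/5], an interval of length at least 1/10, both y and z - y lie in [0, 2/5],
where the profile is bounded below. -/
lemma conv_phiHat_ge (h : Small η δ) {z : ℝ} (hz : z ∈ Icc (3 / 5 : ℝ) (7 / 10)) :
    (Real.exp (-1280) / 15 / 1500000000) ^ 2 / 20 ≤ conv (phiHat δ) (phiHat δ) z := by
  -- Any weight will do, as only integrability on a bounded interval is wanted.
  have hi := intervalIntegrable_conv (β₁ := 1) (β₂ := 1) one_pos zero_le_one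
    (wBdd_phiHat one_pos h) (wBdd_phiHat one_pos h) (by linarith [hz.1] : 0 ≤ z)
  set c := Real.exp (-1280) / 15 / 1500000000
  have hc : 0 < c := by positivity
  have h1 : c ^ 2 / 10 ≤ ∫ y in (0 : ℝ)..z, phiHat δ (z - y) * phiHat δ y := by
    calc c ^ 2 / 10 ≤ (2 / 5 - (z - 2 / 5)) * c ^ 2 := by nlinarith [hz.2, sq_nonneg c]
      _ = ∫ _ in (z - 2 / 5)..(2 / 5), c ^ 2 := by
          rw [intervalIntegral.integral_const, smul_eq_mul]
      _ ≤ ∫ y in (z - 2 / 5)..(2 / 5), phiHat δ (z - y) * phiHat δ y := by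
          refine intervalIntegral.integral_mono_on (by linarith [hz.2]) intervalIntegrable_const
            (hi.mono_set ?_) fun y hy => ?_
          · rw [uIcc_of_le (by linarith [hz.2]), uIcc_of_le (by linarith [hz.1])]
            exact Icc_subset_Icc (by linarith [hz.1]) (by linarith [hz.1])
          · rw [sq]
            have e1 := phiHat_ge h (z := z - y) ⟨by linarith [hy.2, hz.1], by linarith [hy.1]⟩
            have e2 := phiHat_ge h (z := y) ⟨by linarith [hy.1, hz.1], hy.2⟩
            exact mul_le_mul e1 e2 hc.le (hc.le.trans e1)
      _ ≤ _ := by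
          refine intervalIntegral.integral_mono_interval (by linarith [hz.1])
            (by linarith [hz.2]) (by linarith [hz.1]) ?_ hi
          filter_upwards [ae_restrict_mem measurableSet_Ioc] with y hy
          exact mul_nonneg (phiHat_nonneg h (by linarith [hy.2])) (phiHat_nonneg h hy.1.le)
  rw [conv]
  linarith

/-- On [3/5, 1] the denominator is at least 1/3200, so all but a bounded part of E(1) is accumulated
before ξ; the parameters cost another 64πη. -/
lemma le_expo_of_mem (h : Small η δ) (hp : p ∈ box η δ) {ξ : ℝ} (hξ : ξ ∈ Icc (3 / 5 : ℝ) 1) :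
    expo δ 0 1 - (1280 + 64 * Real.pi * η) ≤ expo δ p ξ := by
  have h1 := expo_zero_sub_expo_le h.pos h.le_one h.eta_nonneg hp
    (z := ξ) ⟨by linarith [hξ.1], hξ.2⟩
  have h2 : expo δ 0 1 - expo δ 0 ξ ≤ 1280 := by
    rw [expo_sub h.pos h.le_one]
    calc _ ≤ ∫ _ in ξ..1, (3200 : ℝ) := by
          refine intervalIntegral.integral_mono_on hξ.2
            ((continuous_rate h.pos h.le_one 0).intervalIntegrable _ _)
            intervalIntegrable_const fun y hy => ?_
          have e1 := le_den h.pos.le h.le_one (z := y) ⟨by linarith [hξ.1, hy.1], hy.2⟩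
          have e2 : (1 / 10 : ℝ) ^ 2 ≤ (y - 1 / 2) ^ 2 := by
            gcongr
            linarith [hξ.1, hy.1]
          have e3 := h.pos
          simp only [Prod.fst_zero, Prod.snd_zero, sub_zero, zero_mul]
          rw [div_le_iff₀ (den_pos h.pos h.le_one y)]
          linarith
      _ ≤ 1280 := by
          rw [intervalIntegral.integral_const, smul_eq_mul]
          linarith [hξ.1]
  linarith

/-- The lower bound for the leading coefficient of `conv phiHat phiHat`. -/
def lowC (η : ℝ) : ℝ :=
  3 / 50 * ((Real.exp (-1280) / 15 / 1500000000) ^ 2 / 20) *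
    Real.exp (-(1280 + 64 * Real.pi * η))

lemma lowC_pos (η : ℝ) : 0 < lowC η := by unfold lowC; positivity

/-- The integrand is nonnegative, and [3/5, 7/10] already gives a multiple of exp E(1): there the
convolution square has a fixed positive lower bound and the kernel has passed the near-singularity
at 1/2. The factor 3/50 is 3/5 times the length 1/10. -/
lemma lowC_le_lead (hβ₁ : 0 < β₁) (hβ₂ : 1 < β₂) (h : Small η δ) (hp : p ∈ box η δ) :
    lowC η * Real.exp (expo δ 0 1) ≤ tailInt δ p (conv (phiHat δ) (phiHat δ)) 0 := by
  have hG := (wBdd_phiHat (β₂ := β₂) hβ₁ h).conv hβ₁ hβ₂ (wBdd_phiHat hβ₁ h)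
  have hk := one_le_kerC hβ₁
  have hint := integrableOn_tailInt hβ₁ hβ₂.le h.pos h.le_one hG
    (B := kerC β₁ * Real.exp (expo δ 0 1)) (by positivity) le_rfl (ker_zero_bound hβ₁ h hp)
  set c := (Real.exp (-1280) / 15 / 1500000000) ^ 2 / 20 with hc
  have hc0 : 0 < c := by positivity
  have hsub : Ioc (3 / 5 : ℝ) (7 / 10) ⊆ Ioi 0 := fun y hy => by
    have := hy.1
    simp only [mem_Ioi]
    linarith
  calc lowC η * Real.exp (expo δ 0 1)
      = ∫ _ in (3 / 5 : ℝ)..(7 / 10),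
          3 / 5 * c * Real.exp (expo δ 0 1 - (1280 + 64 * Real.pi * η)) := by
        rw [intervalIntegral.integral_const, smul_eq_mul, lowC, ← hc,
          sub_eq_add_neg (expo δ 0 1), Real.exp_add]
        ring
    _ ≤ ∫ ξ in (3 / 5 : ℝ)..(7 / 10), ξ * conv (phiHat δ) (phiHat δ) ξ * ker δ p 0 ξ := by
        refine intervalIntegral.integral_mono_on (by norm_num) intervalIntegrable_const ?_
          fun ξ hξ => ?_
        · rw [intervalIntegrable_iff, uIoc_of_le (by norm_num)]
          exact hint.mono_set hsub
        · have e1 := conv_phiHat_ge h hξ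
          have e2 := le_expo_of_mem h hp (ξ := ξ) ⟨hξ.1, by linarith [hξ.2]⟩
          rw [ker, expo_zero_right, sub_zero]
          have e3 : 3 / 5 * c ≤ ξ * conv (phiHat δ) (phiHat δ) ξ :=
            mul_le_mul hξ.1 e1 hc0.le (by linarith [hξ.1])
          exact mul_le_mul e3 (Real.exp_le_exp.2 e2) (Real.exp_pos _).le
            ((by positivity : (0 : ℝ) ≤ 3 / 5 * c).trans e3)
    _ ≤ tailInt δ p (conv (phiHat δ) (phiHat δ)) 0 := by
        rw [intervalIntegral.integral_of_le (by norm_num), tailInt]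
        refine setIntegral_mono_set hint ?_ (Eventually.of_forall hsub)
        filter_upwards [ae_restrict_mem measurableSet_Ioi] with ξ hξ
        have hξ0 : (0 : ℝ) ≤ ξ := le_of_lt hξ
        exact mul_nonneg (mul_nonneg hξ0 (conv_phiHat_nonneg h hξ0)) (ker_pos _ _ _ _).le

/-- The weighted bound for the elements of the ball. -/
def ballC (β₁ : ℝ) : ℝ := hatC β₁ + Real.exp β₁

lemma ballC_pos (β₁ : ℝ) : 0 < ballC β₁ := add_pos (hatC_pos β₁) (Real.exp_pos _)

lemma wBdd_sub_phiHat (hβ₁ : 0 < β₁) (h : Small η δ) (hr : 0 ≤ r)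
    (hΦ : Φ ∈ zBall β₁ β₂ (phiHat δ) r) : WBdd β₁ β₂ (Real.exp β₁ * r) (Φ - phiHat δ) := by
  refine ⟨AEStronglyMeasurable.sub ?_ (aemeasurable_phiHat h).aestronglyMeasurable.restrict,
    fun z hz => abs_le_of_zNorm_le hβ₁.le hr hΦ.2 hz⟩
  rw [restrict_Ioi_eq_restrict_Ici]
  exact hΦ.1.1.aestronglyMeasurable

lemma wBdd_of_mem (hβ₁ : 0 < β₁) (h : Small η δ) (hr : 0 ≤ r) (hr1 : r ≤ 1)
    (hΦ : Φ ∈ zBall β₁ β₂ (phiHat δ) r) : WBdd β₁ β₂ (ballC β₁) Φ := by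
  have := (wBdd_phiHat (β₂ := β₂) hβ₁ h).add (wBdd_sub_phiHat hβ₁ h hr hΦ)
  rw [add_sub_cancel] at this
  refine this.mono ?_
  unfold ballC
  have := Real.exp_pos β₁
  nlinarith

/-- The weighted bound for the convolution squares of elements of the ball. -/
def sqC (β₁ β₂ : ℝ) : ℝ := convC β₂ * ballC β₁ * ballC β₁

/-- The coefficient depends on the convolution square with Lipschitz constant O(exp E(1)), the order
of the lower bound itself, so a radius small independently of δ loses only half. -/
lemma lead_ge (hβ₁ : 0 < β₁) (hβ₂ : 1 < β₂) (h : Small η δ) (hr : 0 ≤ r) (hr1 : r ≤ 1)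
    (hr2 : leadC β₁ * (2 * convC β₂ * ballC β₁ * (Real.exp β₁ * r)) ≤ lowC η / 2)
    (hΦ : Φ ∈ zBall β₁ β₂ (phiHat δ) r) (hp : p ∈ box η δ) :
    lowC η / 2 * Real.exp (expo δ 0 1) ≤ tailInt δ p (conv Φ Φ) 0 := by
  have hΦm := wBdd_of_mem hβ₁ h hr hr1 hΦ
  have hHm : WBdd β₁ β₂ (ballC β₁) (phiHat δ) :=
    (wBdd_phiHat hβ₁ h).mono (le_add_of_nonneg_right (Real.exp_pos _).le)
  have hd := hΦm.conv_self_sub hβ₁ hβ₂ hHm (wBdd_sub_phiHat hβ₁ h hr hΦ)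
  have h1 := abs_lead_diff_le hβ₁ hβ₂.le h hp hp (hΦm.conv hβ₁ hβ₂ hΦm) (hHm.conv hβ₁ hβ₂ hHm) hd
  rw [delta_self] at h1
  have h2 := lowC_le_lead hβ₁ hβ₂ h hp
  have h3 := (abs_le.1 h1).1
  have h4 := Real.exp_pos (expo δ 0 1)
  nlinarith

end

end LSW

/-! ### The compatibility conditions as a fixed point problem. -/

namespace LSW

noncomputable section

variable {δ η : ℝ} {p q : ℝ × ℝ} {β₁ β₂ m d r s : ℝ} {G G' g f Φ Ψ : ℝ → ℝ}

lemma abs_mul_sub_mul_le (x y x' y' : ℝ) :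
    |x * y - x' * y'| ≤ |x - x'| * |y| + |x'| * |y - y'| := by
  have : x * y - x' * y' = (x - x') * y + x' * (y - y') := by ring
  rw [this]
  refine (abs_add_le _ _).trans ?_
  rw [abs_mul, abs_mul]

lemma abs_inv_sub_inv_le {a a' l D : ℝ} (hl : 0 < l) (ha : l ≤ a) (ha' : l ≤ a')
    (h : |a - a'| ≤ D) : |1 / a - 1 / a'| ≤ D / l ^ 2 := by
  have h1 : 0 < a := by linarith
  have h2 : 0 < a' := by linarith
  have e : 1 / a - 1 / a' = -((a - a') / (a * a')) := by
    field_simp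
    ring
  rw [e, abs_neg, abs_div, abs_of_pos (mul_pos h1 h2), sq]
  have := (abs_nonneg _).trans h
  gcongr

lemma abs_div_sq_sub_le {a a' b b' l D U : ℝ} (hl : 0 < l) (ha : l ≤ a) (ha' : l ≤ a')
    (h : |a - a'| ≤ D) (hb : |b - b'| ≤ D) (hU : |b'| ≤ U) :
    |b / a ^ 2 - b' / a' ^ 2| ≤ D / l ^ 2 * (1 + 2 * U / l) := by
  have h1 : 0 < a := by linarith
  have h2 : 0 < a' := by linarith
  have hD := (abs_nonneg _).trans h
  have e : b / a ^ 2 - b' / a' ^ 2 =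
      (b - b') / a ^ 2 + b' * ((1 / a - 1 / a') * (1 / a + 1 / a')) := by
    field_simp
    ring
  have h3 := abs_inv_sub_inv_le hl ha ha' h
  have h4 : |1 / a + 1 / a'| ≤ 2 / l := by
    rw [abs_of_pos (by positivity)]
    have t1 : 1 / a ≤ 1 / l := one_div_le_one_div_of_le hl ha
    have t2 : 1 / a' ≤ 1 / l := one_div_le_one_div_of_le hl ha'
    have t3 : 2 / l = 1 / l + 1 / l := by ring
    linarith
  rw [e]
  calc _ ≤ |b - b'| / a ^ 2 + |b'| * (|1 / a - 1 / a'| * |1 / a + 1 / a'|) := by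
        refine (abs_add_le _ _).trans_eq ?_
        rw [abs_div, abs_of_pos (by positivity : 0 < a ^ 2), abs_mul, abs_mul]
    _ ≤ D / l ^ 2 + U * (D / l ^ 2 * (2 / l)) := by
        have := (abs_nonneg _).trans hU
        gcongr
    _ = _ := by ring

/-- A map of a box into itself that halves distances has exactly one fixed point there. -/
lemma existsUnique_fixedPoint {S : Set (ℝ × ℝ)} (hS : IsClosed S) (hne : S.Nonempty)
    {T : ℝ × ℝ → ℝ × ℝ} (hT : MapsTo T S S)
    (hL : ∀ p ∈ S, ∀ q ∈ S, ‖T p - T q‖ ≤ 1 / 2 * ‖p - q‖) :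
    ∃! p, p ∈ S ∧ T p = p := by
  obtain ⟨x, hx⟩ := hne
  have hc : ContractingWith (1 / 2) (hT.restrict T S S) := by
    refine ⟨by rw [← NNReal.coe_lt_coe]; norm_num, LipschitzWith.of_dist_le_mul fun a b => ?_⟩
    have := hL a a.2 b b.2
    simpa [Subtype.dist_eq, dist_eq_norm] using this
  obtain ⟨y, hy, hfix, -⟩ := hc.exists_fixedPoint' hS.isComplete hT hx (edist_ne_top _ _)
  refine ⟨y, ⟨hy, hfix⟩, fun z hz => ?_⟩
  have h1 := hL z hz.1 y hy
  rw [hz.2, hfix.eq] at h1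
  have h2 : ‖z - y‖ ≤ 0 := by linarith
  exact sub_eq_zero.1 (norm_le_zero_iff.1 h2)

/-- The bound for the moments. -/
def momC (β₁ η : ℝ) : ℝ := 2 * profC η * leadC β₁ + remC β₁

/-- The lower bound for the moments. -/
def momLow (η : ℝ) : ℝ := normLower * lowC η / 4

/-- The constant in the stability of the parameters. -/
def stabC (β₁ β₂ η : ℝ) : ℝ :=
  momC β₁ η / momLow η ^ 2 * (1 + 2 * (momC β₁ η * sqC β₁ β₂) / momLow η)

/-- The bound for the parameters. -/
def parC (β₁ β₂ η : ℝ) : ℝ := 1 / momLow η + momC β₁ η * sqC β₁ β₂ / momLow η ^ 2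

/-- The constant in the Lipschitz estimate for the normalized profiles. -/
def psiC (η : ℝ) : ℝ := 64 * profC η * (1 / normLower + profC η / normLower ^ 2)

lemma momC_pos (hβ₁ : 0 < β₁) (η : ℝ) : 0 < momC β₁ η := by
  have := profC_pos η
  have := leadC_pos hβ₁
  have := remC_pos hβ₁
  unfold momC
  positivity

lemma momLow_pos (η : ℝ) : 0 < momLow η := by
  have := normLower_pos
  have := lowC_pos η
  unfold momLow
  positivity

lemma sqC_nonneg (β₁ β₂ : ℝ) : 0 ≤ sqC β₁ β₂ := by
  have := convC_nonneg β₂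
  have := ballC_pos β₁
  unfold sqC
  positivity

lemma stabC_pos (hβ₁ : 0 < β₁) (β₂ η : ℝ) : 0 < stabC β₁ β₂ η := by
  have := momC_pos hβ₁ η
  have := momLow_pos η
  have := sqC_nonneg β₁ β₂
  unfold stabC
  positivity

lemma parC_pos (hβ₁ : 0 < β₁) (β₂ η : ℝ) : 0 < parC β₁ β₂ η := by
  have := momC_pos hβ₁ η
  have := momLow_pos η
  have := sqC_nonneg β₁ β₂
  unfold parC
  positivity

lemma psiC_pos (η : ℝ) : 0 < psiC η := by
  have := profC_pos η
  have := normLower_pos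
  unfold psiC
  positivity

/-- The small quantity `exp (-∫_0^1 1 / den δ) / δ`. -/
def tiny (δ : ℝ) : ℝ := 1 / (δ * Real.exp (expo δ 0 1))

/-- The smallness conditions on `δ` and on the radius `r` of the ball. -/
structure Admissible (β₁ β₂ η δ r : ℝ) : Prop extends Small η δ where
  r_nonneg : 0 ≤ r
  r_le : r ≤ 1
  lead_le : leadC β₁ * (2 * convC β₂ * ballC β₁ * (Real.exp β₁ * r)) ≤ lowC η / 2
  rem_le : remC β₁ * sqC β₁ β₂ * tiny δ ≤ momLow η
  tiny_le : tiny δ ≤ 1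
  par_le : parC β₁ β₂ η / Real.exp (expo δ 0 1) ≤ η * √δ
  stab_le : stabC β₁ β₂ η * (sqC β₁ β₂ * (64 * (1 + 4 / β₁))) * tiny δ ≤ 1 / 2

lemma normLower_le_profMom_id (h : Small η δ) (hp : p ∈ box η δ) :
    normLower ≤ profMom (fun z => z) δ p := normLower_le h.pos h.le hp.1

lemma normLower_le_profMom_one (h : Small η δ) (hp : p ∈ box η δ) :
    normLower ≤ profMom (fun _ => 1) δ p := by
  refine (normLower_le_profMom_id h hp).trans ?_
  refine intervalIntegral.integral_mono_on zero_le_one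
    (intervalIntegrable_mul_profile isWeight_id h p)
    (intervalIntegrable_mul_profile isWeight_one h p) fun z hz => ?_
  exact mul_le_mul_of_nonneg_right hz.2 (homSol_pos h.pos h.le_one p z).le

lemma tiny_eq (δ : ℝ) : tiny δ = 1 / δ / Real.exp (expo δ 0 1) := by
  unfold tiny
  field_simp

lemma wBdd_conv_of_mem (hβ₁ : 0 < β₁) (hβ₂ : 1 < β₂) (h : Admissible β₁ β₂ η δ r)
    (hΦ : Φ ∈ zBall β₁ β₂ (phiHat δ) r) : WBdd β₁ β₂ (sqC β₁ β₂) (conv Φ Φ) :=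
  have h1 := wBdd_of_mem hβ₁ h.toSmall h.r_nonneg h.r_le hΦ
  h1.conv hβ₁ hβ₂ h1

/-- The main product is at least 2 · `momLow η` · exp E(1), and `rem_le` lets the remainder use up
at most half of it. -/
lemma totMom_ge (hβ₁ : 0 < β₁) (hβ₂ : 1 < β₂) (h : Admissible β₁ β₂ η δ r)
    (hΦ : Φ ∈ zBall β₁ β₂ (phiHat δ) r) (hp : p ∈ box η δ) (hg : IsWeight g)
    (hN : normLower ≤ profMom g δ p) :
    momLow η * Real.exp (expo δ 0 1) ≤ totMom g δ p (conv Φ Φ) := by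
  have hG := wBdd_conv_of_mem hβ₁ hβ₂ h hΦ
  have h1 := lead_ge hβ₁ hβ₂ h.toSmall h.r_nonneg h.r_le h.lead_le hΦ hp
  have h2 := (abs_le.1 (abs_remMom_le hg hβ₁ hβ₂.le h.toSmall hp hG)).2
  have hK := Real.exp_pos (expo δ 0 1)
  have hδ := h.pos
  have h3 := h.rem_le
  rw [tiny_eq, ← mul_div_assoc, div_le_iff₀ hK] at h3
  have h4 : normLower * (lowC η / 2 * Real.exp (expo δ 0 1)) ≤
      profMom g δ p * tailInt δ p (conv Φ Φ) 0 :=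
    mul_le_mul hN h1 (mul_nonneg (by linarith [lowC_pos η]) hK.le) (normLower_pos.le.trans hN)
  have h5 : remC β₁ * (sqC β₁ β₂ / δ) = remC β₁ * sqC β₁ β₂ * (1 / δ) := by ring
  rw [totMom_eq hg hβ₁ hβ₂.le h.toSmall hp hG]
  unfold momLow at h3 ⊢
  linarith

lemma norm_le_delta (hβ₁ : 0 < β₁) (hδ : 0 < δ) (hm : 0 ≤ m) (hd : 0 ≤ d) :
    m * (64 / δ * ‖p - q‖) ≤ delta β₁ δ m d p q := by
  unfold delta
  calc m * (64 / δ * ‖p - q‖) = 0 + m * (64 * (1 + 0)) * (‖p - q‖ / δ) := by ring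
    _ ≤ _ := by
        have : 0 ≤ 4 / β₁ := by positivity
        gcongr

lemma div_le_exp_mul (h : tiny δ ≤ 1) {x : ℝ} (hx : 0 ≤ x) :
    x / δ ≤ Real.exp (expo δ 0 1) * x := by
  have hK := Real.exp_pos (expo δ 0 1)
  rw [tiny_eq, div_le_one hK] at h
  calc x / δ = 1 / δ * x := by ring
    _ ≤ _ := by gcongr

/-- The product rule for profile moment times leading coefficient gives exp E(1) · `delta`; the
O(`delta`/δ) change of the remainder fits in because 1/δ ≤ exp E(1). -/
lemma abs_totMom_diff_le (hβ₁ : 0 < β₁) (hβ₂ : 1 < β₂) (h : Small η δ) (ht : tiny δ ≤ 1)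
    (hG : WBdd β₁ β₂ m G) (hG' : WBdd β₁ β₂ m G') (hd : WBdd β₁ β₂ d (G - G'))
    (hp : p ∈ box η δ) (hq : q ∈ box η δ) (hg : IsWeight g) :
    |totMom g δ p G - totMom g δ q G'| ≤
      momC β₁ η * Real.exp (expo δ 0 1) * delta β₁ δ m d p q := by
  have hK := Real.exp_pos (expo δ 0 1)
  have hΔ := delta_nonneg (p := p) (q := q) hβ₁ h.pos hG.nonneg hd.nonneg
  have e1 := abs_profMom_sub_le hg h hp hq
  have e2 := abs_lead_le hβ₁ hβ₂.le h hp hG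
  have e3 := abs_profMom_le hg h hq
  have e4 := abs_lead_diff_le hβ₁ hβ₂.le h hp hq hG hG' hd
  have e5 := abs_remMom_diff_le hg hβ₁ hβ₂.le h hp hq hG hG' hd
  have e6 := norm_le_delta (p := p) (q := q) hβ₁ h.pos hG.nonneg hd.nonneg
  have e7 := div_le_exp_mul ht hΔ
  have hP := profC_pos η
  have hL := leadC_pos hβ₁
  have hR := remC_pos hβ₁
  rw [totMom_eq hg hβ₁ hβ₂.le h hp hG, totMom_eq hg hβ₁ hβ₂.le h hq hG', sub_sub_sub_comm]
  set Δ := delta β₁ δ m d p q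
  set K := Real.exp (expo δ 0 1)
  have e0 : 0 ≤ 64 / δ * ‖p - q‖ :=
    mul_nonneg (div_nonneg (by norm_num) h.pos.le) (norm_nonneg _)
  calc _ ≤ |profMom g δ p * tailInt δ p G 0 - profMom g δ q * tailInt δ q G' 0| +
        |remMom g δ p G - remMom g δ q G'| := abs_sub _ _
    _ ≤ (|profMom g δ p - profMom g δ q| * |tailInt δ p G 0| +
          |profMom g δ q| * |tailInt δ p G 0 - tailInt δ q G' 0|) +
          remC β₁ * (Δ / δ) := add_le_add (abs_mul_sub_mul_le _ _ _ _) e5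
    _ ≤ (profC η * (64 / δ * ‖p - q‖) * (leadC β₁ * K * m) + profC η * (leadC β₁ * K * Δ)) +
          remC β₁ * (K * Δ) := by gcongr
    _ = profC η * leadC β₁ * K * (m * (64 / δ * ‖p - q‖)) + profC η * leadC β₁ * K * Δ +
          remC β₁ * K * Δ := by ring
    _ ≤ profC η * leadC β₁ * K * Δ + profC η * leadC β₁ * K * Δ + remC β₁ * K * Δ := by gcongr
    _ = _ := by unfold momC; ring

lemma abs_totMom_le (hβ₁ : 0 < β₁) (hβ₂ : 1 < β₂) (h : Small η δ) (ht : tiny δ ≤ 1)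
    (hG : WBdd β₁ β₂ m G) (hp : p ∈ box η δ) (hg : IsWeight g) :
    |totMom g δ p G| ≤ momC β₁ η * Real.exp (expo δ 0 1) * m := by
  have := abs_totMom_diff_le hβ₁ hβ₂ h ht hG (wBdd_zero hG.nonneg) (d := m) (by simpa using hG)
    hp hp hg
  rw [delta_self] at this
  simpa [totMom, tailInt] using this

/-- The map whose fixed points are the compatible parameters. -/
def parMap (δ : ℝ) (G : ℝ → ℝ) (p : ℝ × ℝ) : ℝ × ℝ :=
  (1 / totMom (fun z => z) δ p G, totMom (fun _ => 1) δ p G / totMom (fun z => z) δ p G ^ 2)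

/-- The map (1/A, B/A²) is homogeneous of degree -1 in (A, B). As A and B are of order exp E(1) and
change by exp E(1) · `delta`, its values change by `delta`/exp E(1). -/
lemma norm_parMap_sub_le (hβ₁ : 0 < β₁) (hβ₂ : 1 < β₂) (h : Admissible β₁ β₂ η δ r)
    (hΦ : Φ ∈ zBall β₁ β₂ (phiHat δ) r) (hΨ : Ψ ∈ zBall β₁ β₂ (phiHat δ) r)
    (hd : WBdd β₁ β₂ d (conv Φ Φ - conv Ψ Ψ)) (hp : p ∈ box η δ) (hq : q ∈ box η δ) :
    ‖parMap δ (conv Φ Φ) p - parMap δ (conv Ψ Ψ) q‖ ≤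
      stabC β₁ β₂ η * (delta β₁ δ (sqC β₁ β₂) d p q / Real.exp (expo δ 0 1)) := by
  have hK := Real.exp_pos (expo δ 0 1)
  have hG := wBdd_conv_of_mem hβ₁ hβ₂ h hΦ
  have hG' := wBdd_conv_of_mem hβ₁ hβ₂ h hΨ
  have hs := h.toSmall
  have hΔ := delta_nonneg (p := p) (q := q) hβ₁ h.pos hG.nonneg hd.nonneg
  have hm := sqC_nonneg β₁ β₂
  have a1 := totMom_ge hβ₁ hβ₂ h hΦ hp isWeight_id (normLower_le_profMom_id hs hp)
  have a2 := totMom_ge hβ₁ hβ₂ h hΨ hq isWeight_id (normLower_le_profMom_id hs hq)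
  have a3 := abs_totMom_diff_le hβ₁ hβ₂ hs h.tiny_le hG hG' hd hp hq isWeight_id
  have a4 := abs_totMom_diff_le hβ₁ hβ₂ hs h.tiny_le hG hG' hd hp hq isWeight_one
  have a5 := abs_totMom_le hβ₁ hβ₂ hs h.tiny_le hG' hq isWeight_one
  have hl : 0 < momLow η * Real.exp (expo δ 0 1) := mul_pos (momLow_pos η) hK
  have b1 := abs_inv_sub_inv_le hl a1 a2 a3
  have b2 := abs_div_sq_sub_le hl a1 a2 a3 a4 a5
  have hC := momC_pos hβ₁ η
  have hL := momLow_pos η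
  set Δ := delta β₁ δ (sqC β₁ β₂) d p q
  set K := Real.exp (expo δ 0 1)
  have e : momC β₁ η * K * Δ / (momLow η * K) ^ 2 *
      (1 + 2 * (momC β₁ η * K * sqC β₁ β₂) / (momLow η * K)) = stabC β₁ β₂ η * (Δ / K) := by
    unfold stabC
    field_simp
  rw [e] at b2
  refine max_le ?_ b2
  refine b1.trans ?_
  rw [← e]
  refine le_mul_of_one_le_right (by positivity) ?_
  have : 0 ≤ 2 * (momC β₁ η * K * sqC β₁ β₂) / (momLow η * K) := by positivity
  linarith

lemma parMap_bounds (hβ₁ : 0 < β₁) (hβ₂ : 1 < β₂) (h : Admissible β₁ β₂ η δ r)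
    (hΦ : Φ ∈ zBall β₁ β₂ (phiHat δ) r) (hp : p ∈ box η δ) :
    (0 < (parMap δ (conv Φ Φ) p).1 ∧
      (parMap δ (conv Φ Φ) p).1 ≤ 1 / momLow η / Real.exp (expo δ 0 1)) ∧
    (0 < (parMap δ (conv Φ Φ) p).2 ∧
      (parMap δ (conv Φ Φ) p).2 ≤
        momC β₁ η * sqC β₁ β₂ / momLow η ^ 2 / Real.exp (expo δ 0 1)) := by
  have hK := Real.exp_pos (expo δ 0 1)
  have hG := wBdd_conv_of_mem hβ₁ hβ₂ h hΦ
  have hs := h.toSmall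
  have hL := momLow_pos η
  have hC := momC_pos hβ₁ η
  have hm := sqC_nonneg β₁ β₂
  have a1 := totMom_ge hβ₁ hβ₂ h hΦ hp isWeight_id (normLower_le_profMom_id hs hp)
  have a2 := totMom_ge hβ₁ hβ₂ h hΦ hp isWeight_one (normLower_le_profMom_one hs hp)
  have a5 := (abs_le.1 (abs_totMom_le hβ₁ hβ₂ hs h.tiny_le hG hp isWeight_one)).2
  simp only [parMap]
  set K := Real.exp (expo δ 0 1)
  have hl : 0 < momLow η * K := mul_pos hL hK
  have hA := hl.trans_le a1
  have hB := hl.trans_le a2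
  refine ⟨⟨by positivity, ?_⟩, by positivity, ?_⟩
  · rw [div_div]
    exact one_div_le_one_div_of_le hl a1
  · calc _ ≤ momC β₁ η * K * sqC β₁ β₂ / (momLow η * K) ^ 2 := by gcongr
      _ = _ := by field_simp

lemma norm_parMap_le (hβ₁ : 0 < β₁) (hβ₂ : 1 < β₂) (h : Admissible β₁ β₂ η δ r)
    (hΦ : Φ ∈ zBall β₁ β₂ (phiHat δ) r) (hp : p ∈ box η δ) :
    ‖parMap δ (conv Φ Φ) p‖ ≤ parC β₁ β₂ η / Real.exp (expo δ 0 1) := by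
  have hK := Real.exp_pos (expo δ 0 1)
  obtain ⟨⟨h1, h2⟩, h3, h4⟩ := parMap_bounds hβ₁ hβ₂ h hΦ hp
  have hL := momLow_pos η
  have hC := momC_pos hβ₁ η
  have hm := sqC_nonneg β₁ β₂
  refine max_le ?_ ?_
  · rw [Real.norm_of_nonneg h1.le]
    refine h2.trans ?_
    unfold parC
    gcongr
    exact le_add_of_nonneg_right (by positivity)
  · rw [Real.norm_of_nonneg h3.le]
    refine h4.trans ?_
    unfold parC
    gcongr
    exact le_add_of_nonneg_left (by positivity)

lemma mapsTo_parMap (hβ₁ : 0 < β₁) (hβ₂ : 1 < β₂) (h : Admissible β₁ β₂ η δ r)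
    (hΦ : Φ ∈ zBall β₁ β₂ (phiHat δ) r) :
    MapsTo (parMap δ (conv Φ Φ)) (box η δ) (box η δ) := by
  intro p hp
  obtain ⟨⟨h1, -⟩, h3, -⟩ := parMap_bounds hβ₁ hβ₂ h hΦ hp
  have h5 := (norm_parMap_le hβ₁ hβ₂ h hΦ hp).trans h.par_le
  exact ⟨⟨h1.le, h3.le⟩, (le_abs_self _).trans ((norm_fst_le _).trans h5),
    (le_abs_self _).trans ((norm_snd_le _).trans h5)⟩

/-- The parameter part of `delta` contains ‖p - q‖/δ; divided by exp E(1) it becomes a multiple of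
`tiny δ`, made at most 1/2 by `stab_le`. -/
lemma stab_mul_le (h : Admissible β₁ β₂ η δ r) :
    stabC β₁ β₂ η * (delta β₁ δ (sqC β₁ β₂) d p q / Real.exp (expo δ 0 1)) ≤
      stabC β₁ β₂ η * (d / Real.exp (expo δ 0 1)) + 1 / 2 * ‖p - q‖ := by
  have h1 := h.stab_le
  calc _ = stabC β₁ β₂ η * (d / Real.exp (expo δ 0 1)) +
        stabC β₁ β₂ η * (sqC β₁ β₂ * (64 * (1 + 4 / β₁))) * tiny δ * ‖p - q‖ := by
        rw [tiny_eq]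
        unfold delta
        ring
    _ ≤ _ := by gcongr

lemma existsUnique_parMap (hβ₁ : 0 < β₁) (hβ₂ : 1 < β₂) (h : Admissible β₁ β₂ η δ r)
    (hΦ : Φ ∈ zBall β₁ β₂ (phiHat δ) r) :
    ∃! p, p ∈ box η δ ∧ parMap δ (conv Φ Φ) p = p := by
  have hδ : 0 ≤ η * √δ := mul_nonneg h.eta_nonneg (Real.sqrt_nonneg _)
  have hcl : IsClosed (box η δ) := isClosed_Icc (α := ℝ × ℝ)
  refine existsUnique_fixedPoint hcl ⟨0, le_rfl, hδ, hδ⟩ (mapsTo_parMap hβ₁ hβ₂ h hΦ)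
    fun p hp q hq => ?_
  -- With the same Φ on both sides only the parameters vary, so d = 0.
  have h0 : WBdd β₁ β₂ 0 (conv Φ Φ - conv Φ Φ) := by
    rw [sub_self]
    exact wBdd_zero le_rfl
  have h1 := norm_parMap_sub_le hβ₁ hβ₂ h hΦ hΦ h0 hp hq
  have h2 := stab_mul_le (d := 0) (p := p) (q := q) h
  rw [zero_div, mul_zero, zero_add] at h2
  exact h1.trans h2

/-- In ψ(z)/ψ(ξ) the normalization cancels, and the factor 1/den(ξ) inside ψ(ξ) cancels the one in
`a δ ξ`; what is left is the kernel over den(z). -/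
lemma opI_eq (h : Small η δ) (p : ℝ × ℝ) (hp : p ∈ box η δ) {z : ℝ} (hz : 0 ≤ z) :
    opI Φ p.1 p.2 δ z = p.1 * (tailInt δ p (conv Φ Φ) z / den δ z) := by
  rw [opI, tailInt]
  congr 1
  rw [div_eq_inv_mul (∫ ξ in Ioi z, _), ← integral_const_mul]
  refine setIntegral_congr_fun measurableSet_Ioi fun ξ hξ => ?_
  have hξ0 : 0 ≤ ξ := hz.trans (le_of_lt hξ)
  have hN := (normLower_pos.trans_le (normLower_le h.pos h.le hp.1)).ne'
  have hd1 := (den_pos h.pos h.le_one z).ne'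
  have hd2 := (den_pos h.pos h.le_one ξ).ne'
  simp only [psi_eq h.pos h.le_one p hz, psi_eq h.pos h.le_one p hξ0, a_eq hξ0]
  rw [div_div_div_cancel_right₀ hN, homSol, homSol, ker, sub_eq_add_neg, Real.exp_add]
  have e : Real.exp (expo δ p ξ) = (Real.exp (-expo δ p ξ))⁻¹ := by rw [Real.exp_neg, inv_inv]
  rw [e]
  have := (Real.exp_pos (-expo δ p ξ)).ne'
  field_simp

/-- Each moment of the operator is ε times `totMom`, so the conditions become εA = 1 and ε²B = ε'.
The closed box admits zero parameters while compatibility does not; the gap closes because A and B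
are positive at every point of the box. -/
lemma isCompatible_iff (hβ₁ : 0 < β₁) (hβ₂ : 1 < β₂) (h : Admissible β₁ β₂ η δ r)
    (hΦ : Φ ∈ zBall β₁ β₂ (phiHat δ) r) (p : ℝ × ℝ) :
    IsCompatible η δ Φ p ↔ p ∈ box η δ ∧ parMap δ (conv Φ Φ) p = p := by
  have hs := h.toSmall
  have key : ∀ g : ℝ → ℝ, p ∈ box η δ → ∫ z in Ioi (0 : ℝ), g z * opI Φ p.1 p.2 δ z =
      p.1 * totMom g δ p (conv Φ Φ) := by
    intro g hp
    rw [totMom, ← integral_const_mul]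
    refine setIntegral_congr_fun measurableSet_Ioi fun z hz => ?_
    simp only [opI_eq hs p hp (le_of_lt hz)]
    ring
  have key1 := key (fun z => z)
  have key2 := key (fun _ => 1)
  simp only [one_mul] at key2
  have hpos : p ∈ box η δ → 0 < totMom (fun z => z) δ p (conv Φ Φ) := fun hp =>
    (mul_pos (momLow_pos η) (Real.exp_pos _)).trans_le
      (totMom_ge hβ₁ hβ₂ h hΦ hp isWeight_id (normLower_le_profMom_id hs hp))
  constructor
  · rintro ⟨⟨h1, h2⟩, ⟨h3, h4⟩, h5, h6⟩
    have hp : p ∈ box η δ := ⟨⟨h1.le, h3.le⟩, h2, h4⟩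
    refine ⟨hp, ?_⟩
    have hA := hpos hp
    rw [key1 hp] at h5
    rw [key2 hp] at h6
    unfold parMap
    set A := totMom (fun z => z) δ p (conv Φ Φ)
    set B := totMom (fun _ => 1) δ p (conv Φ Φ)
    have h7 : p.1 * A = 1 := mul_left_cancel₀ h1.ne' (h5.trans (mul_one _).symm)
    have h8 : 1 / A = p.1 := by rw [← h7]; field_simp
    refine Prod.ext h8 ?_
    change B / A ^ 2 = p.2
    rw [← h6, ← h8]
    field_simp
  · rintro ⟨hp, hfix⟩
    obtain ⟨⟨h1, -⟩, h3, -⟩ := parMap_bounds hβ₁ hβ₂ h hΦ hp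
    have hA := hpos hp
    rw [hfix] at h1 h3
    refine ⟨⟨h1, hp.2.1⟩, ⟨h3, hp.2.2⟩, ?_, ?_⟩
    · rw [key1 hp]
      have h8 : 1 / totMom (fun z => z) δ p (conv Φ Φ) = p.1 := congrArg Prod.fst hfix
      rw [← h8]
      field_simp
    · rw [key2 hp]
      have h8 : 1 / totMom (fun z => z) δ p (conv Φ Φ) = p.1 := congrArg Prod.fst hfix
      have h9 : totMom (fun _ => 1) δ p (conv Φ Φ) / totMom (fun z => z) δ p (conv Φ Φ) ^ 2 = p.2 :=
        congrArg Prod.snd hfix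
      rw [← h8, ← h9]
      field_simp

theorem existsUnique_isCompatible (hβ₁ : 0 < β₁) (hβ₂ : 1 < β₂) (h : Admissible β₁ β₂ η δ r)
    (hΦ : Φ ∈ zBall β₁ β₂ (phiHat δ) r) : ∃! p, IsCompatible η δ Φ p := by
  simp only [isCompatible_iff hβ₁ hβ₂ h hΦ]
  exact existsUnique_parMap hβ₁ hβ₂ h hΦ

lemma params_spec (hβ₁ : 0 < β₁) (hβ₂ : 1 < β₂) (h : Admissible β₁ β₂ η δ r)
    (hΦ : Φ ∈ zBall β₁ β₂ (phiHat δ) r) :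
    params η δ Φ ∈ box η δ ∧ parMap δ (conv Φ Φ) (params η δ Φ) = params η δ Φ :=
  (isCompatible_iff hβ₁ hβ₂ h hΦ _).1
    (Classical.epsilon_spec (existsUnique_isCompatible hβ₁ hβ₂ h hΦ).exists)

end

end LSW

/-! ### Self map and contraction estimates. -/

namespace LSW

noncomputable section

variable {δ η : ℝ} {p q : ℝ × ℝ} {β₁ β₂ m d r s : ℝ} {G G' g f Φ Ψ : ℝ → ℝ}

lemma abs_psi_sub_le (h : Small η δ) (hp : p ∈ box η δ) (hq : q ∈ box η δ) {z : ℝ}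
    (hz : z ∈ Icc (0 : ℝ) 1) :
    |homSol δ p z / normC δ p - homSol δ q z / normC δ q| ≤ psiC η * (‖p - q‖ / δ) := by
  have e1 := abs_homSol_sub_le h hp hq hz
  have e2 : |normC δ p - normC δ q| ≤ profC η * (64 / δ * ‖p - q‖) :=
    abs_profMom_sub_le isWeight_id h hp hq
  have e3 := homSol_le h hq hz
  have e4 := (homSol_pos h.pos h.le_one q z).le
  have h1 := normLower_le h.pos h.le hp.1
  have h2 := normLower_le h.pos h.le hq.1
  have h0 := normLower_pos
  have h3 := h0.trans_le h1
  have h4 := h0.trans_le h2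
  have hδ := h.pos
  have hC := profC_pos η
  have key : homSol δ p z / normC δ p - homSol δ q z / normC δ q =
      (homSol δ p z - homSol δ q z) / normC δ p -
        homSol δ q z * (normC δ p - normC δ q) / (normC δ p * normC δ q) := by
    field_simp
    ring
  rw [key]
  refine (abs_sub _ _).trans ?_
  rw [abs_div, abs_div, abs_mul, abs_of_pos h3, abs_of_pos (mul_pos h3 h4), abs_of_nonneg e4]
  calc _ ≤ profC η * (64 / δ * ‖p - q‖) / normLower +
        profC η * (profC η * (64 / δ * ‖p - q‖)) / (normLower * normLower) := by gcongr
    _ = _ := by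
        unfold psiC
        field_simp

lemma homSol_div_normC_le (h : Small η δ) (hp : p ∈ box η δ) {z : ℝ} (hz : z ∈ Icc (0 : ℝ) 1) :
    |homSol δ p z / normC δ p| ≤ profC η / normLower := by
  have h1 := normLower_le h.pos h.le hp.1
  have h0 := normLower_pos
  rw [abs_of_nonneg (div_nonneg (homSol_pos h.pos h.le_one p z).le (h0.le.trans h1))]
  have := homSol_le h hp hz
  have := profC_pos η
  gcongr

/-- The remainder of the first moment. -/
def remId (δ : ℝ) (p : ℝ × ℝ) (G : ℝ → ℝ) : ℝ := remMom (fun z => z) δ p G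

/-- The form of the operator on `[0, 1]` at compatible parameters. -/
lemma opI_eq_of_fixed (hβ₁ : 0 < β₁) (hβ₂ : 1 < β₂) (h : Admissible β₁ β₂ η δ r)
    (hΦ : Φ ∈ zBall β₁ β₂ (phiHat δ) r) (hp : p ∈ box η δ)
    (hfix : parMap δ (conv Φ Φ) p = p) {z : ℝ} (hz : z ∈ Icc (0 : ℝ) 1) :
    opI Φ p.1 p.2 δ z = homSol δ p z / normC δ p * (1 + p.1 * remId δ p (conv Φ Φ)) -
      p.1 * (headInt δ p (conv Φ Φ) z / den δ z) := by
  have hs := h.toSmall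
  have hG := wBdd_conv_of_mem hβ₁ hβ₂ h hΦ
  have hN := normLower_pos.trans_le (normLower_le h.pos h.le hp.1)
  have hA : 0 < totMom (fun z => z) δ p (conv Φ Φ) :=
    (mul_pos (momLow_pos η) (Real.exp_pos _)).trans_le
      (totMom_ge hβ₁ hβ₂ h hΦ hp isWeight_id (normLower_le_profMom_id hs hp))
  have h8 : 1 / totMom (fun z => z) δ p (conv Φ Φ) = p.1 := congrArg Prod.fst hfix
  have h9 : p.1 * totMom (fun z => z) δ p (conv Φ Φ) = 1 := by
    rw [← h8]
    field_simp
  rw [totMom_eq isWeight_id hβ₁ hβ₂.le hs hp hG] at h9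
  have h10 : profMom (fun z => z) δ p = normC δ p := rfl
  rw [h10] at h9
  rw [opI_eq hs p hp hz.1, tailInt_div_eq hβ₁ hβ₂.le hs hp hG hz.1, remId]
  -- The first compatibility condition trades ε times the exponentially large coefficient for 1 +
  -- εR, so that this product of a tiny and a huge factor never has to be estimated.
  have h11 : 1 + p.1 * remMom (fun z => z) δ p (conv Φ Φ) =
      p.1 * normC δ p * tailInt δ p (conv Φ Φ) 0 := by linear_combination -h9
  rw [h11]
  field_simp

lemma fst_bounds (hβ₁ : 0 < β₁) (hβ₂ : 1 < β₂) (h : Admissible β₁ β₂ η δ r)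
    (hΦ : Φ ∈ zBall β₁ β₂ (phiHat δ) r) (hp : p ∈ box η δ)
    (hfix : parMap δ (conv Φ Φ) p = p) :
    |p.1| ≤ 1 / momLow η / Real.exp (expo δ 0 1) ∧
      ‖p‖ ≤ parC β₁ β₂ η / Real.exp (expo δ 0 1) := by
  obtain ⟨⟨h1, h2⟩, -⟩ := parMap_bounds hβ₁ hβ₂ h hΦ hp
  have h3 := norm_parMap_le hβ₁ hβ₂ h hΦ hp
  rw [hfix] at h1 h2 h3
  exact ⟨by rwa [abs_of_pos h1], h3⟩

lemma inv_exp_le_tiny (h : Small η δ) : 1 / Real.exp (expo δ 0 1) ≤ tiny δ := by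
  have hδ := h.pos
  unfold tiny
  have := Real.exp_pos (expo δ 0 1)
  refine one_div_le_one_div_of_le (by positivity) ?_
  exact mul_le_of_le_one_left this.le h.le_one

lemma tiny_pos (h : Small η δ) : 0 < tiny δ := by
  have hδ := h.pos
  unfold tiny
  positivity

/-- The constant in the self map estimate on `[0, 1]`. -/
def selfHeadC (β₁ β₂ η : ℝ) : ℝ :=
  psiC η * parC β₁ β₂ η + profC η / normLower * (1 / momLow η * (remC β₁ * sqC β₁ β₂)) +
    1 / momLow η * (32 * sqC β₁ β₂)

/-- The constant in the self map estimate. -/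
def selfC (β₁ β₂ η : ℝ) : ℝ :=
  selfHeadC β₁ β₂ η * Real.exp β₁ + 1 / momLow η * (tailIntC β₁ * sqC β₁ β₂)

lemma selfHeadC_nonneg (hβ₁ : 0 < β₁) (β₂ η : ℝ) : 0 ≤ selfHeadC β₁ β₂ η := by
  have := psiC_pos η
  have := parC_pos hβ₁ β₂ η
  have := profC_pos η
  have := normLower_pos
  have := momLow_pos η
  have := remC_pos hβ₁
  have := sqC_nonneg β₁ β₂
  unfold selfHeadC
  positivity

lemma selfC_nonneg (hβ₁ : 0 < β₁) (β₂ η : ℝ) : 0 ≤ selfC β₁ β₂ η := by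
  have := selfHeadC_nonneg hβ₁ β₂ η
  have := momLow_pos η
  have := tailIntC_pos hβ₁
  have := sqC_nonneg β₁ β₂
  unfold selfC
  positivity

lemma abs_headInt_div_le (hβ₁ : 0 < β₁) (hβ₂ : 0 ≤ β₂) (h : Small η δ) (hp : p ∈ box η δ)
    (hG : WBdd β₁ β₂ m G) {z : ℝ} (hz : z ∈ Icc (0 : ℝ) 1) :
    |headInt δ p G z / den δ z| ≤ 32 * (m / δ) := by
  have := abs_headInt_div_diff_le hβ₁ hβ₂ h hp hp hG (wBdd_zero hG.nonneg) (d := m)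
    (by simpa using hG) hz
  rw [delta_self] at this
  simpa [headInt] using this

lemma le_mul_wt_of_le_one (hβ₁ : 0 < β₁) {x C z : ℝ} (hC : 0 ≤ C) (hz : z ≤ 1) (hx : x ≤ C) :
    x ≤ C * Real.exp β₁ * wt β₁ β₂ z := by
  have := exp_le_wt (β₂ := β₂) hβ₁.le hz
  calc x ≤ C * Real.exp β₁ * Real.exp (-β₁) := by
        rw [Real.exp_neg]
        field_simp
        exact hx
    _ ≤ _ := by gcongr

lemma abs_opI_sub_phiHat_le (hβ₁ : 0 < β₁) (hβ₂ : 1 < β₂) (h : Admissible β₁ β₂ η δ r)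
    (hΦ : Φ ∈ zBall β₁ β₂ (phiHat δ) r) (hp : p ∈ box η δ)
    (hfix : parMap δ (conv Φ Φ) p = p) {z : ℝ} (hz : 0 ≤ z) :
    |opI Φ p.1 p.2 δ z - phiHat δ z| ≤ selfC β₁ β₂ η * tiny δ * wt β₁ β₂ z := by
  have hs := h.toSmall
  have hδ := h.pos
  have hG := wBdd_conv_of_mem hβ₁ hβ₂ h hΦ
  obtain ⟨hp1, hp2⟩ := fst_bounds hβ₁ hβ₂ h hΦ hp hfix
  have hK := Real.exp_pos (expo δ 0 1)
  have c1 := psiC_pos η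
  have c2 := parC_pos hβ₁ β₂ η
  have c3 := profC_pos η
  have c4 := normLower_pos
  have c5 := momLow_pos η
  have c6 := remC_pos hβ₁
  have c7 := sqC_nonneg β₁ β₂
  have c8 := tailIntC_pos hβ₁
  have c9 := selfHeadC_nonneg hβ₁ β₂ η
  have ht := tiny_pos hs
  have hw := wt_pos β₁ β₂ z
  rcases le_or_gt z 1 with h1 | h1
  · have hz1 : z ∈ Icc (0 : ℝ) 1 := ⟨hz, h1⟩
    -- The centre `phiHat` is the normalized profile at zero parameters, so Lipschitz dependence of
    -- the profile is applied between p and 0.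
    have h0 : (0 : ℝ × ℝ) ∈ box η δ :=
      ⟨le_rfl, mul_nonneg h.eta_nonneg (Real.sqrt_nonneg _),
        mul_nonneg h.eta_nonneg (Real.sqrt_nonneg _)⟩
    have e1 := abs_psi_sub_le hs hp h0 hz1
    have e2 := homSol_div_normC_le hs hp hz1
    have e3 : |remId δ p (conv Φ Φ)| ≤ _ := abs_remMom_le isWeight_id hβ₁ hβ₂.le hs hp hG
    have e4 := abs_headInt_div_le hβ₁ (by linarith) hs hp hG hz1
    rw [sub_zero] at e1
    have e5 : |opI Φ p.1 p.2 δ z - phiHat δ z| ≤ selfHeadC β₁ β₂ η * tiny δ := by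
      rw [opI_eq_of_fixed hβ₁ hβ₂ h hΦ hp hfix hz1, phiHat_of_mem h.pos h.le_one hz1]
      set x := homSol δ p z / normC δ p
      set y := homSol δ 0 z / normC δ 0
      set R := remId δ p (conv Φ Φ)
      set P := headInt δ p (conv Φ Φ) z / den δ z
      set K := Real.exp (expo δ 0 1)
      calc |x * (1 + p.1 * R) - p.1 * P - y| = |(x - y) + x * (p.1 * R) - p.1 * P| := by
            congr 1
            ring
        _ ≤ |x - y| + |x| * (|p.1| * |R|) + |p.1| * |P| := by
            refine (abs_sub _ _).trans ?_
            rw [abs_mul p.1 P]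
            gcongr
            refine (abs_add_le _ _).trans_eq ?_
            rw [abs_mul, abs_mul]
        _ ≤ psiC η * (parC β₁ β₂ η / K / δ) +
              profC η / normLower * (1 / momLow η / K * (remC β₁ * (sqC β₁ β₂ / δ))) +
              1 / momLow η / K * (32 * (sqC β₁ β₂ / δ)) := by
            gcongr
            refine e1.trans ?_
            gcongr
        _ = _ := by
            rw [tiny_eq]
            unfold selfHeadC
            ring
    refine (le_mul_wt_of_le_one (β₂ := β₂) hβ₁ (by positivity) h1 e5).trans ?_
    unfold selfC
    have : 0 ≤ 1 / momLow η * (tailIntC β₁ * sqC β₁ β₂) * tiny δ * wt β₁ β₂ z := by positivity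
    linarith
  · rw [phiHat_of_one_lt h1, sub_zero, opI_eq hs p hp hz, abs_mul]
    have e1 := abs_tailInt_div_le hβ₁ hβ₂.le hs hp hG h1.le
    have e2 := inv_exp_le_tiny hs
    calc _ ≤ 1 / momLow η / Real.exp (expo δ 0 1) * (tailIntC β₁ * sqC β₁ β₂ * wt β₁ β₂ z) := by
          gcongr
      _ = 1 / momLow η * (tailIntC β₁ * sqC β₁ β₂) * wt β₁ β₂ z *
            (1 / Real.exp (expo δ 0 1)) := by ring
      _ ≤ 1 / momLow η * (tailIntC β₁ * sqC β₁ β₂) * wt β₁ β₂ z * tiny δ := by gcongr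
      _ ≤ _ := by
          unfold selfC
          have : 0 ≤ selfHeadC β₁ β₂ η * Real.exp β₁ * tiny δ * wt β₁ β₂ z := by positivity
          linarith

lemma aemeasurable_opI (hβ₁ : 0 < β₁) (hβ₂ : 1 < β₂) (h : Admissible β₁ β₂ η δ r)
    (hΦ : Φ ∈ zBall β₁ β₂ (phiHat δ) r) (hp : p ∈ box η δ) :
    AEMeasurable (opI Φ p.1 p.2 δ) (volume.restrict (Ici 0)) := by
  have h1 := ((aestronglyMeasurable_mul_tailInt isWeight_one hβ₁ hβ₂.le h.toSmall hp
    (wBdd_conv_of_mem hβ₁ hβ₂ h hΦ)).const_mul p.1).aemeasurable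
  refine h1.congr ?_
  filter_upwards [ae_restrict_mem measurableSet_Ici] with z hz
  rw [opI_eq h.toSmall p hp hz, one_mul]

theorem opIbar_mem (hβ₁ : 0 < β₁) (hβ₂ : 1 < β₂) (h : Admissible β₁ β₂ η δ r)
    (hr : 2 * selfC β₁ β₂ η * tiny δ ≤ r) (hΦ : Φ ∈ zBall β₁ β₂ (phiHat δ) r) :
    opIbar η δ Φ ∈ zBall β₁ β₂ (phiHat δ) r := by
  obtain ⟨hp, hfix⟩ := params_spec hβ₁ hβ₂ h hΦ
  have ht := tiny_pos h.toSmall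
  have hC := selfC_nonneg hβ₁ β₂ η
  have h1 : zNorm β₁ β₂ (opIbar η δ Φ - phiHat δ) ≤ ENNReal.ofReal r := by
    refine (zNorm_le_of_abs_le hβ₁.le (by linarith) (m := selfC β₁ β₂ η * tiny δ)
      (by positivity) fun z hz => ?_).trans (ENNReal.ofReal_le_ofReal (by linarith))
    exact abs_opI_sub_phiHat_le hβ₁ hβ₂ h hΦ hp hfix hz
  refine ⟨⟨aemeasurable_opI hβ₁ hβ₂ h hΦ hp, ?_⟩, h1⟩
  have h2 : zNorm β₁ β₂ (phiHat δ) ≤ ENNReal.ofReal (2 * hatC β₁) :=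
    zNorm_le_of_abs_le hβ₁.le (by linarith) (hatC_pos β₁).le (wBdd_phiHat hβ₁ h.toSmall).bound
  have h3 := zNorm_add_le (β₁ := β₁) (β₂ := β₂) (opIbar η δ Φ - phiHat δ) (phiHat δ)
  rw [sub_add_cancel] at h3
  exact h3.trans_lt (ENNReal.add_lt_top.2
    ⟨h1.trans_lt ENNReal.ofReal_lt_top, h2.trans_lt ENNReal.ofReal_lt_top⟩)

/-- Lipschitz dependence of the compatible parameters on the convolution term. -/
lemma norm_sub_le_of_fixed (hβ₁ : 0 < β₁) (hβ₂ : 1 < β₂) (h : Admissible β₁ β₂ η δ r)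
    (hΦ : Φ ∈ zBall β₁ β₂ (phiHat δ) r) (hΨ : Ψ ∈ zBall β₁ β₂ (phiHat δ) r)
    (hd : WBdd β₁ β₂ d (conv Φ Φ - conv Ψ Ψ)) (hp : p ∈ box η δ) (hq : q ∈ box η δ)
    (hpf : parMap δ (conv Φ Φ) p = p) (hqf : parMap δ (conv Ψ Ψ) q = q) :
    ‖p - q‖ ≤ 2 * stabC β₁ β₂ η * (d / Real.exp (expo δ 0 1)) ∧
      delta β₁ δ (sqC β₁ β₂) d p q ≤ 2 * d := by
  have h1 := norm_parMap_sub_le hβ₁ hβ₂ h hΦ hΨ hd hp hq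
  have h2 := stab_mul_le (d := d) (p := p) (q := q) h
  rw [hpf, hqf] at h1
  -- The term ‖p - q‖/2 of the stability estimate is absorbed on the left.
  have h3 : ‖p - q‖ ≤ 2 * stabC β₁ β₂ η * (d / Real.exp (expo δ 0 1)) := by linarith
  refine ⟨h3, ?_⟩
  have h4 := h.stab_le
  have hδ := h.pos
  have hm := sqC_nonneg β₁ β₂
  have hdn := hd.nonneg
  have : sqC β₁ β₂ * (64 * (1 + 4 / β₁)) * (‖p - q‖ / δ) ≤ d := by
    calc _ ≤ sqC β₁ β₂ * (64 * (1 + 4 / β₁)) *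
          (2 * stabC β₁ β₂ η * (d / Real.exp (expo δ 0 1)) / δ) := by gcongr
      _ = 2 * (stabC β₁ β₂ η * (sqC β₁ β₂ * (64 * (1 + 4 / β₁))) * tiny δ) * d := by
          rw [tiny_eq]
          ring
      _ ≤ 2 * (1 / 2) * d := by gcongr
      _ = d := by ring
  unfold delta
  linarith

/-- The constant for products of the small parameter with linear functionals. -/
def prodC (β₁ β₂ η : ℝ) : ℝ := 2 * stabC β₁ β₂ η * sqC β₁ β₂ + 2 / momLow η

/-- The constant in the contraction estimate on `[0, 1]`. -/
def contrHeadC (β₁ β₂ η : ℝ) : ℝ :=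
  4 * psiC η * stabC β₁ β₂ η + profC η / normLower * (remC β₁ * prodC β₁ β₂ η) +
    32 * prodC β₁ β₂ η

/-- The constant in the contraction estimate. -/
def contrC (β₁ β₂ η : ℝ) : ℝ :=
  contrHeadC β₁ β₂ η * Real.exp β₁ + tailIntC β₁ * prodC β₁ β₂ η

lemma prodC_pos (hβ₁ : 0 < β₁) (β₂ η : ℝ) : 0 < prodC β₁ β₂ η := by
  have := stabC_pos hβ₁ β₂ η
  have := sqC_nonneg β₁ β₂
  have := momLow_pos η
  unfold prodC
  positivity

lemma contrHeadC_pos (hβ₁ : 0 < β₁) (β₂ η : ℝ) : 0 < contrHeadC β₁ β₂ η := by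
  have := prodC_pos hβ₁ β₂ η
  have := stabC_pos hβ₁ β₂ η
  have := psiC_pos η
  have := profC_pos η
  have := normLower_pos
  have := remC_pos hβ₁
  unfold contrHeadC
  positivity

lemma contrC_pos (hβ₁ : 0 < β₁) (β₂ η : ℝ) : 0 < contrC β₁ β₂ η := by
  have := contrHeadC_pos hβ₁ β₂ η
  have := prodC_pos hβ₁ β₂ η
  have := tailIntC_pos hβ₁
  unfold contrC
  positivity

/-- Changes of `ε X`, when `X` is bounded by `c m` and changes by at most `2 c d`. -/
lemma abs_fst_mul_sub_le (hβ₁ : 0 < β₁) {x y c K : ℝ} (hK : 0 < K)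
    (hd : 0 ≤ d)
    (hpq : ‖p - q‖ ≤ 2 * stabC β₁ β₂ η * (d / K)) (hq : |q.1| ≤ 1 / momLow η / K)
    (hx : |x| ≤ c * sqC β₁ β₂) (hxy : |x - y| ≤ c * (2 * d)) :
    |p.1 * x - q.1 * y| ≤ c * prodC β₁ β₂ η * (d / K) := by
  have h1 : |p.1 - q.1| ≤ ‖p - q‖ := norm_fst_le (p - q)
  have hs := stabC_pos hβ₁ β₂ η
  have hm := momLow_pos η
  calc _ ≤ |p.1 - q.1| * |x| + |q.1| * |x - y| := abs_mul_sub_mul_le _ _ _ _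
    _ ≤ 2 * stabC β₁ β₂ η * (d / K) * (c * sqC β₁ β₂) + 1 / momLow η / K * (c * (2 * d)) := by
        gcongr
        exact h1.trans hpq
    _ = _ := by
        unfold prodC
        ring

/-- In each term either the parameters differ, by O(d/exp E(1)), or a factor ε = O(1/exp E(1)) meets
a change O(d). On [0, 1] the estimates lose a single factor 1/δ, beyond 1 none; `tiny δ` covers
both. -/
lemma abs_opI_sub_opI_le (hβ₁ : 0 < β₁) (hβ₂ : 1 < β₂) (h : Admissible β₁ β₂ η δ r)
    (hΦ : Φ ∈ zBall β₁ β₂ (phiHat δ) r) (hΨ : Ψ ∈ zBall β₁ β₂ (phiHat δ) r)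
    (hd : WBdd β₁ β₂ d (conv Φ Φ - conv Ψ Ψ)) (hp : p ∈ box η δ) (hq : q ∈ box η δ)
    (hpf : parMap δ (conv Φ Φ) p = p) (hqf : parMap δ (conv Ψ Ψ) q = q) {z : ℝ} (hz : 0 ≤ z) :
    |opI Φ p.1 p.2 δ z - opI Ψ q.1 q.2 δ z| ≤
      contrC β₁ β₂ η * tiny δ * d * wt β₁ β₂ z := by
  have hs := h.toSmall
  have hδ := h.pos
  have hG := wBdd_conv_of_mem hβ₁ hβ₂ h hΦ
  have hG' := wBdd_conv_of_mem hβ₁ hβ₂ h hΨ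
  obtain ⟨hpq, hΔ⟩ := norm_sub_le_of_fixed hβ₁ hβ₂ h hΦ hΨ hd hp hq hpf hqf
  obtain ⟨hp1, -⟩ := fst_bounds hβ₁ hβ₂ h hΦ hp hpf
  obtain ⟨hq1, -⟩ := fst_bounds hβ₁ hβ₂ h hΨ hq hqf
  have hK := Real.exp_pos (expo δ 0 1)
  have hdn := hd.nonneg
  have c1 := psiC_pos η
  have c2 := prodC_pos hβ₁ β₂ η
  have c3 := profC_pos η
  have c4 := normLower_pos
  have c5 := momLow_pos η
  have c6 := remC_pos hβ₁
  have c7 := sqC_nonneg β₁ β₂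
  have c8 := tailIntC_pos hβ₁
  have c9 := contrHeadC_pos hβ₁ β₂ η
  have ht := tiny_pos hs
  have hw := wt_pos β₁ β₂ z
  rcases le_or_gt z 1 with h1 | h1
  · have hz1 : z ∈ Icc (0 : ℝ) 1 := ⟨hz, h1⟩
    have e1 := abs_psi_sub_le hs hp hq hz1
    have e2 := homSol_div_normC_le hs hq hz1
    have e3 : |remId δ p (conv Φ Φ)| ≤ _ := abs_remMom_le isWeight_id hβ₁ hβ₂.le hs hp hG
    have e4 : |remId δ p (conv Φ Φ) - remId δ q (conv Ψ Ψ)| ≤ _ :=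
      abs_remMom_diff_le isWeight_id hβ₁ hβ₂.le hs hp hq hG hG' hd
    have e5 := abs_headInt_div_le hβ₁ (by linarith) hs hp hG hz1
    have e6 := abs_headInt_div_diff_le hβ₁ (by linarith) hs hp hq hG hG' hd hz1
    have e7 : |p.1 * remId δ p (conv Φ Φ)| ≤ 1 := by
      rw [abs_mul]
      calc _ ≤ 1 / momLow η / Real.exp (expo δ 0 1) * (remC β₁ * (sqC β₁ β₂ / δ)) := by gcongr
        _ = remC β₁ * sqC β₁ β₂ * tiny δ / momLow η := by
            rw [tiny_eq]
            ring
        _ ≤ 1 := (div_le_one c5).2 h.rem_le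
    have e8 : |opI Φ p.1 p.2 δ z - opI Ψ q.1 q.2 δ z| ≤ contrHeadC β₁ β₂ η * tiny δ * d := by
      rw [opI_eq_of_fixed hβ₁ hβ₂ h hΦ hp hpf hz1, opI_eq_of_fixed hβ₁ hβ₂ h hΨ hq hqf hz1]
      set x := homSol δ p z / normC δ p
      set y := homSol δ q z / normC δ q
      set R := remId δ p (conv Φ Φ)
      set R' := remId δ q (conv Ψ Ψ)
      set P := headInt δ p (conv Φ Φ) z / den δ z
      set P' := headInt δ q (conv Ψ Ψ) z / den δ z
      set K := Real.exp (expo δ 0 1)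
      set Δ := delta β₁ δ (sqC β₁ β₂) d p q
      have f1 : |p.1 * R - q.1 * R'| ≤ remC β₁ / δ * prodC β₁ β₂ η * (d / K) := by
        refine abs_fst_mul_sub_le hβ₁ hK hdn hpq hq1 (e3.trans_eq (by ring))
          (e4.trans ?_)
        calc _ = remC β₁ / δ * Δ := by ring
          _ ≤ _ := by gcongr
      have f2 : |p.1 * P - q.1 * P'| ≤ 32 / δ * prodC β₁ β₂ η * (d / K) := by
        refine abs_fst_mul_sub_le hβ₁ hK hdn hpq hq1 (e5.trans_eq (by ring))
          (e6.trans ?_)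
        calc _ = 32 / δ * Δ := by ring
          _ ≤ _ := by gcongr
      calc |x * (1 + p.1 * R) - p.1 * P - (y * (1 + q.1 * R') - q.1 * P')| =
            |(x - y) * (1 + p.1 * R) + y * (p.1 * R - q.1 * R') - (p.1 * P - q.1 * P')| := by
            congr 1
            ring
        _ ≤ |x - y| * |1 + p.1 * R| + |y| * |p.1 * R - q.1 * R'| + |p.1 * P - q.1 * P'| := by
            refine (abs_sub _ _).trans ?_
            gcongr
            refine (abs_add_le _ _).trans_eq ?_
            rw [abs_mul, abs_mul]
        _ ≤ psiC η * (2 * stabC β₁ β₂ η * (d / K) / δ) * 2 +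
              profC η / normLower * (remC β₁ / δ * prodC β₁ β₂ η * (d / K)) +
              32 / δ * prodC β₁ β₂ η * (d / K) := by
            have f3 : |1 + p.1 * R| ≤ 2 := by
              refine (abs_add_le _ _).trans ?_
              rw [abs_one]
              linarith
            have f4 : |x - y| ≤ psiC η * (2 * stabC β₁ β₂ η * (d / K) / δ) := by
              refine e1.trans ?_
              gcongr
            have := (abs_nonneg _).trans f4
            gcongr
        _ = _ := by
            rw [tiny_eq]
            unfold contrHeadC
            ring
    refine (le_mul_wt_of_le_one (β₂ := β₂) hβ₁ (by positivity) h1 e8).trans ?_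
    unfold contrC
    have : 0 ≤ tailIntC β₁ * prodC β₁ β₂ η * tiny δ * d * wt β₁ β₂ z := by positivity
    linarith
  · rw [opI_eq hs p hp hz, opI_eq hs q hq hz]
    have e1 := abs_tailInt_div_le hβ₁ hβ₂.le hs hp hG h1.le
    have e2 := abs_tailInt_div_diff_le hβ₁ hβ₂.le hs hp hq hG hG' hd h1.le
    have e3 := inv_exp_le_tiny hs
    have f := abs_fst_mul_sub_le (c := tailIntC β₁ * wt β₁ β₂ z) hβ₁ hK hdn hpq hq1
      (e1.trans_eq (by ring)) (e2.trans (by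
        calc _ = tailIntC β₁ * wt β₁ β₂ z * delta β₁ δ (sqC β₁ β₂) d p q := by ring
          _ ≤ _ := by gcongr))
    refine f.trans ?_
    calc _ = tailIntC β₁ * prodC β₁ β₂ η * d * wt β₁ β₂ z * (1 / Real.exp (expo δ 0 1)) := by ring
      _ ≤ tailIntC β₁ * prodC β₁ β₂ η * d * wt β₁ β₂ z * tiny δ := by gcongr
      _ ≤ _ := by
          unfold contrC
          have : 0 ≤ contrHeadC β₁ β₂ η * Real.exp β₁ * tiny δ * d * wt β₁ β₂ z := by positivity
          linarith

/-- The Lipschitz constant of `opIbar`, without the small factor. -/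
def lipC (β₁ β₂ η : ℝ) : ℝ :=
  2 * contrC β₁ β₂ η * (2 * convC β₂ * ballC β₁ * Real.exp β₁)

lemma lipC_nonneg (hβ₁ : 0 < β₁) (β₂ η : ℝ) : 0 ≤ lipC β₁ β₂ η := by
  have := contrC_pos hβ₁ β₂ η
  have := convC_nonneg β₂
  have := ballC_pos β₁
  unfold lipC
  positivity

theorem zNorm_opIbar_sub_le (hβ₁ : 0 < β₁) (hβ₂ : 1 < β₂) (h : Admissible β₁ β₂ η δ r)
    (hΦ : Φ ∈ zBall β₁ β₂ (phiHat δ) r) (hΨ : Ψ ∈ zBall β₁ β₂ (phiHat δ) r) :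
    zNorm β₁ β₂ (opIbar η δ Φ - opIbar η δ Ψ) ≤
      ENNReal.ofReal (lipC β₁ β₂ η * tiny δ) * zNorm β₁ β₂ (Φ - Ψ) := by
  obtain ⟨hp, hpf⟩ := params_spec hβ₁ hβ₂ h hΦ
  obtain ⟨hq, hqf⟩ := params_spec hβ₁ hβ₂ h hΨ
  have ht := tiny_pos h.toSmall
  have hfin : zNorm β₁ β₂ (Φ - Ψ) ≠ ∞ := by
    refine ne_top_of_le_ne_top ?_ (zNorm_sub_le Φ (phiHat δ) Ψ)
    rw [zNorm_sub_comm (phiHat δ)]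
    exact ENNReal.add_ne_top.2 ⟨(hΦ.2.trans_lt ENNReal.ofReal_lt_top).ne,
      (hΨ.2.trans_lt ENNReal.ofReal_lt_top).ne⟩
  -- Finiteness of the distance within the ball lets it serve as the real constant of a weighted
  -- bound.
  set t := (zNorm β₁ β₂ (Φ - Ψ)).toReal with htdef
  have htn : 0 ≤ t := ENNReal.toReal_nonneg
  have hte : zNorm β₁ β₂ (Φ - Ψ) = ENNReal.ofReal t := (ENNReal.ofReal_toReal hfin).symm
  have h1 := wBdd_of_mem hβ₁ h.toSmall h.r_nonneg h.r_le hΦ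
  have h2 := wBdd_of_mem hβ₁ h.toSmall h.r_nonneg h.r_le hΨ
  have h3 : WBdd β₁ β₂ (Real.exp β₁ * t) (Φ - Ψ) :=
    ⟨h1.meas.sub h2.meas, fun z hz => abs_le_of_zNorm_le hβ₁.le htn hte.le hz⟩
  have hd := h1.conv_self_sub hβ₁ hβ₂ h2 h3
  have hdn := hd.nonneg
  have hC := contrC_pos hβ₁ β₂ η
  rw [hte, ← ENNReal.ofReal_mul (mul_nonneg (lipC_nonneg hβ₁ β₂ η) ht.le)]
  refine (zNorm_le_of_abs_le hβ₁.le (by linarith)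
    (m := contrC β₁ β₂ η * tiny δ * (2 * convC β₂ * ballC β₁ * (Real.exp β₁ * t)))
    (by positivity) fun z hz => ?_).trans_eq ?_
  · exact abs_opI_sub_opI_le hβ₁ hβ₂ h hΦ hΨ hd hp hq hpf hqf hz
  · congr 1
    unfold lipC
    ring

/-! ### Validity of the smallness conditions for small δ, and the conclusion. -/

lemma tiny_le (hδ : 0 < δ) (hδ1 : δ ≤ 1 / 16) : tiny δ ≤ growthC * δ := by
  have h1 := inv_exp_expo_le hδ hδ1
  have hg := growthC_pos
  calc tiny δ = 1 / δ * (1 / Real.exp (expo δ 0 1)) := by rw [tiny_eq]; ring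
    _ ≤ 1 / δ * (growthC * δ ^ 5) := by gcongr
    _ = growthC * δ * δ ^ 3 := by field_simp
    _ ≤ growthC * δ * 1 := by
        gcongr
        exact pow_le_one₀ hδ.le (by linarith)
    _ = _ := mul_one _

lemma eventually_mul_le {C c : ℝ} (hC : 0 ≤ C) (hc : 0 < c) :
    ∀ᶠ δ in 𝓝[>] (0 : ℝ), C * δ ≤ c := by
  filter_upwards [eventually_le (c := c / (C + 1)) (by positivity), eventually_pos] with δ h h0
  rw [le_div_iff₀ (by positivity)] at h
  linarith

lemma eventually_mul_tiny_le {C c : ℝ} (hC : 0 ≤ C) (hc : 0 < c) :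
    ∀ᶠ δ in 𝓝[>] (0 : ℝ), C * tiny δ ≤ c := by
  filter_upwards [eventually_mul_le (mul_nonneg hC growthC_pos.le) hc, eventually_pos,
    eventually_le (c := 1 / 16) (by norm_num)] with δ h h0 h1
  calc C * tiny δ ≤ C * (growthC * δ) := by
        gcongr
        exact tiny_le h0 h1
    _ = C * growthC * δ := by ring
    _ ≤ c := h

theorem eventually_admissible (hβ₁ : 0 < β₁) (hη : 0 < η) {μ : ℝ → ℝ}
    (hμ : IsRadius β₁ β₂ μ) :
    ∀ᶠ δ in 𝓝[>] (0 : ℝ), Admissible β₁ β₂ η δ (μ δ ^ 2) ∧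
      2 * selfC β₁ β₂ η * tiny δ ≤ μ δ ^ 2 := by
  have hμ2 : Tendsto (fun δ => μ δ ^ 2) (𝓝[>] 0) (𝓝 0) := by simpa using hμ.1.pow 2
  have hr : ∀ c > 0, ∀ᶠ δ in 𝓝[>] (0 : ℝ), μ δ ^ 2 ≤ c := fun c hc =>
    hμ2.eventually (eventually_le_nhds hc)
  have k1 := leadC_pos hβ₁
  have k2 := convC_nonneg β₂
  have k3 := ballC_pos β₁
  have k4 := lowC_pos η
  have k5 := remC_pos hβ₁
  have k6 := sqC_nonneg β₁ β₂
  have k7 := parC_pos hβ₁ β₂ η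
  have k8 := stabC_pos hβ₁ β₂ η
  have k9 := selfC_nonneg hβ₁ β₂ η
  have kl : 0 ≤ leadC β₁ * (2 * convC β₂ * ballC β₁ * Real.exp β₁) := by positivity
  -- Only nonnegativity of the constants `cl` and `cs` is at hand, hence the denominators `cl + 1`
  -- and `cs + 1`.
  set cl := leadC β₁ * (2 * convC β₂ * ballC β₁ * Real.exp β₁) with hcl
  set cs := 2 * selfC β₁ β₂ η * (72000000000 * 25) with hcs
  have hcs0 : 0 ≤ cs := by positivity
  filter_upwards [eventually_pos, eventually_le (c := 1 / 16) (by norm_num),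
    eventually_mul_le (C := 1) zero_le_one (c := (1 / (2 * η)) ^ 2) (by positivity),
    hr 1 one_pos, hr (lowC η / 2 / (cl + 1)) (by positivity),
    eventually_mul_tiny_le (C := remC β₁ * sqC β₁ β₂) (by positivity) (momLow_pos η),
    eventually_mul_tiny_le (C := 1) zero_le_one one_pos,
    eventually_mul_tiny_le (C := parC β₁ β₂ η) k7.le hη,
    eventually_mul_tiny_le (C := stabC β₁ β₂ η * (sqC β₁ β₂ * (64 * (1 + 4 / β₁))))
      (by positivity) (c := 1 / 2) (by norm_num),
    hμ.2.1.def (c := 1 / (cs + 1)) (by positivity)]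
    with δ h0 h1 h2 h3 h4 h5 h6 h7 h8 h9
  have hs : Small η δ := by
    refine ⟨h0, h1, hη.le, ?_⟩
    have : √δ ≤ 1 / (2 * η) := Real.sqrt_le_iff.2 ⟨by positivity, by linarith⟩
    calc η * √δ ≤ η * (1 / (2 * η)) := by gcongr
      _ = 1 / 2 := by field_simp
  have hK := Real.exp_pos (expo δ 0 1)
  have hδs : δ ≤ √δ := by
    rw [Real.le_sqrt' h0]
    nlinarith
  refine ⟨{ toSmall := hs, r_nonneg := sq_nonneg _, r_le := h3, lead_le := ?_, rem_le := h5,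
            tiny_le := by linarith, par_le := ?_, stab_le := h8 }, ?_⟩
  · rw [le_div_iff₀ (by positivity)] at h4
    have := sq_nonneg (μ δ)
    calc _ = μ δ ^ 2 * cl := by rw [hcl]; ring
      _ ≤ _ := by linarith
  -- Since 1/exp E(1) = δ · `tiny δ` and δ ≤ √δ, the parameters fall far inside the box.
  · calc parC β₁ β₂ η / Real.exp (expo δ 0 1) = parC β₁ β₂ η * tiny δ * δ := by
          rw [tiny_eq]
          field_simp
      _ ≤ η * √δ := mul_le_mul h7 hδs h0.le hη.le
  · have hK1 := K₁_pos h0 h1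
    rw [Real.norm_of_nonneg (by positivity), Real.norm_of_nonneg (sq_nonneg _)] at h9
    have h10 := exp_expo_le_K₁ h0 h1
    calc 2 * selfC β₁ β₂ η * tiny δ ≤
          2 * selfC β₁ β₂ η * (72000000000 * (25 * (1 / (δ * K₁ δ)))) := by
          unfold tiny
          gcongr
      _ = cs * (1 / (δ * K₁ δ)) := by rw [hcs]; ring
      _ ≤ cs * (1 / (cs + 1) * μ δ ^ 2) := by gcongr
      _ = cs / (cs + 1) * μ δ ^ 2 := by ring
      _ ≤ 1 * μ δ ^ 2 := by
          gcongr
          rw [div_le_one (by positivity)]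
          linarith
      _ = _ := one_mul _

end

end LSW

theorem mainTheorem5 (β₁ β₂ : ℝ) (hβ₁ : 0 < β₁) (hβ₂ : 1 < β₂) :
    (∃ μ : ℝ → ℝ, LSW.IsRadius β₁ β₂ μ) ∧
    ∀ μ : ℝ → ℝ, LSW.IsRadius β₁ β₂ μ → ∀ η : ℝ, 0 < η →
      ∃ L : ℝ → ℝ, Tendsto L (𝓝[>] 0) (𝓝 0) ∧
        ∀ᶠ δ in 𝓝[>] (0 : ℝ),
          LSW.phiLSW ∈ LSW.Y β₁ β₂ μ δ ∧
          LSW.zBall β₁ β₂ LSW.phiLSW (μ δ ^ 2 / 2) ⊆ LSW.Y β₁ β₂ μ δ ∧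
          LSW.Y β₁ β₂ μ δ ⊆ LSW.zBall β₁ β₂ LSW.phiLSW (2 * μ δ ^ 2) ∧
          (∀ Φ ∈ LSW.Y β₁ β₂ μ δ, ∃! p : ℝ × ℝ, LSW.IsCompatible η δ Φ p) ∧
          (∀ Φ ∈ LSW.Y β₁ β₂ μ δ, LSW.opIbar η δ Φ ∈ LSW.Y β₁ β₂ μ δ) ∧
          ∀ Φ₁ ∈ LSW.Y β₁ β₂ μ δ, ∀ Φ₂ ∈ LSW.Y β₁ β₂ μ δ,
            LSW.zNorm β₁ β₂ (LSW.opIbar η δ Φ₂ - LSW.opIbar η δ Φ₁) ≤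
              ENNReal.ofReal (L δ) * LSW.zNorm β₁ β₂ (Φ₂ - Φ₁) := by
  -- The actual Lipschitz constant is a multiple of `tiny δ`; its crude bound by a multiple of δ is
  -- a convenient choice of L.
  refine ⟨LSW.exists_isRadius β₁ β₂, fun μ hμ η hη =>
    ⟨fun δ => LSW.lipC β₁ β₂ η * (LSW.growthC * δ), ?_, ?_⟩⟩
  · have : Tendsto (fun δ : ℝ => LSW.lipC β₁ β₂ η * (LSW.growthC * δ)) (𝓝 0)
        (𝓝 (LSW.lipC β₁ β₂ η * (LSW.growthC * 0))) :=
      (Continuous.tendsto (by fun_prop) 0)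
    rw [mul_zero, mul_zero] at this
    exact this.mono_left nhdsWithin_le_nhds
  · filter_upwards [LSW.eventually_ball_subset hμ, LSW.eventually_admissible hβ₁ hη hμ]
      with δ h1 h2
    obtain ⟨h2, h3⟩ := h2
    refine ⟨h1.1, h1.2.1, h1.2.2, fun Φ hΦ => LSW.existsUnique_isCompatible hβ₁ hβ₂ h2 hΦ,
      fun Φ hΦ => LSW.opIbar_mem hβ₁ hβ₂ h2 h3 hΦ, fun Φ₁ hΦ₁ Φ₂ hΦ₂ => ?_⟩
    refine (LSW.zNorm_opIbar_sub_le hβ₁ hβ₂ h2 hΦ₂ hΦ₁).trans ?_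
    gcongr
    · exact LSW.lipC_nonneg hβ₁ β₂ η
    · exact LSW.tiny_le h2.pos h2.le
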